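/- **Setup.** Let $n\ge 1$ and $k\ge 0$ be integers and let $R$ be a commutative ring. Let $V(n,k)$ be the set of $k$-element subsets ("I-states") $x$ of $\{0,\dots,n\}$ and let $V_l(n,k)=\{x\in V(n,k): n\notin x\}$. For $x\in V(n,k)$ and $1\le i\le n$ put $v^x_i=|x\cap\{i,\dots,n\}|$, and for $x,y,z\in V(n,k)$ let $w^{x,y}_i=\tfrac12|v^x_i-v^y_i|$ and $g^{x,y,z}=w^{y,z}-w^{x,z}+w^{x,y}\in\mathbb Z_{\ge0}^n$. Let $\mathcal B_0(n,k)$ be the $R[U_1,\dots,U_n]$-algebra that is free as a module on the elements $f_{x,y}$, $x,y\in V(n,k)$, with $f_{x,y}f_{y,z}=U^{g^{x,y,z}}f_{x,z}$, and $f_{x,y}f_{y',z}=0$ for $y\ne y'$; put $I_x=f_{x,x}$. For $1\le i\le n$ let $R_i$ be the sum of the $f_{x,y}$ with $x\cap\{i-1,i\}=\{i-1\}$ and $y=(x\setminus\{i-1\})\cup\{i\}$, and let $L_i$ be the sum of the $f_{y,x}$ over the same pairs. Let $\mathcal B(n,k)$ be the quotient of $\mathcal B_0(n,k)$ by the two-sided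 ideal generated by all $R_{i-1}R_i$ and $L_iL_{i-1}$, and all $U_iI_x$ with $x\cap\{i-1,i\}=\varnothing$. The Ozsváth–Szabó algebra, with coefficients in $R$, is $$B_l^R(n,k)=\Big(\sum_{x\in V_l(n,k)}I_x\Big)\,\mathcal B(n,k)\,\Big(\sum_{x\in V_l(n,k)}I_x\Big).$$ It is graded by $\deg U_i=2$ and $\deg f_{x,y}=\sum_i|v^x_i-v^y_i|$. Let $P(x)=B_l^R(n,k)I_x$ for $x\in V_l(n,k)$; modules are graded left modules. Let $e_k^\vee=\sum_{x\in V_l(n,k),\,0\notin x}I_x$. There is an additive and multiplicative map $\psi\colon B_l^R(n,k+1)\to B_l^R(n,k)$ that is $R[U_1,\dots,U_n]$-linear, sends $f_{x,y}$ to $f_{x\setminus\{0\},\,y\setminus\{0\}}$ if $0\in x\cap y$ and to $0$ otherwise, and sends $1$ to $e_k^\vee$. Let $\mathbf F_k=B_l^R(n,k)e_k^\vee$, a $(B_l^R(n,k),B_l^R(n,k+1))$-bimodule with the right action $p\cdot b=p\,\psi(b)$. Let $\mathcal F_k=\mathbf F_k\otimes_{B_l^R(n,k+1)}-$, a functor from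 finitely generated projective graded $B_l^R(n,k+1)$-modules to finitely generated projective graded $B_l^R(n,k)$-modules. Let $K_0(B_l^R(n,k))$ be the Grothendieck group of finitely generated projective graded $B_l^R(n,k)$-modules, a module over $\mathbb Z[q,q^{-1}]$ with $q^i[M]=[q^iM]$, where $q^iM$ is $M$ with its degrees shifted upwards by $i$. Let $U_q(\mathfrak{gl}(1|1))$ be the superalgebra over $\mathbb C(q)$ with even generators $K_1^{\pm1},K_2^{\pm1}$, odd generators $E,F$, and the relations that $K_1,K_2$ commute, $K_1E=qEK_1$, $K_2E=q^{-1}EK_2$, $K_1F=q^{-1}FK_1$, $K_2F=qFK_2$, $E^2=F^2=0$, $EF+FE=(K-K^{-1})/(q-q^{-1})$, where $K=K_1K_2$. Its comultiplication is $\Delta(E)=E\otimes K^{-1}+1\otimes E$, $\Delta(F)=F\otimes1+K\otimes F$, $\Delta(K_i)=K_i\otimes K_i$. Let $V$ be its vector representation with basis $v_0$ (even, of weight $\epsilon_1$) and $v_1$ (odd, of weight $\epsilon_2$), so that $K_1,K_2$ act on $v_0$ by $q,1$ and on $v_1$ by $1,q$, and $Fv_0=v_1$, $Ev_1=v_0$,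 $Fv_1=Ev_0=0$. Let $(V^{\otimes n})_k$ be the subspace of $V^{\otimes n}$ on which $K_1$ acts as $q^k$ and $K_2$ acts as $q^{n-k}$. Write $e_{i_k}\wedge\dots\wedge e_{i_1}$ (with $i_k>\dots>i_1$) for the standard basis vector of $V^{\otimes n}$ with $v_0$ in the positions $i_1,\dots,i_k$ and $v_1$ in the other positions; put $\ell_1=e_1$ and $\ell_i=e_i+q\,e_{i-1}$ for $2\le i\le n$. For $x=\{x_1<\dots<x_k\}\in V_l(n,k)$ let $v_x^\diamondsuit=\ell_{x_k+1}\wedge\dots\wedge\ell_{x_1+1}$ be the corresponding canonical basis vector. **Theorem.** Let $n\ge1$. 1. For every commutative ring $R$ and every $k\ge0$, $\mathbf F_k\otimes_{B_l^R(n,k+1)}\mathbf F_{k+1}=0$, and $\mathcal F_k\circ\mathcal F_{k+1}=0$. 2. For every commutative ring $R$, every $k\ge 0$ and every $x\in V_l(n,k+1)$, there is a graded isomorphism of degree $0$, $\mathcal F_k(P(x))\cong P(x\setminus\{0\})$, if $0\in x$; and $\mathcal F_k(P(x))=0$ if $0\notin x$. 3. Let $\Bbbk$ be a field. There is exactly one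 family of $\mathbb C(q)$-linear isomorphisms $\Phi_k\colon \mathbb C(q)\otimes_{\mathbb Z[q,q^{-1}]}K_0(B_l^{\Bbbk}(n,k))\to(V^{\otimes n})_k$, $k\ge0$, with $\Phi_k(1\otimes[P(x)])=v_x^\diamondsuit$ for all $k$ and all $x\in V_l(n,k)$. Under this identification, the map induced by $\mathcal F_k$ is the action of the generator $F$: for every $k\ge 0$ and every $z\in\mathbb C(q)\otimes_{\mathbb Z[q,q^{-1}]}K_0(B_l^{\Bbbk}(n,k+1))$, $$\Phi_k\big((\mathrm{id}\otimes K_0(\mathcal F_k))(z)\big)=F\cdot\Phi_{k+1}(z).$$ -/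

import Mathlib

set_option linter.unusedSectionVars false

namespace OSz

noncomputable section

/-- `V(n,k)`: the I-states, i.e. the `k`-element subsets of `{0, …, n}`. -/
abbrev IState (n k : ℕ) : Type := ↥((Finset.range (n + 1)).powersetCard k)

/-- The coordinate of `v^x` at the line between the regions `i` and `i + 1` (the `(i+1)`-st line):
the number of elements of `x` lying in `{i+1, …, n}`. -/
def vvec {n k : ℕ} (x : IState n k) (i : ℕ) : ℕ := (x.1.filter (fun a => i < a)).card

/-- Twice the coordinate of `w^{x,y}` at the `(i+1)`-st line, i.e. `|v^x - v^y|`. -/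
def vdist {n k : ℕ} (x y : IState n k) (i : ℕ) : ℕ := ((vvec x i : ℤ) - (vvec y i : ℤ)).natAbs

/-- The exponent vector `g^{x,y,z} = w^{y,z} - w^{x,z} + w^{x,y}`. It is a vector of natural numbers:
the subtraction never truncates and the division is exact (see `two_mul_gvec`). -/
def gvec {n k : ℕ} (x y z : IState n k) : Fin n →₀ ℕ :=
  Finsupp.equivFunOnFinite.symm fun i => (vdist y z i + vdist x y i - vdist x z i) / 2

/-- The `q`-degree of `f_{x,y}`, i.e. `∑ i, |v_i^x - v_i^y|`. -/
def fdeg {n k : ℕ} (x y : IState n k) : ℕ := ∑ i : Fin n, vdist x y i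

theorem two_mul_gvec {n k : ℕ} (x y z : IState n k) (i : Fin n) :
    2 * gvec x y z i + vdist x z i = vdist y z i + vdist x y i := by
  simp only [gvec, vdist, Finsupp.equivFunOnFinite_symm_apply_apply]
  omega

theorem gvec_assoc {n k : ℕ} (x y z w : IState n k) :
    gvec x y z + gvec x z w = gvec y z w + gvec x y w := by
  ext i
  have h1 := two_mul_gvec x y z i
  have h2 := two_mul_gvec x z w i
  have h3 := two_mul_gvec y z w i
  have h4 := two_mul_gvec x y w i
  simp only [Finsupp.add_apply]
  omega

theorem gvec_left {n k : ℕ} (x y : IState n k) : gvec x x y = 0 := by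
  ext i
  have h1 := two_mul_gvec x x y i
  have : vdist x x i = 0 := by simp [vdist]
  simp only [Finsupp.zero_apply]
  omega

theorem gvec_right {n k : ℕ} (x y : IState n k) : gvec x y y = 0 := by
  ext i
  have h1 := two_mul_gvec x y y i
  have : vdist y y i = 0 := by simp [vdist]
  simp only [Finsupp.zero_apply]
  omega

theorem degree_gvec {n k : ℕ} (x y z : IState n k) :
    2 * (gvec x y z).degree + fdeg x z = fdeg y z + fdeg x y := by
  simp only [Finsupp.degree_eq_sum, fdeg, Finset.mul_sum, ← Finset.sum_add_distrib]
  exact Finset.sum_congr rfl fun i _ => two_mul_gvec x y z i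

universe u

variable (R : Type u) [CommRing R] (n k : ℕ)

/-- The `R[U_1, …, U_n]`-algebra `B_0(n,k)`: it is free over `R[U_1, …, U_n]` on the elements
`f_{x,y}`, for `x` and `y` in `V(n,k)`, with `f_{x,y} f_{y,z} = U^{g^{x,y,z}} f_{x,z}`, all the other
products of the `f`'s being zero. An element is given by its coefficients. -/
@[ext] structure BZero : Type u where
  coeff : IState n k → IState n k → MvPolynomial (Fin n) R

variable {R n k}

namespace BZero

/-- An element as a matrix of polynomials. -/
def equivFun : BZero R n k ≃ (IState n k → IState n k → MvPolynomial (Fin n) R) where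
  toFun := coeff
  invFun := mk
  left_inv _ := rfl
  right_inv _ := rfl

instance : AddCommGroup (BZero R n k) := equivFun.addCommGroup

instance : Module (MvPolynomial (Fin n) R) (BZero R n k) := equivFun.module _

@[simp] theorem coeff_zero (x y : IState n k) : (0 : BZero R n k).coeff x y = 0 := rfl
@[simp] theorem coeff_add (a b : BZero R n k) (x y : IState n k) :
    (a + b).coeff x y = a.coeff x y + b.coeff x y := rfl
@[simp] theorem coeff_neg (a : BZero R n k) (x y : IState n k) :
    (-a).coeff x y = -a.coeff x y := rfl
@[simp] theorem coeff_smul (p : MvPolynomial (Fin n) R) (a : BZero R n k) (x y : IState n k) :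
    (p • a).coeff x y = p * a.coeff x y := rfl

instance : Mul (BZero R n k) where
  mul a b := ⟨fun x z => ∑ y, MvPolynomial.monomial (gvec x y z) 1 * (a.coeff x y * b.coeff y z)⟩

instance : One (BZero R n k) where
  one := ⟨fun x y => if x = y then 1 else 0⟩

theorem coeff_mul (a b : BZero R n k) (x z : IState n k) : (a * b).coeff x z =
    ∑ y, MvPolynomial.monomial (gvec x y z) 1 * (a.coeff x y * b.coeff y z) := rfl

theorem coeff_one (x y : IState n k) :
    (1 : BZero R n k).coeff x y = if x = y then 1 else 0 := rfl

instance : Ring (BZero R n k) :=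
  { (inferInstance : AddCommGroup (BZero R n k)) with
    mul := (· * ·)
    one := 1
    left_distrib := fun a b c => by
      ext1; funext x z
      simp only [coeff_mul, coeff_add, mul_add, Finset.sum_add_distrib]
    right_distrib := fun a b c => by
      ext1; funext x z
      simp only [coeff_mul, coeff_add, mul_add, add_mul, Finset.sum_add_distrib]
    zero_mul := fun a => by
      ext1; funext x z
      simp [coeff_mul]
    mul_zero := fun a => by
      ext1; funext x z
      simp [coeff_mul]
    one_mul := fun a => by
      ext1; funext x z
      rw [coeff_mul, Finset.sum_eq_single x]
      · rw [gvec_left]; simp [coeff_one]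
      · intro y _ hy; simp [coeff_one, hy.symm]
      · simp
    mul_one := fun a => by
      ext1; funext x z
      rw [coeff_mul, Finset.sum_eq_single z]
      · rw [gvec_right]; simp [coeff_one]
      · intro y _ hy; simp [coeff_one, hy]
      · simp
    mul_assoc := fun a b c => by
      ext1; funext x w
      simp only [coeff_mul, Finset.mul_sum, Finset.sum_mul]
      rw [Finset.sum_comm]
      refine Finset.sum_congr rfl fun y _ => Finset.sum_congr rfl fun z _ => ?_
      have h : (MvPolynomial.monomial (gvec x y z) (1 : R)) * MvPolynomial.monomial (gvec x z w) 1
          = MvPolynomial.monomial (gvec y z w) 1 * MvPolynomial.monomial (gvec x y w) 1 := by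
        rw [MvPolynomial.monomial_mul, MvPolynomial.monomial_mul, gvec_assoc]
      linear_combination (a.coeff x y * b.coeff y z * c.coeff z w) * h }

instance : Algebra (MvPolynomial (Fin n) R) (BZero R n k) :=
  Algebra.ofModule
    (fun r a b => by
      ext1; funext x z
      simp only [coeff_mul, coeff_smul, Finset.mul_sum]
      exact Finset.sum_congr rfl fun _ _ => by ring)
    (fun r a b => by
      ext1; funext x z
      simp only [coeff_mul, coeff_smul, Finset.mul_sum]
      exact Finset.sum_congr rfl fun _ _ => by ring)

/-- The element `p f_{x,y}`, for a polynomial `p` in the `U_i`. -/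
def pf (x y : IState n k) : MvPolynomial (Fin n) R →+ BZero R n k where
  toFun p := ⟨fun a b => if a = x ∧ b = y then p else 0⟩
  map_zero' := by ext1; funext a b; simp
  map_add' p q := by ext1; funext a b; simp only [coeff_add]; split_ifs <;> simp

/-- The generator `f_{x,y}`. -/
def f (x y : IState n k) : BZero R n k := pf x y 1

theorem coeff_pf (x y a b : IState n k) (p : MvPolynomial (Fin n) R) :
    (pf x y p).coeff a b = if a = x ∧ b = y then p else 0 := rfl

theorem pf_mul_pf (x y y' z : IState n k) (p p' : MvPolynomial (Fin n) R) :
    pf x y p * pf y' z p' =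
      if y = y' then pf x z (MvPolynomial.monomial (gvec x y z) 1 * (p * p')) else 0 := by
  ext1; funext a b
  rw [coeff_mul, Finset.sum_eq_single y]
  · by_cases h : y = y'
    · subst h
      by_cases ha : a = x <;> by_cases hb : b = z <;> simp [coeff_pf, ha, hb]
    · simp [coeff_pf, h]
  · intro c _ hc; simp [coeff_pf, hc]
  · simp

/-- The defining relation. -/
theorem f_mul_f (x y z : IState n k) :
    (f x y * f y z : BZero R n k) = MvPolynomial.monomial (gvec x y z) (1 : R) • f x z := by
  rw [f, f, f, pf_mul_pf, if_pos rfl]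
  ext1; funext a b
  simp only [coeff_pf, coeff_smul]
  split_ifs <;> simp

theorem eq_sum (a : BZero R n k) : a = ∑ x, ∑ y, pf x y (a.coeff x y) := by
  have hs : ∀ (ι : Type) (s : Finset ι) (g : ι → BZero R n k) (c d : IState n k),
      (∑ i ∈ s, g i).coeff c d = ∑ i ∈ s, (g i).coeff c d := by
    intro ι s g c d
    classical
    induction s using Finset.induction_on with
    | empty => simp
    | insert i s hi ih => simp [Finset.sum_insert hi, ih]
  ext1; funext c d
  rw [hs, Finset.sum_eq_single c, hs, Finset.sum_eq_single d]
  · simp [coeff_pf]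
  · intro b _ hb; simp [coeff_pf, hb.symm]
  · simp
  · intro b _ hb; rw [hs]; simp [coeff_pf, hb.symm]
  · simp

theorem coeff_sum {ι : Type*} (s : Finset ι) (g : ι → BZero R n k) (c d : IState n k) :
    (∑ i ∈ s, g i).coeff c d = ∑ i ∈ s, (g i).coeff c d := by
  classical
  induction s using Finset.induction_on with
  | empty => simp
  | insert i s hi ih => simp [Finset.sum_insert hi, ih]

/-- `x ∩ {i, i+1} = {i}` and `y = (x \ {i}) ∪ {i+1}`. -/
def StepR (i : ℕ) (x y : IState n k) : Prop :=
  i ∈ x.1 ∧ i + 1 ∉ x.1 ∧ y.1 = insert (i + 1) (x.1.erase i)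

/-- `x ∩ {i, i+1} = {i+1}` and `y = (x \ {i+1}) ∪ {i}`. -/
def StepL (i : ℕ) (x y : IState n k) : Prop :=
  i + 1 ∈ x.1 ∧ i ∉ x.1 ∧ y.1 = insert i (x.1.erase (i + 1))

instance (i : ℕ) (x y : IState n k) : Decidable (StepR i x y) := by unfold StepR; infer_instance

instance (i : ℕ) (x y : IState n k) : Decidable (StepL i x y) := by unfold StepL; infer_instance

/-- The element `R_{i+1}`. -/
def elR (i : Fin n) : BZero R n k := ∑ x, ∑ y, if StepR i x y then f x y else 0

/-- The element `L_{i+1}`. -/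
def elL (i : Fin n) : BZero R n k := ∑ x, ∑ y, if StepL i x y then f x y else 0

/-- The generators of the ideal that defines `B(n,k)`: the products `R_{i-1} R_i` and `L_i L_{i-1}`,
and the elements `U_i I_x` with `x ∩ {i-1, i} = ∅`. -/
inductive Rel : BZero R n k → Prop
  | RR (i j : Fin n) (h : (j : ℕ) = i + 1) : Rel (elR i * elR j)
  | LL (i j : Fin n) (h : (j : ℕ) = i + 1) : Rel (elL j * elL i)
  | U (i : Fin n) (x : IState n k) (h : (i : ℕ) ∉ x.1) (h' : (i : ℕ) + 1 ∉ x.1) :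
      Rel ((MvPolynomial.X i : MvPolynomial (Fin n) R) • f x x)

variable (R n k) in
/-- The two-sided ideal generated by the relations. -/
def relIdeal : Ideal (BZero R n k) := (TwoSidedIdeal.span {a | Rel a}).asIdeal

instance : (relIdeal R n k).IsTwoSided := inferInstanceAs (TwoSidedIdeal.asIdeal _).IsTwoSided

theorem pf_eq (x y : IState n k) (p : MvPolynomial (Fin n) R) : pf x y p = p • f x y := by
  ext1; funext a b
  simp only [f, coeff_pf, coeff_smul]
  split_ifs <;> simp

theorem f_mul_f_ne {x y y' z : IState n k} (h : y ≠ y') : (f x y * f y' z : BZero R n k) = 0 := by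
  rw [f, f, pf_mul_pf, if_neg h]

theorem eq_sum' (a : BZero R n k) :
    a = ∑ x : IState n k, ∑ y : IState n k, a.coeff x y • f x y := by
  conv_lhs => rw [eq_sum a]
  simp only [pf_eq]

/-- Induction over the basis. -/
theorem induction_f {K : AddSubgroup (BZero R n k)}
    (h : ∀ (x y : IState n k) (p : MvPolynomial (Fin n) R), p • f x y ∈ K) (a : BZero R n k) : a ∈ K := by
  rw [eq_sum' a]
  exact sum_mem fun x _ => sum_mem fun y _ => h _ _ _

/-- The terms of the generating relations between two given I-states. -/
inductive ElRel : IState n k → IState n k → BZero R n k → Prop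
  | RR (i j : Fin n) (h : (j : ℕ) = i + 1) (x y z : IState n k)
      (h1 : StepR i x y) (h2 : StepR j y z) :
      ElRel x z (f x y * f y z)
  | LL (i j : Fin n) (h : (j : ℕ) = i + 1) (x y z : IState n k)
      (h1 : StepL j x y) (h2 : StepL i y z) :
      ElRel x z (f x y * f y z)
  | U (i : Fin n) (x : IState n k) (h : (i : ℕ) ∉ x.1) (h' : (i : ℕ) + 1 ∉ x.1) :
      ElRel x x ((MvPolynomial.X i : MvPolynomial (Fin n) R) • f x x)

theorem f_self_mul (x y z : IState n k) : (f x x * f y z : BZero R n k) =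
    if x = y then f y z else 0 := by
  split_ifs with h
  · subst h; rw [f_mul_f, gvec_left]; simp
  · exact f_mul_f_ne h

theorem f_mul_self (x y z : IState n k) : (f x y * f z z : BZero R n k) =
    if y = z then f x y else 0 := by
  split_ifs with h
  · subst h; rw [f_mul_f, gvec_right]; simp
  · exact f_mul_f_ne h

theorem sum_mul_sum_aux (P Q : IState n k → IState n k → Prop) [∀ x y, Decidable (P x y)]
    [∀ x y, Decidable (Q x y)] :
    (∑ x, ∑ y, if P x y then (f x y : BZero R n k) else 0) *
      (∑ x, ∑ y, if Q x y then f x y else 0) =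
    ∑ x, ∑ y, ∑ z, if P x y ∧ Q y z then f x y * f y z else 0 := by
  rw [Finset.sum_mul]
  refine Finset.sum_congr rfl fun x _ => ?_
  rw [Finset.sum_mul]
  refine Finset.sum_congr rfl fun y _ => ?_
  rw [Finset.mul_sum, Finset.sum_eq_single y]
  · rw [Finset.mul_sum]
    refine Finset.sum_congr rfl fun z _ => ?_
    by_cases h1 : P x y <;> by_cases h2 : Q y z <;> simp [h1, h2]
  · intro y' _ hy
    rw [Finset.mul_sum]
    refine Finset.sum_eq_zero fun z _ => ?_
    split_ifs <;> simp [f_mul_f_ne (Ne.symm hy)]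
  · simp

theorem step_unique {y z : IState n k} {s : Finset ℕ} (h : y.1 = s) (h' : z.1 = s) : y = z :=
  Subtype.ext (h.trans h'.symm)

theorem ElRel.mem {x z : IState n k} {e : BZero R n k} (h : ElRel x z e) :
    e ∈ relIdeal R n k := by
  have key : ∀ r : BZero R n k, Rel r → r ∈ relIdeal R n k := fun r hr =>
    TwoSidedIdeal.subset_span hr
  induction h with
  | RR i j h x y z h1 h2 =>
    have h3 := (relIdeal R n k).mul_mem_left (f x x) (key _ (Rel.RR i j h))
    convert h3 using 1
    rw [elR, elR, sum_mul_sum_aux]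
    simp only [Finset.mul_sum]
    rw [Finset.sum_eq_single x, Finset.sum_eq_single y, Finset.sum_eq_single z]
    · rw [if_pos ⟨h1, h2⟩, ← mul_assoc, f_self_mul, if_pos rfl]
    · intro z' _ hz
      rw [if_neg, mul_zero]
      rintro ⟨-, -, -, h4⟩
      exact hz (step_unique h4 h2.2.2)
    · simp
    · intro y' _ hy
      refine Finset.sum_eq_zero fun z _ => ?_
      rw [if_neg, mul_zero]
      rintro ⟨⟨-, -, h4⟩, -⟩
      exact hy (step_unique h4 h1.2.2)
    · simp
    · intro x' _ hx
      refine Finset.sum_eq_zero fun y _ => Finset.sum_eq_zero fun z _ => ?_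
      split_ifs
      · rw [← mul_assoc, f_self_mul, if_neg hx.symm, zero_mul]
      · simp
    · simp
  | LL i j h x y z h1 h2 =>
    have h3 := (relIdeal R n k).mul_mem_left (f x x) (key _ (Rel.LL i j h))
    convert h3 using 1
    rw [elL, elL, sum_mul_sum_aux]
    simp only [Finset.mul_sum]
    rw [Finset.sum_eq_single x, Finset.sum_eq_single y, Finset.sum_eq_single z]
    · rw [if_pos ⟨h1, h2⟩, ← mul_assoc, f_self_mul, if_pos rfl]
    · intro z' _ hz
      rw [if_neg, mul_zero]
      rintro ⟨-, -, -, h4⟩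
      exact hz (step_unique h4 h2.2.2)
    · simp
    · intro y' _ hy
      refine Finset.sum_eq_zero fun z _ => ?_
      rw [if_neg, mul_zero]
      rintro ⟨⟨-, -, h4⟩, -⟩
      exact hy (step_unique h4 h1.2.2)
    · simp
    · intro x' _ hx
      refine Finset.sum_eq_zero fun y _ => Finset.sum_eq_zero fun z _ => ?_
      split_ifs
      · rw [← mul_assoc, f_self_mul, if_neg hx.symm, zero_mul]
      · simp
    · simp
  | U i x h h' => exact key _ (Rel.U i x h h')

/-- An additive subgroup that contains the following elements contains the ideal. -/
theorem relIdeal_le {K : AddSubgroup (BZero R n k)}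
    (hK : ∀ (x z a b : IState n k) (e : BZero R n k) (p : MvPolynomial (Fin n) R),
      ElRel x z e → p • (f a x * e * f z b) ∈ K) :
    ∀ a ∈ relIdeal R n k, a ∈ K := by
  have key : ∀ (s : BZero R n k), Rel s → ∀ (a x z b : IState n k) (p : MvPolynomial (Fin n) R),
      p • (f a x * s * f z b) ∈ K := by
    have aux : ∀ (a x x' y' z' z b : IState n k) (p : MvPolynomial (Fin n) R),
        (ElRel (R := R) x' z' (f x' y' * f y' z')) →
        p • (f a x * (f x' y' * f y' z') * f z b) ∈ K := by
      intro a x x' y' z' z b p h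
      by_cases h1 : x = x'
      · by_cases h2 : z' = z
        · subst h1 h2; exact hK _ _ _ _ _ _ h
        · rw [mul_assoc (f a x), mul_assoc (f x' y'), f_mul_f_ne h2]; simp
      · rw [← mul_assoc (f a x), f_mul_f_ne h1]; simp
    intro s hs a x z b p
    cases hs with
    | RR i j h =>
      rw [elR, elR, sum_mul_sum_aux]
      simp only [Finset.mul_sum, Finset.sum_mul, Finset.smul_sum]
      refine sum_mem fun x' _ => sum_mem fun y' _ => sum_mem fun z' _ => ?_
      split_ifs with h1
      · exact aux _ _ _ _ _ _ _ _ (ElRel.RR i j h _ _ _ h1.1 h1.2)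
      · simp
    | LL i j h =>
      rw [elL, elL, sum_mul_sum_aux]
      simp only [Finset.mul_sum, Finset.sum_mul, Finset.smul_sum]
      refine sum_mem fun x' _ => sum_mem fun y' _ => sum_mem fun z' _ => ?_
      split_ifs with h1
      · exact aux _ _ _ _ _ _ _ _ (ElRel.LL i j h _ _ _ h1.1 h1.2)
      · simp
    | U i x' h h' =>
      by_cases h1 : x = x'
      · by_cases h2 : x' = z
        · subst h1 h2; exact hK _ _ _ _ _ _ (ElRel.U i _ h h')
        · rw [mul_assoc (f a x), smul_mul_assoc, f_mul_f_ne h2]; simp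
      · rw [mul_smul_comm, f_mul_f_ne h1]; simp
  intro a ha
  have ha' : a ∈ TwoSidedIdeal.span {a : BZero R n k | Rel a} := ha
  rw [TwoSidedIdeal.mem_span_iff_mem_addSubgroup_closure] at ha'
  refine (AddSubgroup.closure_le K).2 ?_ ha'
  rintro _ ⟨_, ⟨A, -, s, hs, rfl⟩, B, -, rfl⟩
  simp only [SetLike.mem_coe]
  rw [eq_sum' A, eq_sum' B]
  simp only [Finset.sum_mul, Finset.mul_sum]
  refine sum_mem fun x _ => sum_mem fun y _ => sum_mem fun z _ => sum_mem fun w _ => ?_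
  rw [smul_mul_assoc, smul_mul_assoc, mul_smul_comm, smul_smul]
  exact key s hs _ _ _ _ _

/-! The map that forgets the element `0` of the I-states. -/

/-- `x ∪ {0}`. -/
def addZero (x : IState n k) (h : 0 ∉ x.1) : IState n (k + 1) :=
  ⟨insert 0 x.1, by
    have hx := Finset.mem_powersetCard.1 x.2
    refine Finset.mem_powersetCard.2 ⟨?_, by rw [Finset.card_insert_of_notMem h, hx.2]⟩
    exact Finset.insert_subset (by simp) hx.1⟩

/-- `x \ {0}`. -/
def removeZero (x : IState n (k + 1)) (h : 0 ∈ x.1) : IState n k :=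
  ⟨x.1.erase 0, by
    have hx := Finset.mem_powersetCard.1 x.2
    refine Finset.mem_powersetCard.2 ⟨(Finset.erase_subset _ _).trans hx.1, ?_⟩
    rw [Finset.card_erase_of_mem h, hx.2]; rfl⟩

theorem removeZero_addZero (x : IState n k) (h : 0 ∉ x.1) :
    removeZero (addZero x h) (by simp [addZero]) = x :=
  Subtype.ext (by simp [removeZero, addZero, h])

theorem addZero_removeZero (x : IState n (k + 1)) (h : 0 ∈ x.1) :
    addZero (removeZero x h) (by simp [removeZero]) = x :=
  Subtype.ext (by simp [removeZero, addZero, h])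

theorem vvec_removeZero (x : IState n (k + 1)) (h : 0 ∈ x.1) (i : ℕ) :
    vvec (removeZero x h) i = vvec x i := by
  unfold vvec removeZero
  congr 1
  ext a
  simp only [Finset.mem_filter, Finset.mem_erase]
  constructor
  · rintro ⟨⟨_, h1⟩, h2⟩; exact ⟨h1, h2⟩
  · rintro ⟨h1, h2⟩; exact ⟨⟨by omega, h1⟩, h2⟩

theorem gvec_removeZero (x y z : IState n (k + 1)) (hx : 0 ∈ x.1) (hy : 0 ∈ y.1) (hz : 0 ∈ z.1) :
    gvec (removeZero x hx) (removeZero y hy) (removeZero z hz) = gvec x y z := by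
  simp only [gvec, vdist, vvec_removeZero]

theorem fdeg_removeZero (x y : IState n (k + 1)) (hx : 0 ∈ x.1) (hy : 0 ∈ y.1) :
    fdeg (removeZero x hx) (removeZero y hy) = fdeg x y := by
  simp only [fdeg, vdist, vvec_removeZero]

variable (R n k) in
/-- The `R[U_1, …, U_n]`-linear map from `B_0(n,k+1)` to `B_0(n,k)` that sends `f_{x,y}` to
`f_{x \ 0, y \ 0}` if `0 ∈ x ∩ y` and to `0` otherwise. -/
def psiZero : BZero R n (k + 1) →ₗ[MvPolynomial (Fin n) R] BZero R n k where
  toFun a := ⟨fun x y => if h : 0 ∉ x.1 ∧ 0 ∉ y.1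
    then a.coeff (addZero x h.1) (addZero y h.2) else 0⟩
  map_add' a b := by
    ext1; funext x y
    simp only [coeff_add]
    split_ifs <;> simp
  map_smul' p a := by
    ext1; funext x y
    simp only [coeff_smul, RingHom.id_apply]
    split_ifs <;> simp

theorem coeff_f (x y a b : IState n k) :
    (f x y : BZero R n k).coeff a b = if a = x ∧ b = y then 1 else 0 := rfl

theorem psiZero_f (x y : IState n (k + 1)) (hx : 0 ∈ x.1) (hy : 0 ∈ y.1) :
    psiZero R n k (f x y) = f (removeZero x hx) (removeZero y hy) := by
  ext1; funext a b
  have key : ∀ (a : IState n k) (h : 0 ∉ a.1) (x : IState n (k + 1)) (hx : 0 ∈ x.1),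
      addZero a h = x ↔ a = removeZero x hx := by
    intro a h x hx
    constructor
    · rintro rfl; exact (removeZero_addZero a h).symm
    · rintro rfl; exact addZero_removeZero x hx
  simp only [psiZero, LinearMap.coe_mk, AddHom.coe_mk, coeff_f]
  by_cases h : 0 ∉ a.1 ∧ 0 ∉ b.1
  · rw [dif_pos h]
    exact if_congr (and_congr (key _ _ _ _) (key _ _ _ _)) rfl rfl
  · rw [dif_neg h, if_neg]
    rintro ⟨rfl, rfl⟩
    exact h (by simp [removeZero])

theorem psiZero_f_zero (x y : IState n (k + 1)) (h : 0 ∉ x.1 ∨ 0 ∉ y.1) :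
    psiZero R n k (f x y) = 0 := by
  ext1; funext a b
  simp only [psiZero, LinearMap.coe_mk, AddHom.coe_mk, coeff_f, coeff_zero]
  split_ifs with h1 h2
  · exfalso
    rcases h with h | h
    · exact h (by rw [← h2.1]; simp [addZero])
    · exact h (by rw [← h2.2]; simp [addZero])
  · rfl
  · rfl

/-- The key fact: a path from `x` to `z`, both containing `0`, through some `y` that does not
contain `0`, is sent to the ideal. -/
theorem key_mem (x y z : IState n (k + 1)) (hx : 0 ∈ x.1) (hy : 0 ∉ y.1) (hz : 0 ∈ z.1) :
    (MvPolynomial.monomial (gvec x y z) (1 : R)) • f (removeZero x hx) (removeZero z hz)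
      ∈ relIdeal R n k := by
  have hY := Finset.mem_powersetCard.1 y.2
  have hne : y.1.Nonempty := by
    rw [← Finset.card_pos, hY.2]; omega
  set m := y.1.min' hne with hm
  have hmy : m ∈ y.1 := Finset.min'_mem _ _
  have hm0 : 0 < m := Nat.pos_of_ne_zero fun h => hy (h ▸ hmy)
  have hmn : m < n + 1 := by simpa using hY.1 hmy
  have hmin : ∀ a ∈ y.1, m ≤ a := fun a ha => Finset.min'_le _ _ ha
  have hn : 0 < n := by omega
  let y' : IState n k := ⟨y.1.erase m, by
    refine Finset.mem_powersetCard.2 ⟨(Finset.erase_subset _ _).trans hY.1, ?_⟩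
    rw [Finset.card_erase_of_mem hmy, hY.2]; rfl⟩
  have hy'0 : 0 ∉ y'.1 := fun h => hy (Finset.mem_of_mem_erase h)
  have hy'1 : 1 ∉ y'.1 := fun h => by
    have h1 := Finset.mem_erase.1 h
    have h2 := hmin _ h1.2
    omega
  have hv : ∀ i : ℕ, vvec y i = vvec y' i + if i < m then 1 else 0 := by
    intro i
    unfold vvec
    have : y.1 = insert m y'.1 := (Finset.insert_erase hmy).symm
    rw [this, Finset.filter_insert]
    split_ifs with h
    · rw [Finset.card_insert_of_notMem]
      simp [y']
    · rfl
  have hv' : ∀ i : ℕ, i < m → vvec y i = k + 1 := by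
    intro i hi
    unfold vvec
    rw [Finset.filter_true_of_mem, hY.2]
    intro a ha
    exact lt_of_lt_of_le hi (hmin a ha)
  have hle : ∀ (x : IState n (k + 1)), 0 ∈ x.1 → ∀ i, vvec x i ≤ k := by
    intro x hx i
    have h1 := Finset.card_erase_of_mem hx
    rw [(Finset.mem_powersetCard.1 x.2).2] at h1
    have h2 : x.1.filter (fun a => i < a) ⊆ x.1.erase 0 := by
      intro a ha
      have := Finset.mem_filter.1 ha
      exact Finset.mem_erase.2 ⟨by omega, this.1⟩
    have h3 := Finset.card_le_card h2
    unfold vvec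
    omega
  have hg : ∀ i : Fin n, gvec (removeZero x hx) y' (removeZero z hz) i + (if (i : ℕ) < m then 1 else 0)
      = gvec x y z i := by
    intro i
    have h1 := two_mul_gvec (removeZero x hx) y' (removeZero z hz) i
    have h2 := two_mul_gvec x y z i
    have h3 := hv i
    have h4 := hv' i
    have h5 := hle x hx i
    have h6 := hle z hz i
    simp only [vdist, vvec_removeZero] at h1 h2
    split_ifs at h3 ⊢ with h
    · have h7 := h4 h
      omega
    · have : vvec y i = vvec y' i := by omega
      rw [this] at h2
      omega
  set g' := gvec (removeZero x hx) y' (removeZero z hz) with hg'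
  have hsum : gvec x y z = (gvec x y z - g' - Finsupp.single ⟨0, hn⟩ 1) +
      Finsupp.single ⟨0, hn⟩ 1 + g' := by
    ext i
    have h1 := hg i
    simp only [Finsupp.add_apply, Finsupp.tsub_apply]
    by_cases hi : i = ⟨0, hn⟩
    · subst hi
      rw [if_pos (by simpa using hm0)] at h1
      simp only [Finsupp.single_eq_same]
      omega
    · rw [Finsupp.single_eq_of_ne hi]
      omega
  have hmem := (ElRel.U (R := R) (k := k) ⟨0, hn⟩ y' hy'0 hy'1).mem
  have h2 := (relIdeal R n k).mul_mem_left (f (removeZero x hx) y') hmem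
  have h3 := (relIdeal R n k).mul_mem_right (f y' (removeZero z hz)) h2
  have h4 := (relIdeal R n k).mul_mem_left (algebraMap (MvPolynomial (Fin n) R) _
    (MvPolynomial.monomial (gvec x y z - g' - Finsupp.single ⟨0, hn⟩ 1) (1 : R))) h3
  convert h4 using 1
  rw [← Algebra.smul_def, mul_smul_comm, smul_mul_assoc, f_mul_self, if_pos rfl, f_mul_f,
    smul_smul, smul_smul, MvPolynomial.X, MvPolynomial.monomial_mul, MvPolynomial.monomial_mul,
    ← hg', ← hsum, one_mul, one_mul]

/-- Two additive maps agree if they agree on the multiples of the `f_{x,y}`. -/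
theorem addHom_ext {A : Type*} [AddCommGroup A] {φ χ : BZero R n k →+ A}
    (h : ∀ (x y : IState n k) (p : MvPolynomial (Fin n) R), φ (p • f x y) = χ (p • f x y))
    (a : BZero R n k) : φ a = χ a := by
  have := induction_f (K := (φ - χ).ker) (fun x y p => by
    rw [AddMonoidHom.mem_ker, AddMonoidHom.sub_apply, h, sub_self]) a
  rwa [AddMonoidHom.mem_ker, AddMonoidHom.sub_apply, sub_eq_zero] at this

theorem f_mul_mul_f (a : BZero R n k) (x y : IState n k) :
    f x x * a * f y y = a.coeff x y • f x y := by
  conv_lhs => rw [eq_sum' a]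
  simp only [Finset.mul_sum, Finset.sum_mul]
  rw [Finset.sum_eq_single x, Finset.sum_eq_single y]
  · rw [mul_smul_comm, smul_mul_assoc, f_self_mul, if_pos rfl, f_mul_self, if_pos rfl]
  · intro z _ hz
    rw [mul_smul_comm, smul_mul_assoc, mul_assoc, f_mul_self, if_neg hz, mul_zero, smul_zero]
  · simp
  · intro z _ hz
    refine Finset.sum_eq_zero fun w _ => ?_
    rw [mul_smul_comm, smul_mul_assoc, f_self_mul, if_neg hz.symm, zero_mul, smul_zero]
  · simp

theorem psiZero_mul_f (x y z : IState n (k + 1)) :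
    psiZero R n k (f x y * f y z) - psiZero R n k (f x y) * psiZero R n k (f y z)
      ∈ relIdeal R n k := by
  by_cases hx : 0 ∈ x.1
  · by_cases hz : 0 ∈ z.1
    · by_cases hy : 0 ∈ y.1
      · rw [f_mul_f, map_smul, psiZero_f x z hx hz, psiZero_f x y hx hy, psiZero_f y z hy hz,
          f_mul_f, gvec_removeZero, sub_self]
        exact zero_mem _
      · rw [f_mul_f, map_smul, psiZero_f x z hx hz, psiZero_f_zero x y (Or.inr hy), zero_mul,
          sub_zero]
        exact key_mem x y z hx hy hz
    · rw [f_mul_f, map_smul, psiZero_f_zero x z (Or.inr hz), psiZero_f_zero y z (Or.inr hz),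
        mul_zero, smul_zero, sub_zero]
      exact zero_mem _
  · rw [f_mul_f, map_smul, psiZero_f_zero x z (Or.inl hx), psiZero_f_zero x y (Or.inl hx),
      zero_mul, smul_zero, sub_zero]
    exact zero_mem _

theorem psiZero_mul_f' (x y y' z : IState n (k + 1)) :
    psiZero R n k (f x y * f y' z) - psiZero R n k (f x y) * psiZero R n k (f y' z)
      ∈ relIdeal R n k := by
  by_cases h : y = y'
  · subst h; exact psiZero_mul_f x y z
  · have h0 : psiZero R n k (f x y) * psiZero R n k (f y' z) = 0 := by
      by_cases h1 : 0 ∈ x.1 ∧ 0 ∈ y.1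
      · by_cases h2 : 0 ∈ y'.1 ∧ 0 ∈ z.1
        · rw [psiZero_f x y h1.1 h1.2, psiZero_f y' z h2.1 h2.2]
          refine f_mul_f_ne fun h3 => h ?_
          rw [← addZero_removeZero y h1.2, ← addZero_removeZero y' h2.1]
          simp only [h3]
        · rw [psiZero_f_zero y' z (by tauto), mul_zero]
      · rw [psiZero_f_zero x y (by tauto), zero_mul]
    rw [h0, f_mul_f_ne h, map_zero, sub_zero]
    exact zero_mem _

theorem psiZero_mul (a b : BZero R n (k + 1)) :
    psiZero R n k (a * b) - psiZero R n k a * psiZero R n k b ∈ relIdeal R n k := by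
  rw [eq_sum' a, eq_sum' b]
  simp only [Finset.sum_mul, map_sum, Finset.mul_sum, ← Finset.sum_sub_distrib]
  refine sum_mem fun x _ => sum_mem fun y _ => sum_mem fun z _ => sum_mem fun w _ => ?_
  rw [smul_mul_assoc, mul_smul_comm, map_smul, map_smul, map_smul, map_smul, smul_mul_assoc,
    mul_smul_comm, ← smul_sub, ← smul_sub, Algebra.smul_def, Algebra.smul_def]
  exact (relIdeal R n k).mul_mem_left _ ((relIdeal R n k).mul_mem_left _ (psiZero_mul_f' _ _ _ _))

variable (R n k) in
/-- The algebra `B(n,k)`, with coefficients in `R`: the quotient of `B_0(n,k)` by the ideal. -/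
def _root_.OSz.BFull : Type u := BZero R n k ⧸ relIdeal R n k

instance : Ring (BFull R n k) := inferInstanceAs (Ring (BZero R n k ⧸ relIdeal R n k))

/-- The quotient map from `B_0(n,k)` to `B(n,k)`. -/
def toB : BZero R n k →+* BFull R n k := Ideal.Quotient.mk (relIdeal R n k)

theorem toB_surjective : Function.Surjective (toB : BZero R n k → BFull R n k) :=
  Ideal.Quotient.mk_surjective

theorem toB_eq_zero {a : BZero R n k} : toB a = 0 ↔ a ∈ relIdeal R n k :=
  Ideal.Quotient.eq_zero_iff_mem

variable (R n k) in
/-- The map from `B_0(n,k+1)` to `B(n,k)` that sends `f_{x,y}` to `f_{x \ 0, y \ 0}` if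
`0 ∈ x ∩ y` and to `0` otherwise. -/
def psiAux : BZero R n (k + 1) →ₙ+* BFull R n k where
  toFun a := toB (psiZero R n k a)
  map_zero' := by rw [map_zero, map_zero]
  map_add' a b := by rw [map_add, map_add]
  map_mul' a b := by
    rw [← map_mul]
    rw [← sub_eq_zero, ← map_sub]
    exact toB_eq_zero.2 (psiZero_mul a b)

theorem psiAux_smul (p : MvPolynomial (Fin n) R) (a : BZero R n (k + 1)) :
    psiAux R n k (p • a) = toB (algebraMap _ _ p) * psiAux R n k a := by
  change toB _ = _ * toB _
  rw [map_smul, Algebra.smul_def, map_mul]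

theorem psiAux_f (x y : IState n (k + 1)) (hx : 0 ∈ x.1) (hy : 0 ∈ y.1) :
    psiAux R n k (f x y) = toB (f (removeZero x hx) (removeZero y hy)) := by
  change toB _ = _
  rw [psiZero_f]

theorem psiAux_f_zero (x y : IState n (k + 1)) (h : 0 ∉ x.1 ∨ 0 ∉ y.1) :
    psiAux R n k (f x y) = 0 := by
  change toB _ = _
  rw [psiZero_f_zero x y h, map_zero]

theorem ElRel.psiAux_eq {x z : IState n (k + 1)} {e : BZero R n (k + 1)} (h : ElRel x z e) :
    psiAux R n k e = 0 := by
  induction h with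
  | RR i j h x y z h1 h2 =>
    rw [map_mul]
    by_cases hx : 0 ∈ x.1
    · by_cases hy : 0 ∈ y.1
      · by_cases hz : 0 ∈ z.1
        · rw [psiAux_f x y hx hy, psiAux_f y z hy hz, ← map_mul, toB_eq_zero]
          refine (ElRel.RR i j h _ _ _ ?_ ?_).mem
          · have hi : (i : ℕ) ≠ 0 := by
              rintro hi
              have := h1.2.2 ▸ hy
              simp [hi] at this
            refine ⟨Finset.mem_erase.2 ⟨hi, h1.1⟩, fun h3 => h1.2.1 (Finset.mem_of_mem_erase h3), ?_⟩
            simp only [removeZero, h1.2.2]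
            ext a; simp only [Finset.mem_erase, Finset.mem_insert]; grind
          · have hj : (j : ℕ) ≠ 0 := by omega
            refine ⟨Finset.mem_erase.2 ⟨hj, h2.1⟩, fun h3 => h2.2.1 (Finset.mem_of_mem_erase h3), ?_⟩
            simp only [removeZero, h2.2.2]
            ext a; simp only [Finset.mem_erase, Finset.mem_insert]; grind
        · rw [psiAux_f_zero y z (Or.inr hz), mul_zero]
      · rw [psiAux_f_zero x y (Or.inr hy), zero_mul]
    · rw [psiAux_f_zero x y (Or.inl hx), zero_mul]
  | LL i j h x y z h1 h2 =>
    rw [map_mul]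
    by_cases hx : 0 ∈ x.1
    · by_cases hy : 0 ∈ y.1
      · by_cases hz : 0 ∈ z.1
        · rw [psiAux_f x y hx hy, psiAux_f y z hy hz, ← map_mul, toB_eq_zero]
          refine (ElRel.LL i j h _ _ _ ?_ ?_).mem
          · have hj : (j : ℕ) ≠ 0 := by omega
            refine ⟨Finset.mem_erase.2 ⟨by omega, h1.1⟩,
              fun h3 => h1.2.1 (Finset.mem_of_mem_erase h3), ?_⟩
            simp only [removeZero, h1.2.2]
            ext a; simp only [Finset.mem_erase, Finset.mem_insert]; grind
          · have hi : (i : ℕ) ≠ 0 := by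
              rintro hi
              exact h2.2.1 (hi ▸ hy)
            refine ⟨Finset.mem_erase.2 ⟨by omega, h2.1⟩,
              fun h3 => h2.2.1 (Finset.mem_of_mem_erase h3), ?_⟩
            simp only [removeZero, h2.2.2]
            ext a; simp only [Finset.mem_erase, Finset.mem_insert]; grind
        · rw [psiAux_f_zero y z (Or.inr hz), mul_zero]
      · rw [psiAux_f_zero x y (Or.inr hy), zero_mul]
    · rw [psiAux_f_zero x y (Or.inl hx), zero_mul]
  | U i x h h' =>
    rw [psiAux_smul]
    by_cases hx : 0 ∈ x.1
    · rw [psiAux_f x x hx hx, ← map_mul, toB_eq_zero, ← Algebra.smul_def]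
      exact (ElRel.U i _ (fun h3 => h (Finset.mem_of_mem_erase h3))
        (fun h3 => h' (Finset.mem_of_mem_erase h3))).mem
    · rw [psiAux_f_zero x x (Or.inl hx), mul_zero]

theorem psiAux_relIdeal (a : BZero R n (k + 1)) (ha : a ∈ relIdeal R n (k + 1)) :
    psiAux R n k a = 0 := by
  refine relIdeal_le (K := (AddMonoidHomClass.toAddMonoidHom (psiAux R n k)).ker) ?_ a ha
  intro x z a b e p he
  change psiAux R n k _ = 0
  rw [psiAux_smul, map_mul, map_mul, he.psiAux_eq]
  simp

end BZero

open BZero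

variable (R n k)

/-- The map from `B(n,k+1)` to `B(n,k)` that sends `f_{x,y}` to `f_{x \ 0, y \ 0}` if
`0 ∈ x ∩ y` and to `0` otherwise. It is multiplicative, but does not send `1` to `1`. -/
def psiFull : BFull R n (k + 1) →ₙ+* BFull R n k where
  toFun := Quotient.lift (psiAux R n k) (fun a b h => by
    have h1 : a - b ∈ relIdeal R n (k + 1) := by
      rw [← Ideal.Quotient.eq]; exact Quotient.sound h
    have := psiAux_relIdeal _ h1
    rwa [map_sub, sub_eq_zero] at this)
  map_zero' := map_zero (psiAux R n k)
  map_add' := by rintro ⟨a⟩ ⟨b⟩; exact map_add (psiAux R n k) a b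
  map_mul' := by rintro ⟨a⟩ ⟨b⟩; exact map_mul (psiAux R n k) a b

/-- `V_l(n,k)`: the left I-states, i.e. the I-states that do not contain `n`. -/
abbrev LState : Type := {x : IState n k // n ∉ x.1}

/-- The idempotent `∑ I_x`, over the I-states `x` with `n ∉ x`. -/
def eLeft : BFull R n k := ∑ x : LState n k, toB (f x.1 x.1)

variable {R n k}

theorem psiFull_mk (a : BZero R n (k + 1)) :
    psiFull R n k (toB a) = psiAux R n k a := rfl

theorem eLeft_mul_f (x : LState n k) (y : IState n k) :
    eLeft R n k * toB (f x.1 y) = toB (f x.1 y) := by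
  rw [eLeft, Finset.sum_mul, Finset.sum_eq_single x]
  · rw [← map_mul, f_self_mul, if_pos rfl]
  · intro z _ hz
    rw [← map_mul, f_self_mul, if_neg (fun h => hz (Subtype.ext h)), map_zero]
  · simp

theorem f_mul_eLeft (x : IState n k) (y : LState n k) :
    toB (f x y.1) * eLeft R n k = toB (f x y.1) := by
  rw [eLeft, Finset.mul_sum, Finset.sum_eq_single y]
  · rw [← map_mul, f_mul_self, if_pos rfl]
  · intro z _ hz
    rw [← map_mul, f_mul_self, if_neg (fun h => hz (Subtype.ext h.symm)), map_zero]
  · simp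

theorem isIdempotentElem_eLeft : IsIdempotentElem (eLeft R n k) := by
  unfold IsIdempotentElem
  conv_lhs => rhs; rw [eLeft]
  rw [Finset.mul_sum]
  exact Finset.sum_congr rfl fun x _ => eLeft_mul_f x x.1

variable (R n k) in
/-- The Ozsváth–Szabó algebra `B_l(n,k)`, with coefficients in `R`: the corner of `B(n,k)` at the
idempotent `∑ I_x`, over the left I-states. -/
def OSzAlg : Type u := (isIdempotentElem_eLeft (R := R) (n := n) (k := k)).Corner

instance : Ring (OSzAlg R n k) :=
  inferInstanceAs (Ring (isIdempotentElem_eLeft (R := R) (n := n) (k := k)).Corner)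

theorem mem_corner {b : BFull R n k} : b ∈ Subsemigroup.corner (eLeft R n k) ↔
    eLeft R n k * b = b ∧ b * eLeft R n k = b :=
  Subsemigroup.mem_corner_iff isIdempotentElem_eLeft

namespace OSzAlg

variable (R n k) in
/-- The inclusion of `B_l(n,k)` into `B(n,k)`. -/
def val : OSzAlg R n k →ₙ+* BFull R n k where
  toFun b := b.1
  map_zero' := rfl
  map_add' _ _ := rfl
  map_mul' _ _ := rfl

theorem val_injective : Function.Injective (val R n k) := Subtype.val_injective

theorem val_one : val R n k 1 = eLeft R n k := rfl

/-- The element `p f_{x,y}` of `B_l(n,k)`, for a polynomial `p` in the `U_i`. -/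
def gen (x y : LState n k) (p : MvPolynomial (Fin n) R) : OSzAlg R n k :=
  ⟨toB (p • f x.1 y.1), mem_corner.2 ⟨by
      rw [Algebra.smul_def, Algebra.commutes, map_mul, ← mul_assoc, eLeft_mul_f], by
      rw [Algebra.smul_def, map_mul, mul_assoc, f_mul_eLeft]⟩⟩

/-- The idempotent `I_x`. -/
def idem (x : LState n k) : OSzAlg R n k := gen x x 1

variable (R n k) in
/-- The idempotent `e^∨`, the sum of the `I_x` with `0 ∉ x`. -/
def eVee : OSzAlg R n k := ∑ x : LState n k with 0 ∉ x.1.1, idem x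

theorem val_gen (x y : LState n k) (p : MvPolynomial (Fin n) R) :
    val R n k (gen x y p) = toB (p • f x.1 y.1) := rfl

theorem gen_add (x y : LState n k) (p q : MvPolynomial (Fin n) R) :
    gen x y (p + q) = gen x y p + gen x y q := by
  apply val_injective
  rw [map_add, val_gen, val_gen, val_gen, add_smul, map_add]

theorem gen_zero (x y : LState n k) : (gen x y 0 : OSzAlg R n k) = 0 := by
  apply val_injective
  rw [map_zero, val_gen, zero_smul, map_zero]

theorem gen_mul_gen (x y z : LState n k) (p q : MvPolynomial (Fin n) R) :
    gen x y p * gen y z q = gen x z (MvPolynomial.monomial (gvec x.1 y.1 z.1) 1 * (p * q)) := by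
  apply val_injective
  rw [map_mul, val_gen, val_gen, val_gen, ← map_mul, smul_mul_assoc, mul_smul_comm, f_mul_f,
    smul_smul, smul_smul]
  congr 2
  ring

theorem gen_mul_gen_ne {x y y' z : LState n k} (h : y ≠ y') (p q : MvPolynomial (Fin n) R) :
    gen x y p * gen y' z q = 0 := by
  apply val_injective
  rw [map_mul, val_gen, val_gen, ← map_mul, smul_mul_assoc, mul_smul_comm,
    f_mul_f_ne (fun h' => h (Subtype.ext h')), smul_zero, smul_zero, map_zero, map_zero]

theorem one_eq_sum : (1 : OSzAlg R n k) = ∑ x : LState n k, idem x := by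
  apply val_injective
  rw [val_one, map_sum]
  simp only [idem, val_gen, one_smul, eLeft]

theorem idem_mul_idem_mem (b : OSzAlg R n k) (x y : LState n k) :
    ∃ p : MvPolynomial (Fin n) R, idem x * b * idem y = gen x y p := by
  obtain ⟨a, ha⟩ := toB_surjective (val R n k b)
  refine ⟨a.coeff x.1 y.1, ?_⟩
  apply val_injective
  rw [map_mul, map_mul, ← ha, idem, idem, val_gen, val_gen, val_gen, ← map_mul, ← map_mul,
    one_smul, one_smul, f_mul_mul_f]

/-- Induction over the elements `p f_{x,y}`. -/
theorem induction_gen {K : AddSubgroup (OSzAlg R n k)}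
    (h : ∀ (x y : LState n k) (p : MvPolynomial (Fin n) R), gen x y p ∈ K) (b : OSzAlg R n k) :
    b ∈ K := by
  have hb : b = ∑ x : LState n k, ∑ y : LState n k, idem x * b * idem y := by
    simp only [← Finset.mul_sum, ← Finset.sum_mul, ← one_eq_sum, one_mul, mul_one]
  rw [hb]
  refine sum_mem fun x _ => sum_mem fun y _ => ?_
  obtain ⟨p, hp⟩ := idem_mul_idem_mem b x y
  rw [hp]
  exact h _ _ _

end OSzAlg

/-- For a left I-state `x` with `0 ∈ x`, the left I-state `x \ {0}`. -/
def LState.removeZero (x : LState n (k + 1)) (h : 0 ∈ x.1.1) : LState n k :=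
  ⟨BZero.removeZero x.1 h, fun h' => x.2 (Finset.mem_of_mem_erase h')⟩

namespace OSzAlg

theorem psiFull_eLeft_mul (x : LState n (k + 1)) :
    eLeft R n k * psiFull R n k (toB (f x.1 x.1)) =
      psiFull R n k (toB (f x.1 x.1)) ∧
    psiFull R n k (toB (f x.1 x.1)) * eLeft R n k =
      psiFull R n k (toB (f x.1 x.1)) := by
  rw [psiFull_mk]
  by_cases hx : 0 ∈ x.1.1
  · rw [psiAux_f _ _ hx hx]
    exact ⟨eLeft_mul_f (x.removeZero hx) _, f_mul_eLeft _ (x.removeZero hx)⟩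
  · rw [psiAux_f_zero _ _ (Or.inl hx), mul_zero, zero_mul]
    exact ⟨rfl, rfl⟩

theorem psiFull_mem (b : OSzAlg R n (k + 1)) :
    psiFull R n k (val R n (k + 1) b) ∈ Subsemigroup.corner (eLeft R n k) := by
  have h1 : val R n (k + 1) b = eLeft R n (k + 1) * val R n (k + 1) b :=
    (mem_corner.1 b.2).1.symm
  have h2 : val R n (k + 1) b = val R n (k + 1) b * eLeft R n (k + 1) :=
    (mem_corner.1 b.2).2.symm
  rw [mem_corner]
  constructor
  · rw [h1, map_mul, ← mul_assoc]
    congr 1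
    rw [eLeft.eq_def R n (k + 1), map_sum, Finset.mul_sum]
    exact Finset.sum_congr rfl fun x _ => (psiFull_eLeft_mul x).1
  · rw [h2, map_mul, mul_assoc]
    congr 1
    rw [eLeft.eq_def R n (k + 1), map_sum, Finset.sum_mul]
    exact Finset.sum_congr rfl fun x _ => (psiFull_eLeft_mul x).2

variable (R n k) in
/-- The map `B_l(n,k+1) → B_l(n,k)`, `b ↦ Ψ'(e^∧ b e^∧)`. It is additive and multiplicative, and
sends `p f_{x,y}` to `p f_{x \ 0, y \ 0}` if `0 ∈ x ∩ y` and to `0` otherwise, where `p` is a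
polynomial in the `U_i` (see `psi_gen` and `psi_gen_zero`). -/
def psi : OSzAlg R n (k + 1) →ₙ+* OSzAlg R n k where
  toFun b := ⟨psiFull R n k (val R n (k + 1) b), psiFull_mem b⟩
  map_zero' := val_injective <| by
    change psiFull R n k (val R n (k + 1) 0) = 0
    rw [map_zero, map_zero]
  map_add' a b := val_injective <| by
    change psiFull R n k (val R n (k + 1) (a + b)) =
      psiFull R n k (val R n (k + 1) a) + psiFull R n k (val R n (k + 1) b)
    rw [map_add, map_add]
  map_mul' a b := val_injective <| by
    change psiFull R n k (val R n (k + 1) (a * b)) =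
      psiFull R n k (val R n (k + 1) a) * psiFull R n k (val R n (k + 1) b)
    rw [map_mul, map_mul]

theorem val_psi (b : OSzAlg R n (k + 1)) :
    val R n k (psi R n k b) = psiFull R n k (val R n (k + 1) b) := rfl

theorem psi_gen (x y : LState n (k + 1)) (hx : 0 ∈ x.1.1) (hy : 0 ∈ y.1.1)
    (p : MvPolynomial (Fin n) R) :
    psi R n k (gen x y p) = gen (x.removeZero hx) (y.removeZero hy) p := by
  apply val_injective
  rw [val_psi, val_gen, psiFull_mk, psiAux_smul, psiAux_f _ _ hx hy, val_gen, Algebra.smul_def,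
    map_mul]
  rfl

theorem psi_gen_zero (x y : LState n (k + 1)) (h : 0 ∉ x.1.1 ∨ 0 ∉ y.1.1)
    (p : MvPolynomial (Fin n) R) : psi R n k (gen x y p) = 0 := by
  apply val_injective
  rw [val_psi, val_gen, psiFull_mk, psiAux_smul, psiAux_f_zero _ _ h, mul_zero, map_zero]

theorem psi_one [NeZero n] : psi R n k 1 = eVee R n k := by
  rw [one_eq_sum, map_sum, eVee, ← Finset.sum_filter_add_sum_filter_not
    (Finset.univ : Finset (LState n (k + 1))) (fun x => 0 ∈ x.1.1), Finset.sum_eq_zero (s :=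
    Finset.univ.filter fun x : LState n (k + 1) => ¬ 0 ∈ x.1.1), add_zero]
  · refine Finset.sum_bij' (fun x hx => x.removeZero (Finset.mem_filter.1 hx).2)
      (fun x hx => ⟨addZero x.1 (Finset.mem_filter.1 hx).2, ?_⟩) ?_ ?_ ?_ ?_ ?_
    · simp only [addZero, Finset.mem_insert, not_or]
      exact ⟨NeZero.ne n, x.2⟩
    · intro x hx
      simp [LState.removeZero, BZero.removeZero]
    · intro x hx
      simp [addZero]
    · intro x hx
      exact Subtype.ext (addZero_removeZero _ (Finset.mem_filter.1 hx).2)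
    · intro x hx
      exact Subtype.ext (removeZero_addZero _ (Finset.mem_filter.1 hx).2)
    · intro x hx
      exact psi_gen _ _ (Finset.mem_filter.1 hx).2 (Finset.mem_filter.1 hx).2 _
  · intro x hx
    exact psi_gen_zero _ _ (Or.inl (Finset.mem_filter.1 hx).2) _

theorem eVee_mul_gen (x y : LState n k) (h : 0 ∉ x.1.1) (p : MvPolynomial (Fin n) R) :
    eVee R n k * gen x y p = gen x y p := by
  rw [eVee, Finset.sum_mul, Finset.sum_eq_single x]
  · rw [idem, gen_mul_gen, gvec_left, one_mul]
    congr 1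
    exact one_mul p
  · intro z _ hz
    exact gen_mul_gen_ne hz _ _
  · intro hx
    exact absurd (Finset.mem_filter.2 ⟨Finset.mem_univ x, h⟩) hx

theorem gen_mul_eVee (x y : LState n k) (h : 0 ∉ y.1.1) (p : MvPolynomial (Fin n) R) :
    gen x y p * eVee R n k = gen x y p := by
  rw [eVee, Finset.mul_sum, Finset.sum_eq_single y]
  · rw [idem, gen_mul_gen, gvec_right, mul_one]
    congr 1
    exact one_mul p
  · intro z _ hz
    exact gen_mul_gen_ne hz.symm _ _
  · intro hy
    exact absurd (Finset.mem_filter.2 ⟨Finset.mem_univ y, h⟩) hy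

theorem eVee_mul_eVee : eVee R n k * eVee R n k = eVee R n k := by
  conv_lhs => rhs; rw [eVee]
  rw [Finset.mul_sum, eVee]
  refine Finset.sum_congr rfl fun x hx => ?_
  rw [← eVee]
  exact eVee_mul_gen x x (Finset.mem_filter.1 hx).2 1

theorem psi_mul_eVee (b : OSzAlg R n (k + 1)) : psi R n k b * eVee R n k = psi R n k b := by
  have := induction_gen (K := ((AddMonoidHom.mulRight (eVee R n k)).comp
    (AddMonoidHomClass.toAddMonoidHom (psi R n k)) -
      AddMonoidHomClass.toAddMonoidHom (psi R n k)).ker) (fun x y p => ?_) b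
  · rw [AddMonoidHom.mem_ker, AddMonoidHom.sub_apply, sub_eq_zero] at this
    exact this
  · rw [AddMonoidHom.mem_ker, AddMonoidHom.sub_apply, sub_eq_zero]
    change psi R n k (gen x y p) * eVee R n k = psi R n k (gen x y p)
    by_cases h : 0 ∈ x.1.1 ∧ 0 ∈ y.1.1
    · rw [psi_gen _ _ h.1 h.2, gen_mul_eVee]
      simp [LState.removeZero, BZero.removeZero]
    · rw [psi_gen_zero _ _ (by tauto), zero_mul]

end OSzAlg

open OSzAlg

variable (R n k) in
/-- The bimodule `F_k` over `(B_l(n,k), B_l(n,k+1))`. As a left module it is `B_l(n,k) e^∨`. -/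
abbrev FBim : Type u := ↥(Ideal.span {eVee R n k})

theorem FBim.mul_eVee (p : FBim R n k) : p.1 * eVee R n k = p.1 := by
  obtain ⟨a, ha⟩ := Ideal.mem_span_singleton'.1 p.2
  rw [← ha, mul_assoc, eVee_mul_eVee]

/-- The right action of `B_l(n,k+1)` on `F_k`: `p · b = p Ψ'(e^∧ b e^∧)`. -/
instance FBim.rightModule [NeZero n] : Module (OSzAlg R n (k + 1))ᵐᵒᵖ (FBim R n k) where
  smul b p := ⟨p.1 * psi R n k b.unop, Ideal.mem_span_singleton'.2
    ⟨p.1 * psi R n k b.unop, by rw [mul_assoc, psi_mul_eVee]⟩⟩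
  one_smul p := Subtype.ext (by
    change p.1 * psi R n k 1 = p.1
    rw [psi_one, FBim.mul_eVee])
  mul_smul a b p := Subtype.ext (by
    change p.1 * psi R n k (b.unop * a.unop) = p.1 * psi R n k b.unop * psi R n k a.unop
    rw [map_mul, mul_assoc])
  smul_zero a := Subtype.ext (zero_mul _)
  smul_add a p q := Subtype.ext (add_mul _ _ _)
  add_smul a b p := Subtype.ext (by
    change p.1 * psi R n k (a.unop + b.unop) = p.1 * psi R n k a.unop + p.1 * psi R n k b.unop
    rw [map_add, mul_add])
  zero_smul p := Subtype.ext (by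
    change p.1 * psi R n k 0 = 0
    rw [map_zero, mul_zero])

theorem FBim.coe_op_smul [NeZero n] (b : OSzAlg R n (k + 1)) (p : FBim R n k) :
    (MulOpposite.op b • p).1 = p.1 * psi R n k b := rfl

instance FBim.smulCommClass [NeZero n] :
    SMulCommClass (OSzAlg R n k) (OSzAlg R n (k + 1))ᵐᵒᵖ (FBim R n k) where
  smul_comm _ _ _ := Subtype.ext (mul_assoc _ _ _).symm

open scoped TensorProduct

/-! Gradings by `ℤ`. -/

/-- A criterion for a family of subgroups to be an internal direct sum. -/
theorem isInternal_of_proj {M N : Type*} [AddCommGroup M] [AddCommGroup N]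
    (gr : ℤ → AddSubgroup M) (i : M →+ N) (hi : Function.Injective i) (π : ℤ → M →+ N)
    (hπ : ∀ d e m, m ∈ gr e → π d m = if e = d then i m else 0)
    (hs : ∀ m, m ∈ ⨆ d, gr d) : DirectSum.IsInternal gr := by
  classical
  constructor
  · rw [injective_iff_map_eq_zero]
    intro x hx
    have key : ∀ d, (π d).comp (DirectSum.coeAddMonoidHom gr) =
        (i.comp (gr d).subtype).comp (DFinsupp.evalAddMonoidHom d) := by
      intro d
      refine DirectSum.addHom_ext fun e y => ?_
      simp only [AddMonoidHom.comp_apply, DirectSum.coeAddMonoidHom_of]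
      rw [hπ d e y y.2]
      change _ = i (DirectSum.of (fun d => gr d) e y d)
      split_ifs with h
      · subst h; rw [DirectSum.of_eq_same]
      · rw [DirectSum.of_eq_of_ne _ _ _ (Ne.symm h)]; simp
    refine DFinsupp.ext fun d => ?_
    have h2 := DFunLike.congr_fun (key d) x
    simp only [AddMonoidHom.comp_apply, hx, map_zero] at h2
    exact Subtype.ext (hi (h2.symm.trans (map_zero i).symm))
  · intro m
    have : (⨆ d, gr d) ≤ (DirectSum.coeAddMonoidHom gr).range :=
      iSup_le fun d y hy => ⟨DirectSum.of (fun d => gr d) d ⟨y, hy⟩,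
        DirectSum.coeAddMonoidHom_of gr d _⟩
    exact this (hs m)

section Components

variable {M : Type*} [AddCommGroup M] {gr : ℤ → AddSubgroup M}

/-- The decomposition into homogeneous components. -/
def decomp (h : DirectSum.IsInternal gr) : M ≃+ DirectSum ℤ fun d => gr d :=
  (AddEquiv.ofBijective (DirectSum.coeAddMonoidHom gr)
    (show Function.Bijective (DirectSum.coeAddMonoidHom gr) from h)).symm

theorem decomp_of_mem (h : DirectSum.IsInternal gr) (e : ℤ) (m : M) (hm : m ∈ gr e) :
    decomp h m = DirectSum.of (fun d => gr d) e ⟨m, hm⟩ := by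
  rw [decomp, AddEquiv.symm_apply_eq, AddEquiv.ofBijective_apply, DirectSum.coeAddMonoidHom_of]

/-- The homogeneous component of degree `d`. -/
def comp (h : DirectSum.IsInternal gr) (d : ℤ) : M →+ M :=
  (gr d).subtype.comp ((DFinsupp.evalAddMonoidHom d).comp (decomp h).toAddMonoidHom)

theorem comp_of_mem (h : DirectSum.IsInternal gr) (d e : ℤ) (m : M) (hm : m ∈ gr e) : comp h d m = if e = d then m else 0 := by
  classical
  change (decomp h m d : M) = _
  rw [decomp_of_mem h e m hm]
  split_ifs with h2
  · subst h2; rw [DirectSum.of_eq_same]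
  · rw [DirectSum.of_eq_of_ne _ _ _ (Ne.symm h2)]; simp

theorem mem_iSup_of_isInternal (h : DirectSum.IsInternal gr) (m : M) : m ∈ ⨆ d, gr d := by
  classical
  obtain ⟨x, rfl⟩ := h.2 m
  induction x using DirectSum.induction_on with
  | zero => simp
  | of d y =>
    rw [DirectSum.coeAddMonoidHom_of]
    exact AddSubgroup.mem_iSup_of_mem d y.2
  | add x y hx hy => rw [map_add]; exact add_mem hx hy

/-- Additive induction over the homogeneous elements. -/
theorem induction_homogeneous (h : DirectSum.IsInternal gr) {K : AddSubgroup M} (hK : ∀ d, ∀ m ∈ gr d, m ∈ K) (m : M) : m ∈ K :=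
  (iSup_le hK : (⨆ d, gr d) ≤ K) (mem_iSup_of_isInternal h m)

end Components

/-- The grading on a homogeneous retract. -/
theorem isInternal_comap {M M' : Type*} [AddCommGroup M] [AddCommGroup M']
    {gr : ℤ → AddSubgroup M} (h : DirectSum.IsInternal gr) (i : M' →+ M)
    (hi : Function.Injective i) (r : M →+ M') (hr : ∀ m, r (i m) = m)
    (hr' : ∀ d, ∀ m ∈ gr d, i (r m) ∈ gr d) :
    DirectSum.IsInternal fun d => (gr d).comap i := by
  refine isInternal_of_proj _ i hi (fun d => (comp h d).comp i) ?_ ?_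
  · intro d e m hm
    exact comp_of_mem h d e (i m) hm
  · intro m
    have : ∀ x : M, x ∈ (⨆ d, (gr d).comap i).comap r :=
      induction_homogeneous h fun d x hx =>
        AddSubgroup.mem_comap.2 (AddSubgroup.mem_iSup_of_mem d (hr' d x hx))
    have h2 := this (i m)
    rwa [AddSubgroup.mem_comap, hr] at h2

/-! The tensor product over a noncommutative ring. -/

section BTensor

variable (A B F M : Type*) [Ring A] [Ring B] [AddCommGroup F] [AddCommGroup M] [Module B F]
  [Module Aᵐᵒᵖ F] [SMulCommClass B Aᵐᵒᵖ F] [Module A M]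

/-- The submodule of the tensor product over `ℤ` generated by the `f a ⊗ m - f ⊗ a m`. Since the
two actions on `F` commute, it does not matter whether it is generated as a left `B`-module or as
an additive group. -/
def balancedRel : Submodule B (F ⊗[ℤ] M) :=
  Submodule.span B {t | ∃ (f : F) (a : A) (m : M),
    t = (MulOpposite.op a • f) ⊗ₜ[ℤ] m - f ⊗ₜ[ℤ] (a • m)}

/-- The tensor product `F ⊗_A M` of a `(B, A)`-bimodule and a left `A`-module; it is a left
`B`-module. -/
abbrev BTensor : Type _ := (F ⊗[ℤ] M) ⧸ balancedRel A B F M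

variable {B F M}

/-- The pure tensor `f ⊗ m`. -/
def bt (f : F) (m : M) : BTensor A B F M := (balancedRel A B F M).mkQ (f ⊗ₜ[ℤ] m)

variable (B) in
/-- Pure tensors, as a biadditive map. -/
def btHom : F →+ M →+ BTensor A B F M :=
  AddMonoidHom.mk' (fun f => AddMonoidHom.mk' (fun m => bt A f m)
    (fun m m' => by simp only [bt, TensorProduct.tmul_add, map_add]))
    (fun f f' => by ext m; simp [bt, TensorProduct.add_tmul])

theorem btHom_apply (f : F) (m : M) : btHom A B f m = bt A f m := rfl

theorem bt_smul (f : F) (a : A) (m : M) :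
    (bt A (MulOpposite.op a • f) m : BTensor A B F M) = bt A f (a • m) := by
  rw [← sub_eq_zero, bt, bt, ← map_sub, Submodule.mkQ_apply, Submodule.Quotient.mk_eq_zero]
  exact Submodule.subset_span ⟨f, a, m, rfl⟩

theorem smul_bt (b : B) (f : F) (m : M) :
    b • (bt A f m : BTensor A B F M) = bt A (b • f) m := by
  rw [bt, bt, ← map_smul, TensorProduct.smul_tmul']

theorem bt_induction {K : AddSubgroup (BTensor A B F M)} (h : ∀ f m, bt A f m ∈ K)
    (t : BTensor A B F M) : t ∈ K := by
  obtain ⟨t, rfl⟩ := Submodule.mkQ_surjective _ t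
  induction t using TensorProduct.induction_on with
  | zero => rw [map_zero]; exact zero_mem _
  | tmul f m => exact h f m
  | add x y hx hy => rw [map_add]; exact add_mem hx hy

/-- A balanced biadditive map factors through the tensor product. -/
theorem exists_btLift {N : Type*} [AddCommGroup N] (φ : F →+ M →+ N)
    (h : ∀ f (a : A) m, φ (MulOpposite.op a • f) m = φ f (a • m)) :
    ∃ Φ : BTensor A B F M →+ N, ∀ f m, Φ (bt A f m) = φ f m := by
  let Φ₀ : F ⊗[ℤ] M →+ N := TensorProduct.liftAddHom φ (fun r f m => by
    rw [map_zsmul, map_zsmul]; rfl)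
  have h0 : ∀ f m, Φ₀ (f ⊗ₜ m) = φ f m := fun f m => TensorProduct.liftAddHom_tmul ..
  have h1 : (balancedRel A B F M).toAddSubgroup ≤ Φ₀.ker := by
    intro t ht
    refine Submodule.closure_induction (p := fun t _ => t ∈ Φ₀.ker) (zero_mem _)
      (fun _ _ _ _ hx hy => add_mem hx hy) ?_ ht
    rintro b _ ⟨f, a, m, rfl⟩
    rw [AddMonoidHom.mem_ker, smul_sub, TensorProduct.smul_tmul', TensorProduct.smul_tmul',
      map_sub, h0, h0, smul_comm, h, sub_self]
  exact ⟨QuotientAddGroup.lift _ Φ₀ h1, fun f m => h0 f m⟩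

/-- A balanced biadditive map that is linear for the left action factors through the tensor
product. -/
theorem exists_btLiftLinear {N : Type*} [AddCommGroup N] [Module B N] (φ : F →+ M →+ N)
    (h : ∀ f (a : A) m, φ (MulOpposite.op a • f) m = φ f (a • m))
    (h' : ∀ (b : B) f m, φ (b • f) m = b • φ f m) :
    ∃ Φ : BTensor A B F M →ₗ[B] N, ∀ f m, Φ (bt A f m) = φ f m := by
  obtain ⟨Φ, hΦ⟩ := exists_btLift (B := B) A φ h
  refine ⟨{ Φ with map_smul' := fun b t => ?_ }, hΦ⟩
  have := bt_induction A (K := (Φ.comp (DistribSMul.toAddMonoidHom (BTensor A B F M) b) -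
    (DistribSMul.toAddMonoidHom N b).comp Φ).ker) (fun f m => by
      rw [AddMonoidHom.mem_ker, AddMonoidHom.sub_apply, sub_eq_zero]
      change Φ (b • bt A f m) = b • Φ (bt A f m)
      rw [smul_bt, hΦ, hΦ, h']) t
  rw [AddMonoidHom.mem_ker, AddMonoidHom.sub_apply, sub_eq_zero] at this
  exact this

variable (B) in
/-- The grading of a tensor product: the piece of degree `d` is generated by the `f ⊗ m` with `f`
and `m` homogeneous and `deg f + deg m = d`. -/
def btGr (grF : ℤ → AddSubgroup F) (grM : ℤ → AddSubgroup M) (d : ℤ) :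
    AddSubgroup (BTensor A B F M) :=
  AddSubgroup.closure {t | ∃ i j f m, i + j = d ∧ f ∈ grF i ∧ m ∈ grM j ∧ t = bt A f m}

theorem btGr_isInternal {grA : ℤ → AddSubgroup A} {grF : ℤ → AddSubgroup F}
    {grM : ℤ → AddSubgroup M} (hA : DirectSum.IsInternal grA) (hF : DirectSum.IsInternal grF)
    (hM : DirectSum.IsInternal grM)
    (hAF : ∀ i j, ∀ f ∈ grF i, ∀ a ∈ grA j, MulOpposite.op a • f ∈ grF (i + j))
    (hAM : ∀ i j, ∀ a ∈ grA i, ∀ m ∈ grM j, a • m ∈ grM (i + j)) :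
    DirectSum.IsInternal (btGr A B grF grM) := by
  classical
  let φ : ℤ → F →+ M →+ BTensor A B F M := fun d =>
    (DirectSum.toAddMonoid (β := fun i => grF i) (fun i =>
      ((btHom A B).compl₂ (comp hM (d - i))).comp (grF i).subtype)).comp
      (decomp hF).toAddMonoidHom
  have hφ : ∀ d i f m, f ∈ grF i → φ d f m = bt A f (comp hM (d - i) m) := by
    intro d i f m hf
    have h2 : φ d f = DirectSum.toAddMonoid (β := fun i => grF i) (fun i =>
      ((btHom A B).compl₂ (comp hM (d - i))).comp (grF i).subtype) (decomp hF f) := rfl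
    rw [h2, decomp_of_mem hF i f hf, DirectSum.toAddMonoid_of]
    rfl
  have hbal : ∀ d f (a : A) m, φ d (MulOpposite.op a • f) m = φ d f (a • m) := by
    intro d f a m
    -- it suffices to treat homogeneous elements
    have key : ∀ i j l, ∀ f ∈ grF i, ∀ a ∈ grA j, ∀ m ∈ grM l,
        φ d (MulOpposite.op a • f) m = φ d f (a • m) := by
      intro i j l f hf a ha m hm
      rw [hφ d _ _ m (hAF i j f hf a ha), hφ d i f _ hf, comp_of_mem hM _ l m hm,
        comp_of_mem hM _ _ _ (hAM j l a ha m hm)]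
      by_cases h : l = d - (i + j)
      · rw [if_pos h, if_pos (by omega), bt_smul]
      · rw [if_neg h, if_neg (by omega), ← btHom_apply, ← btHom_apply, map_zero, map_zero]
    have h1 : ∀ i j, ∀ f ∈ grF i, ∀ a ∈ grA j, ∀ m,
        φ d (MulOpposite.op a • f) m = φ d f (a • m) := by
      intro i j f hf a ha m
      have := induction_homogeneous hM (K := (φ d (MulOpposite.op a • f) -
        (φ d f).comp (DistribSMul.toAddMonoidHom M a)).ker) (fun l m hm => by
          rw [AddMonoidHom.mem_ker, AddMonoidHom.sub_apply, sub_eq_zero]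
          exact key i j l f hf a ha m hm) m
      rw [AddMonoidHom.mem_ker, AddMonoidHom.sub_apply, sub_eq_zero] at this
      exact this
    have h2 : ∀ i, ∀ f ∈ grF i, ∀ (a : A) m, φ d (MulOpposite.op a • f) m = φ d f (a • m) := by
      intro i f hf a m
      have := induction_homogeneous hA (K := (((φ d).flip m).comp
        (AddMonoidHom.mk' (fun a : A => MulOpposite.op a • f)
          (fun a b => by rw [MulOpposite.op_add, add_smul])) -
        (φ d f).comp (AddMonoidHom.mk' (fun a : A => a • m) (fun a b => add_smul a b m))).ker)
        (fun j a ha => by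
          rw [AddMonoidHom.mem_ker, AddMonoidHom.sub_apply, sub_eq_zero]
          exact h1 i j f hf a ha m) a
      rw [AddMonoidHom.mem_ker, AddMonoidHom.sub_apply, sub_eq_zero] at this
      exact this
    have := induction_homogeneous hF (K := (((φ d).flip m).comp
        (DistribSMul.toAddMonoidHom F (MulOpposite.op a)) - (φ d).flip (a • m)).ker)
        (fun i f hf => by
          rw [AddMonoidHom.mem_ker, AddMonoidHom.sub_apply, sub_eq_zero]
          exact h2 i f hf a m) f
    rw [AddMonoidHom.mem_ker, AddMonoidHom.sub_apply, sub_eq_zero] at this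
    exact this
  choose π hπ using fun d => exists_btLift (B := B) A (φ d) (hbal d)
  refine isInternal_of_proj _ (AddMonoidHom.id _) (fun _ _ h => h) π ?_ ?_
  · intro d e t ht
    have : btGr A B grF grM e ≤
        (π d - if e = d then AddMonoidHom.id _ else 0).ker := by
      refine (AddSubgroup.closure_le _).2 ?_
      rintro _ ⟨i, j, f, m, hij, hf, hm, rfl⟩
      simp only [SetLike.mem_coe, AddMonoidHom.mem_ker, AddMonoidHom.sub_apply, sub_eq_zero]
      rw [hπ, hφ d i f m hf, comp_of_mem hM _ j m hm]
      by_cases h : e = d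
      · rw [if_pos (by omega), if_pos h]; rfl
      · rw [if_neg (by omega), if_neg h, ← btHom_apply, map_zero]; rfl
    have h2 := this ht
    rw [AddMonoidHom.mem_ker, AddMonoidHom.sub_apply, sub_eq_zero] at h2
    rw [h2]
    split_ifs <;> rfl
  · refine bt_induction A fun f m => ?_
    have h1 : f ∈ AddSubgroup.comap ((btHom A B).flip m) (⨆ d, btGr A B grF grM d) := by
      refine induction_homogeneous hF (fun i f hf => ?_) f
      have h2 : m ∈ AddSubgroup.comap (btHom A B f) (⨆ d, btGr A B grF grM d) := by
        refine induction_homogeneous hM (fun j m hm => ?_) m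
        exact AddSubgroup.mem_comap.2 (AddSubgroup.mem_iSup_of_mem (i + j)
          (AddSubgroup.subset_closure ⟨i, j, f, m, rfl, hf, hm, rfl⟩))
      exact h2
    exact h1

end BTensor

namespace BZero

open scoped Classical in
variable (R n k) in
/-- The projection of `B_0(n,k)` to its part of degree `d`. -/
def gradeProj (d : ℤ) : BZero R n k →+ BZero R n k where
  toFun a := ⟨fun x y => if h : ∃ j : ℕ, 2 * (j : ℤ) + fdeg x y = d
    then MvPolynomial.homogeneousComponent h.choose (a.coeff x y) else 0⟩
  map_zero' := by ext1; funext x y; simp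
  map_add' a b := by
    ext1; funext x y
    simp only [coeff_add]
    split_ifs <;> simp

theorem gradeProj_monomial (d : ℤ) (x y : IState n k) (m : Fin n →₀ ℕ) (c : R) :
    gradeProj R n k d (MvPolynomial.monomial m c • f x y) =
      if 2 * (m.degree : ℤ) + fdeg x y = d then MvPolynomial.monomial m c • f x y else 0 := by
  rw [← pf_eq]
  ext1; funext a b
  have h0 : ((if 2 * (m.degree : ℤ) + fdeg x y = d then pf x y (MvPolynomial.monomial m c) else 0 :
      BZero R n k)).coeff a b = if a = x ∧ b = y then
        (if 2 * (m.degree : ℤ) + fdeg x y = d then MvPolynomial.monomial m c else 0) else 0 := by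
    split_ifs <;> simp_all [coeff_pf]
  rw [h0]
  simp only [gradeProj, AddMonoidHom.coe_mk, ZeroHom.coe_mk, coeff_pf]
  by_cases hab : a = x ∧ b = y
  · obtain ⟨rfl, rfl⟩ := hab
    simp only [and_self, if_true]
    have hm : (MvPolynomial.monomial m c) ∈ MvPolynomial.homogeneousSubmodule (Fin n) R m.degree :=
      MvPolynomial.isHomogeneous_monomial c rfl
    split_ifs with h1 h2 h2
    · rw [MvPolynomial.homogeneousComponent_of_mem hm, if_pos]
      have := h1.choose_spec
      omega
    · rw [MvPolynomial.homogeneousComponent_of_mem hm, if_neg]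
      have := h1.choose_spec
      omega
    · exact absurd ⟨_, h2⟩ h1
    · rfl
  · simp [hab]

theorem ElRel.eq_monomial {x z : IState n k} {e : BZero R n k} (h : ElRel x z e) :
    ∃ s : Fin n →₀ ℕ, e = MvPolynomial.monomial s (1 : R) • f x z := by
  cases h with
  | RR i j h x y z h1 h2 => exact ⟨_, f_mul_f _ _ _⟩
  | LL i j h x y z h1 h2 => exact ⟨_, f_mul_f _ _ _⟩
  | U i x h h' => exact ⟨_, rfl⟩

theorem toB_gradeProj (d : ℤ) (a : BZero R n k) (ha : a ∈ relIdeal R n k) :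
    toB (gradeProj R n k d a) = 0 := by
  refine relIdeal_le (K := ((toB : BZero R n k →+* BFull R n k).toAddMonoidHom.comp
    (gradeProj R n k d)).ker) ?_ a ha
  intro x z a b e p he
  induction p using MvPolynomial.induction_on' with
  | monomial m c =>
    change toB (gradeProj R n k d _) = 0
    obtain ⟨s, hs⟩ := he.eq_monomial
    have h2 : MvPolynomial.monomial m c • (f a x * e * f z b) ∈ relIdeal R n k := by
      rw [Algebra.smul_def]
      exact (relIdeal R n k).mul_mem_left _
        ((relIdeal R n k).mul_mem_right _ ((relIdeal R n k).mul_mem_left _ he.mem))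
    have h3 : ∃ m' : Fin n →₀ ℕ, MvPolynomial.monomial m c • (f a x * e * f z b) =
        MvPolynomial.monomial m' c • (f a b : BZero R n k) := by
      rw [hs, mul_smul_comm, f_mul_f, smul_smul, smul_mul_assoc, f_mul_f, smul_smul, smul_smul,
        MvPolynomial.monomial_mul, MvPolynomial.monomial_mul, MvPolynomial.monomial_mul,
        mul_one, mul_one, mul_one]
      exact ⟨_, rfl⟩
    obtain ⟨m', h3⟩ := h3
    rw [h3] at h2 ⊢
    rw [gradeProj_monomial]
    split_ifs
    · exact toB_eq_zero.2 h2
    · exact map_zero _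
  | add p q hp hq => rw [add_smul]; exact add_mem hp hq

variable (R n k) in
/-- The projection of `B(n,k)` to its part of degree `d`. -/
def gradeProjB (d : ℤ) : BFull R n k →+ BFull R n k :=
  QuotientAddGroup.lift (relIdeal R n k).toAddSubgroup
    ((toB : BZero R n k →+* BFull R n k).toAddMonoidHom.comp (gradeProj R n k d))
    (fun a ha => toB_gradeProj d a ha)

theorem gradeProjB_toB (d : ℤ) (a : BZero R n k) :
    gradeProjB R n k d (toB a) = toB (gradeProj R n k d a) := rfl

end BZero

namespace OSzAlg

variable (R n k) in
/-- The grading of `B_l(n,k)`: the degree of `U_i` is `2` and the degree of `f_{x,y}` is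
`∑ i, |v_i^x - v_i^y|`. -/
def gr (d : ℤ) : AddSubgroup (OSzAlg R n k) :=
  AddSubgroup.closure {b | ∃ (x y : LState n k) (m : Fin n →₀ ℕ) (c : R),
    2 * (m.degree : ℤ) + fdeg x.1 y.1 = d ∧ b = gen x y (MvPolynomial.monomial m c)}

theorem gen_monomial_mem (x y : LState n k) (m : Fin n →₀ ℕ) (c : R) :
    gen x y (MvPolynomial.monomial m c) ∈ gr R n k (2 * (m.degree : ℤ) + fdeg x.1 y.1) :=
  AddSubgroup.subset_closure ⟨x, y, m, c, rfl, rfl⟩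

theorem gr_isInternal : DirectSum.IsInternal (gr R n k) := by
  refine isInternal_of_proj _ (AddMonoidHomClass.toAddMonoidHom (val R n k)) val_injective
    (fun d => (gradeProjB R n k d).comp (AddMonoidHomClass.toAddMonoidHom (val R n k))) ?_ ?_
  · intro d e b hb
    induction hb using AddSubgroup.closure_induction with
    | mem b hb =>
      obtain ⟨x, y, m, c, hm, rfl⟩ := hb
      change gradeProjB R n k d (val R n k (gen x y _)) = if e = d then val R n k (gen x y _) else 0
      rw [val_gen, gradeProjB_toB, gradeProj_monomial, hm]
      split_ifs
      · rfl
      · exact map_zero _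
    | zero => simp
    | add a b _ _ ha hb => rw [map_add, ha, hb]; split_ifs <;> simp
    | neg a _ ha => rw [map_neg, ha]; split_ifs <;> simp
  · refine induction_gen fun x y p => ?_
    induction p using MvPolynomial.induction_on' with
    | monomial m c => exact AddSubgroup.mem_iSup_of_mem _ (gen_monomial_mem x y m c)
    | add p q hp hq => rw [gen_add]; exact add_mem hp hq

theorem mul_mem_gr {i j : ℤ} {a b : OSzAlg R n k} (ha : a ∈ gr R n k i) (hb : b ∈ gr R n k j) :
    a * b ∈ gr R n k (i + j) := by
  induction ha using AddSubgroup.closure_induction with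
  | mem a ha =>
    obtain ⟨x, y, m, c, hm, rfl⟩ := ha
    induction hb using AddSubgroup.closure_induction with
    | mem b hb =>
      obtain ⟨y', z, m', c', hm', rfl⟩ := hb
      by_cases h : y = y'
      · subst h
        rw [gen_mul_gen, MvPolynomial.monomial_mul, MvPolynomial.monomial_mul]
        have h1 := gen_monomial_mem x z (gvec x.1 y.1 z.1 + (m + m')) (1 * (c * c'))
        have h2 := degree_gvec x.1 y.1 z.1
        have h3 : 2 * ((gvec x.1 y.1 z.1 + (m + m')).degree : ℤ) + fdeg x.1 z.1 = i + j := by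
          rw [map_add, map_add]
          push_cast
          omega
        rwa [h3] at h1
      · rw [gen_mul_gen_ne h]; exact zero_mem _
    | zero => rw [mul_zero]; exact zero_mem _
    | add a b _ _ ha hb => rw [mul_add]; exact add_mem ha hb
    | neg a _ ha => rw [mul_neg]; exact neg_mem ha
  | zero => rw [zero_mul]; exact zero_mem _
  | add a b _ _ ha hb => rw [add_mul]; exact add_mem ha hb
  | neg a _ ha => rw [neg_mul]; exact neg_mem ha

theorem idem_mem_gr (x : LState n k) : (idem x : OSzAlg R n k) ∈ gr R n k 0 := by
  have := gen_monomial_mem x x 0 (1 : R)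
  have h0 : fdeg x.1 x.1 = 0 := by simp [fdeg, vdist]
  rw [h0] at this
  simpa [idem] using this

theorem eVee_mem_gr : eVee R n k ∈ gr R n k 0 := sum_mem fun x _ => idem_mem_gr x

theorem psi_mem_gr {i : ℤ} {b : OSzAlg R n (k + 1)} (hb : b ∈ gr R n (k + 1) i) :
    psi R n k b ∈ gr R n k i := by
  induction hb using AddSubgroup.closure_induction with
  | mem b hb =>
    obtain ⟨x, y, m, c, hm, rfl⟩ := hb
    by_cases h : 0 ∈ x.1.1 ∧ 0 ∈ y.1.1
    · rw [psi_gen _ _ h.1 h.2]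
      have := gen_monomial_mem (x.removeZero h.1) (y.removeZero h.2) m c
      rw [← hm]
      rwa [show fdeg (x.removeZero h.1).1 (y.removeZero h.2).1 = fdeg x.1 y.1 from
        fdeg_removeZero _ _ h.1 h.2] at this
    · rw [psi_gen_zero _ _ (by tauto)]; exact zero_mem _
  | zero => rw [map_zero]; exact zero_mem _
  | add a b _ _ ha hb => rw [map_add]; exact add_mem ha hb
  | neg a _ ha => rw [map_neg]; exact neg_mem ha

theorem idem_mul_idem (x : LState n k) : (idem x * idem x : OSzAlg R n k) = idem x := by
  rw [idem, gen_mul_gen, gvec_left]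
  congr 1
  exact (one_mul _).trans (one_mul _)

end OSzAlg

section LeftIdeal

/-- The grading of a left ideal, induced by a grading of the ring. -/
def idealGr {A : Type*} [Ring A] (grA : ℤ → AddSubgroup A) (I : Ideal A) (d : ℤ) : AddSubgroup I :=
  (grA d).comap I.subtype.toAddMonoidHom

variable {A : Type*} [Ring A] (e : A)

/-- Right multiplication by an idempotent. -/
def mulRightIdem : A →ₗ[A] Ideal.span {e} where
  toFun a := ⟨a * e, Ideal.mem_span_singleton'.2 ⟨a, rfl⟩⟩
  map_add' a b := Subtype.ext (add_mul a b e)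
  map_smul' a b := Subtype.ext (mul_assoc a b e)

theorem mulRightIdem_coe (he : e * e = e) (a : Ideal.span {e}) : mulRightIdem e a = a := by
  refine Subtype.ext ?_
  obtain ⟨b, hb⟩ := Ideal.mem_span_singleton'.1 a.2
  change a.1 * e = a.1
  rw [← hb, mul_assoc, he]

theorem finite_idem (he : e * e = e) : Module.Finite A (Ideal.span {e}) :=
  Module.Finite.of_surjective (mulRightIdem e) fun a => ⟨a, mulRightIdem_coe e he a⟩

theorem projective_idem (he : e * e = e) : Module.Projective A (Ideal.span {e}) :=
  Module.Projective.of_split (Submodule.subtype _) (mulRightIdem e)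
    (LinearMap.ext fun a => mulRightIdem_coe e he a)

theorem idealGr_isInternal (he : e * e = e) {grA : ℤ → AddSubgroup A} (hA : DirectSum.IsInternal grA)
    (hmul : ∀ i j, ∀ a ∈ grA i, ∀ b ∈ grA j, a * b ∈ grA (i + j)) (h0 : e ∈ grA 0) :
    DirectSum.IsInternal (idealGr grA (Ideal.span {e})) :=
  isInternal_comap hA _ Subtype.val_injective (mulRightIdem e).toAddMonoidHom
    (mulRightIdem_coe e he) fun d m hm => by
      have := hmul d 0 m hm e h0
      rwa [add_zero] at this

end LeftIdeal

/-! Graded projective modules. -/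

/-- A finitely generated projective graded left module over a graded ring. -/
structure GrProj (A : Type u) [Ring A] (grA : ℤ → AddSubgroup A) where
  carrier : Type u
  [addCommGroup : AddCommGroup carrier]
  [module : Module A carrier]
  gr : ℤ → AddSubgroup carrier
  isInternal : DirectSum.IsInternal gr
  smul_mem : ∀ i j, ∀ a ∈ grA i, ∀ m ∈ gr j, a • m ∈ gr (i + j)
  [finite : Module.Finite A carrier]
  [projective : Module.Projective A carrier]

attribute [instance] GrProj.addCommGroup GrProj.module GrProj.finite GrProj.projective

/-- The category `B_l(n,k)-proj`: its objects. -/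
abbrev OSzProj (R : Type u) [CommRing R] (n k : ℕ) : Type (u + 1) :=
  GrProj (OSzAlg R n k) (OSzAlg.gr R n k)

/-- The module `P(x) = B_l(n,k) I_x`. -/
def projP (x : LState n k) : OSzProj R n k :=
  haveI := finite_idem (idem x : OSzAlg R n k) (idem_mul_idem x)
  haveI := projective_idem (idem x : OSzAlg R n k) (idem_mul_idem x)
  { carrier := Ideal.span {(idem x : OSzAlg R n k)}
    gr := idealGr (OSzAlg.gr R n k) _
    isInternal := idealGr_isInternal _ (idem_mul_idem x) gr_isInternal
      (fun _ _ _ ha _ hb => mul_mem_gr ha hb) (idem_mem_gr x)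
    smul_mem := fun _ _ _ ha _ hm => mul_mem_gr ha hm }

theorem bt_retract {A B F M : Type*} [Ring A] [Ring B] [AddCommGroup F] [AddCommGroup M]
    [Module B F] [Module Aᵐᵒᵖ F] [SMulCommClass B Aᵐᵒᵖ F] [Module A M]
    [Module.Finite A M] [Module.Projective A M] :
    ∃ (m : ℕ) (α : BTensor A B F M →ₗ[B] (Fin m → F)) (β : (Fin m → F) →ₗ[B] BTensor A B F M),
      β ∘ₗ α = LinearMap.id := by
  obtain ⟨m, s, g, -, -, hs⟩ := Module.Finite.exists_comp_eq_id_of_projective A M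
  obtain ⟨α, hα⟩ := exists_btLiftLinear (B := B) (F := F) (M := M) (N := Fin m → F) A
    (AddMonoidHom.mk' (fun f => AddMonoidHom.mk' (fun x j => MulOpposite.op (g x j) • f)
      (fun x y => by funext j; simp [add_smul])) (fun f f' => by ext x j; simp))
    (fun f a x => by
      funext j
      simp only [AddMonoidHom.mk'_apply, map_smul, Pi.smul_apply, smul_eq_mul, MulOpposite.op_mul,
        mul_smul])
    (fun b f x => by
      funext j
      simp only [AddMonoidHom.mk'_apply, Pi.smul_apply]
      exact (smul_comm _ _ _).symm)
  obtain ⟨β, hβ⟩ : ∃ β : (Fin m → F) →ₗ[B] BTensor A B F M,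
      ∀ v, β v = ∑ j, bt A (v j) (s (Pi.single j 1)) :=
    ⟨{  toFun := fun v => ∑ j, bt A (v j) (s (Pi.single j 1))
        map_add' := fun v w => by
          rw [← Finset.sum_add_distrib]
          refine Finset.sum_congr rfl fun j _ => ?_
          simp only [← btHom_apply, Pi.add_apply, map_add, AddMonoidHom.add_apply]
        map_smul' := fun b v => by
          rw [RingHom.id_apply, Finset.smul_sum]
          exact Finset.sum_congr rfl fun j _ => (smul_bt A b _ _).symm }, fun _ => rfl⟩
  refine ⟨m, α, β, ?_⟩
  refine LinearMap.ext fun t => ?_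
  have := bt_induction A (K := (β ∘ₗ α - LinearMap.id).toAddMonoidHom.ker) (fun f x => by
    change (β ∘ₗ α - LinearMap.id : BTensor A B F M →ₗ[B] BTensor A B F M) (bt A f x) = 0
    rw [LinearMap.sub_apply, sub_eq_zero, LinearMap.comp_apply, hα, hβ]
    change ∑ j, bt A (MulOpposite.op (g x j) • f) (s (Pi.single j 1)) = bt A f x
    have h1 : ∀ j, bt A (MulOpposite.op (g x j) • f) (s (Pi.single j 1)) =
        btHom A B f (g x j • s (Pi.single j 1)) := fun j => bt_smul A _ _ _
    rw [Finset.sum_congr rfl fun j _ => h1 j, ← map_sum, ← btHom_apply]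
    congr 1
    simp only [← map_smul]
    rw [← map_sum]
    conv_rhs => rw [← LinearMap.id_apply (R := A) x, ← hs, LinearMap.comp_apply]
    congr 1
    funext i
    simp [Finset.sum_apply, Pi.single_apply]) t
  exact sub_eq_zero.1 this

section TensorMaps

variable (A : Type*) {B F M M' L N : Type*} [Ring A] [Ring B] [AddCommGroup F] [AddCommGroup M]
  [AddCommGroup M'] [AddCommGroup L] [AddCommGroup N] [Module B F] [Module Aᵐᵒᵖ F]
  [SMulCommClass B Aᵐᵒᵖ F] [Module A M] [Module A M'] [Module A L] [Module A N]

theorem bt_linear_ext {T : Type*} [AddCommGroup T] [Module B T] {φ χ : BTensor A B F M →ₗ[B] T}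
    (h : ∀ f m, φ (bt A f m) = χ (bt A f m)) : φ = χ := by
  refine LinearMap.ext fun t => ?_
  have := bt_induction A (K := (φ - χ).toAddMonoidHom.ker) (fun f m => by
    change (φ - χ) (bt A f m) = 0
    rw [LinearMap.sub_apply, sub_eq_zero, h]) t
  exact sub_eq_zero.1 this

variable (B F) in
/-- A linear map induces a map of tensor products. -/
theorem exists_btMap (φ : M →ₗ[A] M') : ∃ Φ : BTensor A B F M →ₗ[B] BTensor A B F M',
    ∀ f m, Φ (bt A f m) = bt A f (φ m) :=
  exists_btLiftLinear A
    (AddMonoidHom.mk' (fun f => (btHom A B f).comp φ.toAddMonoidHom) fun f f' => by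
      ext m; simp)
    (fun f a m => by
      change bt A _ (φ m) = bt A _ (φ (a • m))
      rw [map_smul, bt_smul])
    (fun b f m => (smul_bt A b f (φ m)).symm)

theorem map_btGr {T : Type*} [AddCommGroup T] {grF : ℤ → AddSubgroup F} {grM : ℤ → AddSubgroup M}
    {d : ℤ} (φ : BTensor A B F M →+ T) (K : AddSubgroup T)
    (h : ∀ i j f m, i + j = d → f ∈ grF i → m ∈ grM j → φ (bt A f m) ∈ K) :
    ∀ t ∈ btGr A B grF grM d, φ t ∈ K := fun t ht =>
  (AddSubgroup.closure_le (K.comap φ)).2 (by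
    rintro _ ⟨i, j, f, m, hij, hf, hm, rfl⟩
    exact h i j f m hij hf hm) ht

theorem exists_btCongr (e : M ≃ₗ[A] M') (grF : ℤ → AddSubgroup F) {grM : ℤ → AddSubgroup M}
    {grM' : ℤ → AddSubgroup M'} (i : ℤ) (he : ∀ d, ∀ m ∈ grM d, e m ∈ grM' (d + i)) :
    ∃ Φ : BTensor A B F M ≃ₗ[B] BTensor A B F M',
      ∀ d, ∀ t ∈ btGr A B grF grM d, Φ t ∈ btGr A B grF grM' (d + i) := by
  obtain ⟨Φ, hΦ⟩ := exists_btMap A B F e.toLinearMap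
  obtain ⟨Ψ, hΨ⟩ := exists_btMap A B F e.symm.toLinearMap
  refine ⟨LinearEquiv.ofLinearMap Φ Ψ (bt_linear_ext A fun f m => by simp [hΦ, hΨ])
    (bt_linear_ext A fun f m => by simp [hΦ, hΨ]), fun d => ?_⟩
  refine map_btGr A Φ.toAddMonoidHom _ fun i' j f m hij hf hm => ?_
  change Φ _ ∈ _
  rw [hΦ]
  exact AddSubgroup.subset_closure ⟨i', j + i, f, _, by omega, hf, he j m hm, rfl⟩

theorem exists_btProd (e : (L × N) ≃ₗ[A] M) (grF : ℤ → AddSubgroup F) {grL : ℤ → AddSubgroup L}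
    {grN : ℤ → AddSubgroup N} {grM : ℤ → AddSubgroup M}
    (he : ∀ d, ∀ l ∈ grL d, ∀ m ∈ grN d, e (l, m) ∈ grM d) :
    ∃ Φ : (BTensor A B F L × BTensor A B F N) ≃ₗ[B] BTensor A B F M,
      ∀ d, ∀ l ∈ btGr A B grF grL d, ∀ m ∈ btGr A B grF grN d, Φ (l, m) ∈ btGr A B grF grM d := by
  obtain ⟨i, hi⟩ := exists_btMap A B F (e.toLinearMap ∘ₗ LinearMap.inl A L N)
  obtain ⟨j, hj⟩ := exists_btMap A B F (e.toLinearMap ∘ₗ LinearMap.inr A L N)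
  obtain ⟨p, hp⟩ := exists_btMap A B F (LinearMap.fst A L N ∘ₗ e.symm.toLinearMap)
  obtain ⟨r, hr⟩ := exists_btMap A B F (LinearMap.snd A L N ∘ₗ e.symm.toLinearMap)
  have h0 : ∀ f : F, (bt A f (0 : L) : BTensor A B F L) = 0 := fun f => (btHom A B f).map_zero
  have h0' : ∀ f : F, (bt A f (0 : N) : BTensor A B F N) = 0 := fun f => (btHom A B f).map_zero
  refine ⟨LinearEquiv.ofLinearMap (i.coprod j) (p.prod r) ?_ ?_, fun d l hl m hm => ?_⟩
  · refine bt_linear_ext A fun f m => ?_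
    change i (p _) + j (r _) = _
    rw [hp, hr, hi, hj, ← btHom_apply, ← btHom_apply, ← map_add]
    change btHom A B f _ = btHom A B f m
    congr 1
    simp [← map_add]
  · refine LinearMap.prod_ext (bt_linear_ext A fun f m => ?_) (bt_linear_ext A fun f m => ?_)
    · simp [hp, hr, hi, h0']
    · simp [hp, hr, hj, h0]
  · change i l + j m ∈ _
    refine add_mem (map_btGr A i.toAddMonoidHom _ (fun i' j' f m hij hf hm => ?_) l hl)
      (map_btGr A j.toAddMonoidHom _ (fun i' j' f m hij hf hm => ?_) m hm)
    · change i _ ∈ _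
      rw [hi]
      exact AddSubgroup.subset_closure ⟨i', j', f, _, hij, hf, he j' m hm 0 (zero_mem _), rfl⟩
    · change j _ ∈ _
      rw [hj]
      exact AddSubgroup.subset_closure ⟨i', j', f, _, hij, hf, he j' 0 (zero_mem _) m hm, rfl⟩

end TensorMaps

section Functor

variable [NeZero n]

/-- The functor `F_k : B_l(n,k+1)-proj → B_l(n,k)-proj` given by the tensor product with the
bimodule `F_k`, on objects. -/
def tensorF (M : OSzProj R n (k + 1)) : OSzProj R n k :=
  haveI hF : Module.Finite (OSzAlg R n k) (FBim R n k) := finite_idem _ eVee_mul_eVee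
  haveI hF' : Module.Projective (OSzAlg R n k) (FBim R n k) := projective_idem _ eVee_mul_eVee
  { carrier := BTensor (OSzAlg R n (k + 1)) (OSzAlg R n k) (FBim R n k) M.carrier
    gr := btGr (OSzAlg R n (k + 1)) (OSzAlg R n k) (idealGr (OSzAlg.gr R n k) _) M.gr
    isInternal := btGr_isInternal _ gr_isInternal
      (idealGr_isInternal _ eVee_mul_eVee gr_isInternal
        (fun _ _ _ ha _ hb => mul_mem_gr ha hb) eVee_mem_gr) M.isInternal
      (fun _ _ _ hf _ ha => mul_mem_gr hf (psi_mem_gr ha)) M.smul_mem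
    smul_mem := fun i j a ha => map_btGr _ (DistribSMul.toAddMonoidHom _ a) _
      fun i' j' f m hij hf hm => by
        change a • bt _ f m ∈ _
        rw [smul_bt]
        exact AddSubgroup.subset_closure
          ⟨i + i', j', a • f, m, by omega, mul_mem_gr ha hf, hm, rfl⟩
    finite := by
      obtain ⟨m, α, β, h⟩ := bt_retract (A := OSzAlg R n (k + 1)) (B := OSzAlg R n k)
        (F := FBim R n k) (M := M.carrier)
      exact Module.Finite.of_surjective β fun t => ⟨α t, LinearMap.congr_fun h t⟩
    projective := by
      obtain ⟨m, α, β, h⟩ := bt_retract (A := OSzAlg R n (k + 1)) (B := OSzAlg R n k)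
        (F := FBim R n k) (M := M.carrier)
      have : Module.Projective (OSzAlg R n k) (Fin m → FBim R n k) :=
        Module.Projective.of_equiv (DFinsupp.linearEquivFunOnFintype (R := OSzAlg R n k)
          (M := fun _ : Fin m => FBim R n k))
      exact Module.Projective.of_split α β h }

end Functor

section K0

open LaurentPolynomial

variable (A : Type u) [Ring A] (grA : ℤ → AddSubgroup A)

/-- The relations of the Grothendieck group of finitely generated projective graded modules:
`[M] = [L] + [N]` if `M` is isomorphic to `L ⊕ N`, and `[M'] = q^i [M]` if `M'` is isomorphic to
`q^i M`, the module `M` with its degrees shifted upwards by `i`. -/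
inductive K0Rel : (GrProj A grA →₀ ℤ[T;T⁻¹]) → Prop
  | sum (L N M : GrProj A grA) (e : (L.carrier × N.carrier) ≃ₗ[A] M.carrier)
      (he : ∀ d, ∀ l ∈ L.gr d, ∀ m ∈ N.gr d, e (l, m) ∈ M.gr d) :
      K0Rel (Finsupp.single M 1 - Finsupp.single L 1 - Finsupp.single N 1)
  | shift (i : ℤ) (M M' : GrProj A grA) (e : M.carrier ≃ₗ[A] M'.carrier)
      (he : ∀ d, ∀ m ∈ M.gr d, e m ∈ M'.gr (d + i)) :
      K0Rel (Finsupp.single M' 1 - Finsupp.single M (T i))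

/-- The Grothendieck group of finitely generated projective graded modules. Short exact sequences of
projective modules split, so it is the group generated by the classes `[M]` of the objects, with the
relations `[M] = [L] + [N]` for `M` isomorphic to `L ⊕ N`. It is a module over `ℤ[q, q⁻¹]`, where
`q [M] = [q M]`, and it is presented here as such. The variable `q` is `T 1`. -/
def K0 : Type (u + 1) :=
  (GrProj A grA →₀ ℤ[T;T⁻¹]) ⧸ Submodule.span ℤ[T;T⁻¹] {r | K0Rel A grA r}

instance : AddCommGroup (K0 A grA) := inferInstanceAs (AddCommGroup (_ ⧸ Submodule.span _ _))

instance : Module ℤ[T;T⁻¹] (K0 A grA) := inferInstanceAs (Module _ (_ ⧸ Submodule.span _ _))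

variable {A grA}

/-- The class `[M]`. -/
def K0.cls (M : GrProj A grA) : K0 A grA :=
  (Submodule.span ℤ[T;T⁻¹] {r | K0Rel A grA r}).mkQ (Finsupp.single M 1)

variable [NeZero n]

variable (R n k) in
/-- The Grothendieck group of `B_l(n,k)-proj`. -/
abbrev OSzK0 : Type (u + 1) := K0 (OSzAlg R n k) (OSzAlg.gr R n k)

theorem tensorF_rel {r : OSzProj R n (k + 1) →₀ ℤ[T;T⁻¹]}
    (h : K0Rel (OSzAlg R n (k + 1)) (OSzAlg.gr R n (k + 1)) r) :
    K0Rel (OSzAlg R n k) (OSzAlg.gr R n k)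
      (Finsupp.lmapDomain ℤ[T;T⁻¹] ℤ[T;T⁻¹] tensorF r) := by
  cases h with
  | sum L N M e he =>
    simp only [map_sub, Finsupp.lmapDomain_apply, Finsupp.mapDomain_single]
    obtain ⟨Φ, hΦ⟩ := exists_btProd (OSzAlg R n (k + 1)) (B := OSzAlg R n k) (F := FBim R n k) e
      (idealGr (OSzAlg.gr R n k) _) he
    exact K0Rel.sum (tensorF L) (tensorF N) (tensorF M) Φ hΦ
  | shift i M M' e he =>
    simp only [map_sub, Finsupp.lmapDomain_apply, Finsupp.mapDomain_single]
    obtain ⟨Φ, hΦ⟩ := exists_btCongr (OSzAlg R n (k + 1)) (B := OSzAlg R n k) (F := FBim R n k) e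
      (idealGr (OSzAlg.gr R n k) _) i he
    exact K0Rel.shift i (tensorF M) (tensorF M') Φ hΦ

variable (R n k) in
/-- The map of Grothendieck groups induced by the functor `F_k`: `[M] ↦ [F_k ⊗ M]`. -/
def K0F : OSzK0 R n (k + 1) →ₗ[ℤ[T;T⁻¹]] OSzK0 R n k :=
  Submodule.mapQ _ _ (Finsupp.lmapDomain ℤ[T;T⁻¹] ℤ[T;T⁻¹] tensorF)
    (Submodule.span_le.2 fun _ hr => Submodule.subset_span (tensorF_rel hr))

theorem K0F_cls (M : OSzProj R n (k + 1)) : K0F R n k (K0.cls M) = K0.cls (tensorF M) := by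
  have h : Finsupp.lmapDomain ℤ[T;T⁻¹] ℤ[T;T⁻¹] (tensorF (R := R) (n := n) (k := k))
      (Finsupp.single M 1) = Finsupp.single (tensorF M) 1 := Finsupp.mapDomain_single
  exact congrArg (Submodule.mkQ _) h

end K0

/-! The quantum group of `gl(1|1)`. -/

/-- The field `ℂ(q)`. -/
abbrev Cq : Type := RatFunc ℂ

/-- The variable `q`. -/
def qq : Cq := RatFunc.X

theorem qq_ne_zero : qq ≠ 0 := RatFunc.X_ne_zero

theorem qq_sub_ne_zero : qq - qq⁻¹ ≠ 0 := by
  intro h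
  have h1 : qq * qq = 1 := by
    have h2 : qq = qq⁻¹ := sub_eq_zero.1 h
    calc qq * qq = qq * qq⁻¹ := by rw [← h2]
      _ = 1 := mul_inv_cancel₀ qq_ne_zero
  have h3 : (algebraMap (Polynomial ℂ) Cq) (Polynomial.X * Polynomial.X) =
      algebraMap (Polynomial ℂ) Cq 1 := by
    rw [map_mul, RatFunc.algebraMap_X, map_one]; exact h1
  have h4 := RatFunc.algebraMap_injective ℂ h3
  have h5 := congrArg (Polynomial.eval 0) h4
  simp at h5

/-- The generators of `U_q(gl(1|1))`. The generators `E` and `F` are odd, the others are even. -/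
inductive UGen : Type
  | E | F | K1 | K1inv | K2 | K2inv

open UGen in
/-- The defining relations of `U_q(gl(1|1))`, where `K = K_1 K_2`. -/
inductive URel : FreeAlgebra Cq UGen → FreeAlgebra Cq UGen → Prop
  | comm : URel (FreeAlgebra.ι Cq K1 * FreeAlgebra.ι Cq K2)
      (FreeAlgebra.ι Cq K2 * FreeAlgebra.ι Cq K1)
  | inv1 : URel (FreeAlgebra.ι Cq K1 * FreeAlgebra.ι Cq K1inv) 1
  | inv1' : URel (FreeAlgebra.ι Cq K1inv * FreeAlgebra.ι Cq K1) 1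
  | inv2 : URel (FreeAlgebra.ι Cq K2 * FreeAlgebra.ι Cq K2inv) 1
  | inv2' : URel (FreeAlgebra.ι Cq K2inv * FreeAlgebra.ι Cq K2) 1
  | K1E : URel (FreeAlgebra.ι Cq K1 * FreeAlgebra.ι Cq E)
      (qq • (FreeAlgebra.ι Cq E * FreeAlgebra.ι Cq K1))
  | K2E : URel (FreeAlgebra.ι Cq K2 * FreeAlgebra.ι Cq E)
      (qq⁻¹ • (FreeAlgebra.ι Cq E * FreeAlgebra.ι Cq K2))
  | K1F : URel (FreeAlgebra.ι Cq K1 * FreeAlgebra.ι Cq F)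
      (qq⁻¹ • (FreeAlgebra.ι Cq F * FreeAlgebra.ι Cq K1))
  | K2F : URel (FreeAlgebra.ι Cq K2 * FreeAlgebra.ι Cq F)
      (qq • (FreeAlgebra.ι Cq F * FreeAlgebra.ι Cq K2))
  | EE : URel (FreeAlgebra.ι Cq E * FreeAlgebra.ι Cq E) 0
  | FF : URel (FreeAlgebra.ι Cq F * FreeAlgebra.ι Cq F) 0
  | EF : URel (FreeAlgebra.ι Cq E * FreeAlgebra.ι Cq F + FreeAlgebra.ι Cq F * FreeAlgebra.ι Cq E)
      ((qq - qq⁻¹)⁻¹ • (FreeAlgebra.ι Cq K1 * FreeAlgebra.ι Cq K2 -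
        FreeAlgebra.ι Cq K1inv * FreeAlgebra.ι Cq K2inv))

/-- The quantum group `U_q(gl(1|1))`, as an algebra over `ℂ(q)`. -/
abbrev Uq : Type := RingQuot URel

/-- The generators, as elements of `U_q(gl(1|1))`. -/
def Uq.gen (g : UGen) : Uq := RingQuot.mkAlgHom Cq URel (FreeAlgebra.ι Cq g)

/-- An algebra with elements that satisfy the relations. -/
structure UFamily {A : Type*} [Ring A] [Algebra Cq A] (E F K1 K1inv K2 K2inv : A) : Prop where
  comm : K1 * K2 = K2 * K1
  inv1 : K1 * K1inv = 1
  inv1' : K1inv * K1 = 1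
  inv2 : K2 * K2inv = 1
  inv2' : K2inv * K2 = 1
  K1E : K1 * E = qq • (E * K1)
  K2E : K2 * E = qq⁻¹ • (E * K2)
  K1F : K1 * F = qq⁻¹ • (F * K1)
  K2F : K2 * F = qq • (F * K2)
  EE : E * E = 0
  FF : F * F = 0
  EF : E * F + F * E = (qq - qq⁻¹)⁻¹ • (K1 * K2 - K1inv * K2inv)

/-- The images of the generators under an algebra homomorphism. -/
def UGen.pick {A : Type*} (E F K1 K1inv K2 K2inv : A) : UGen → A
  | .E => E
  | .F => F
  | .K1 => K1
  | .K1inv => K1inv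
  | .K2 => K2
  | .K2inv => K2inv

/-- The algebra homomorphism defined by elements that satisfy the relations. -/
def UFamily.lift {A : Type*} [Ring A] [Algebra Cq A] {E F K1 K1inv K2 K2inv : A}
    (h : UFamily E F K1 K1inv K2 K2inv) : Uq →ₐ[Cq] A :=
  RingQuot.liftAlgHom Cq ⟨FreeAlgebra.lift Cq (UGen.pick E F K1 K1inv K2 K2inv), by
    intro a b hab
    cases hab <;> simp only [map_mul, map_add, map_sub, map_smul, map_one, map_zero,
      FreeAlgebra.lift_ι_apply, UGen.pick, h.comm, h.inv1, h.inv1', h.inv2, h.inv2', h.K1E, h.K2E,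
      h.K1F, h.K2F, h.EE, h.FF, h.EF]⟩

theorem UFamily.lift_gen {A : Type*} [Ring A] [Algebra Cq A] {E F K1 K1inv K2 K2inv : A}
    (h : UFamily E F K1 K1inv K2 K2inv) (g : UGen) :
    h.lift (Uq.gen g) = UGen.pick E F K1 K1inv K2 K2inv g := by
  rw [UFamily.lift, Uq.gen, RingQuot.liftAlgHom_mkAlgHom_apply, FreeAlgebra.lift_ι_apply]

/-- The generators of `U_q(gl(1|1))` satisfy the relations. -/
theorem Uq.family : UFamily (Uq.gen .E) (Uq.gen .F) (Uq.gen .K1) (Uq.gen .K1inv) (Uq.gen .K2)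
    (Uq.gen .K2inv) := by
  have key : ∀ {a b : FreeAlgebra Cq UGen}, URel a b →
      RingQuot.mkAlgHom Cq URel a = RingQuot.mkAlgHom Cq URel b := RingQuot.mkAlgHom_rel Cq
  constructor
  · simpa only [Uq.gen, map_mul] using key .comm
  · simpa only [Uq.gen, map_mul, map_one] using key .inv1
  · simpa only [Uq.gen, map_mul, map_one] using key .inv1'
  · simpa only [Uq.gen, map_mul, map_one] using key .inv2
  · simpa only [Uq.gen, map_mul, map_one] using key .inv2'
  · simpa only [Uq.gen, map_mul, map_smul] using key .K1E
  · simpa only [Uq.gen, map_mul, map_smul] using key .K2E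
  · simpa only [Uq.gen, map_mul, map_smul] using key .K1F
  · simpa only [Uq.gen, map_mul, map_smul] using key .K2F
  · simpa only [Uq.gen, map_mul, map_zero] using key .EE
  · simpa only [Uq.gen, map_mul, map_zero] using key .FF
  · simpa only [Uq.gen, map_mul, map_add, map_sub, map_smul] using key .EF

theorem UFamily.map {A A' : Type*} [Ring A] [Algebra Cq A] [Ring A'] [Algebra Cq A']
    {E F K1 K1inv K2 K2inv : A} (h : UFamily E F K1 K1inv K2 K2inv) (φ : A →ₐ[Cq] A') :
    UFamily (φ E) (φ F) (φ K1) (φ K1inv) (φ K2) (φ K2inv) := by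
  constructor
  · simpa only [map_mul] using congrArg φ h.comm
  · simpa only [map_mul, map_one] using congrArg φ h.inv1
  · simpa only [map_mul, map_one] using congrArg φ h.inv1'
  · simpa only [map_mul, map_one] using congrArg φ h.inv2
  · simpa only [map_mul, map_one] using congrArg φ h.inv2'
  · simpa only [map_mul, map_smul] using congrArg φ h.K1E
  · simpa only [map_mul, map_smul] using congrArg φ h.K2E
  · simpa only [map_mul, map_smul] using congrArg φ h.K1F
  · simpa only [map_mul, map_smul] using congrArg φ h.K2F
  · simpa only [map_mul, map_zero] using congrArg φ h.EE
  · simpa only [map_mul, map_zero] using congrArg φ h.FF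
  · simpa only [map_mul, map_add, map_sub, map_smul] using congrArg φ h.EF

namespace UFamily

variable {A : Type*} [Ring A] [Algebra Cq A] {E F K1 K1inv K2 K2inv : A}

theorem KE (h : UFamily E F K1 K1inv K2 K2inv) : K1 * K2 * E = E * (K1 * K2) := by
  rw [mul_assoc, h.K2E, mul_smul_comm, ← mul_assoc, h.K1E, smul_mul_assoc, smul_smul,
    inv_mul_cancel₀ qq_ne_zero, one_smul, mul_assoc]

theorem KF (h : UFamily E F K1 K1inv K2 K2inv) : K1 * K2 * F = F * (K1 * K2) := by
  rw [mul_assoc, h.K2F, mul_smul_comm, ← mul_assoc, h.K1F, smul_mul_assoc, smul_smul,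
    mul_inv_cancel₀ qq_ne_zero, one_smul, mul_assoc]

theorem Kinv_mul (h : UFamily E F K1 K1inv K2 K2inv) : K1inv * K2inv * (K1 * K2) = 1 := by
  rw [h.comm, mul_assoc, ← mul_assoc K2inv, h.inv2', one_mul, h.inv1']

theorem mul_Kinv (h : UFamily E F K1 K1inv K2 K2inv) : K1 * K2 * (K1inv * K2inv) = 1 := by
  rw [h.comm, mul_assoc, ← mul_assoc K1, h.inv1, one_mul, h.inv2]

theorem comm_Kinv (h : UFamily E F K1 K1inv K2 K2inv) {a : A} (ha : K1 * K2 * a = a * (K1 * K2)) :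
    K1inv * K2inv * a = a * (K1inv * K2inv) := by
  have aux : ∀ x y : A, y * x = 1 → x * y = 1 → x * a = a * x → y * a = a * y := by
    intro x y h1 h2 h3
    calc y * a = y * (a * (x * y)) := by rw [h2, mul_one]
      _ = y * (a * x) * y := by simp only [mul_assoc]
      _ = y * (x * a) * y := by rw [h3]
      _ = y * x * a * y := by simp only [mul_assoc]
      _ = a * y := by rw [h1, one_mul]
  exact aux _ _ h.Kinv_mul h.mul_Kinv ha

end UFamily

open TensorProduct in
/-- The images of the generators under the comultiplication
`Δ(E) = E ⊗ K⁻¹ + 1 ⊗ E`, `Δ(F) = F ⊗ 1 + K ⊗ F`, `Δ(K_i) = K_i ⊗ K_i`, acting on the tensor product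
of two super-modules: a sign appears whenever an odd element moves past an odd vector of the
first factor, so that `1 ⊗ E` and `K ⊗ F` act by `s ⊗ E` and `K s ⊗ F`, where `s` is the parity
operator of the first factor. -/
theorem UFamily.tensor {A A' : Type*} [Ring A] [Algebra Cq A] [Ring A'] [Algebra Cq A']
    {E F K1 K1inv K2 K2inv s : A} {E' F' K1' K1inv' K2' K2inv' : A'}
    (h : UFamily E F K1 K1inv K2 K2inv) (h' : UFamily E' F' K1' K1inv' K2' K2inv')
    (hs : s * s = 1) (sE : s * E = -(E * s)) (sF : s * F = -(F * s))
    (sK1 : s * K1 = K1 * s) (sK2 : s * K2 = K2 * s) :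
    UFamily (E ⊗ₜ[Cq] (K1inv' * K2inv') + s ⊗ₜ[Cq] E') (F ⊗ₜ[Cq] 1 + (K1 * K2 * s) ⊗ₜ[Cq] F')
      (K1 ⊗ₜ[Cq] K1') (K1inv ⊗ₜ[Cq] K1inv') (K2 ⊗ₜ[Cq] K2') (K2inv ⊗ₜ[Cq] K2inv') := by
  have c1 : K1' * (K1inv' * K2inv') = (K1inv' * K2inv') * K1' := by
    refine (h'.comm_Kinv ?_).symm
    rw [mul_assoc, ← h'.comm]
  have c2 : K2' * (K1inv' * K2inv') = (K1inv' * K2inv') * K2' := by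
    refine (h'.comm_Kinv ?_).symm
    rw [h'.comm, mul_assoc, h'.comm]
  have cE := h'.comm_Kinv h'.KE
  have cF := h'.comm_Kinv h'.KF
  constructor
  · simp only [Algebra.TensorProduct.tmul_mul_tmul, h.comm, h'.comm]
  · simp only [Algebra.TensorProduct.tmul_mul_tmul, h.inv1, h'.inv1]; rfl
  · simp only [Algebra.TensorProduct.tmul_mul_tmul, h.inv1', h'.inv1']; rfl
  · simp only [Algebra.TensorProduct.tmul_mul_tmul, h.inv2, h'.inv2]; rfl
  · simp only [Algebra.TensorProduct.tmul_mul_tmul, h.inv2', h'.inv2']; rfl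
  · simp only [mul_add, add_mul, Algebra.TensorProduct.tmul_mul_tmul, h.K1E, h'.K1E, sK1, c1,
      smul_add, TensorProduct.tmul_smul, TensorProduct.smul_tmul']
  · simp only [mul_add, add_mul, Algebra.TensorProduct.tmul_mul_tmul, h.K2E, h'.K2E, sK2, c2,
      smul_add, TensorProduct.tmul_smul, TensorProduct.smul_tmul']
  · have : K1 * (K1 * K2 * s) = K1 * K2 * s * K1 := by
      rw [mul_assoc (K1 * K2) s, sK1, ← mul_assoc (K1 * K2) K1, mul_assoc K1 K2 K1, ← h.comm,
        mul_assoc K1 (K1 * K2) s]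
    simp only [mul_add, add_mul, Algebra.TensorProduct.tmul_mul_tmul, h.K1F, h'.K1F, this,
      smul_add, TensorProduct.tmul_smul, TensorProduct.smul_tmul', mul_one, one_mul]
  · have : K2 * (K1 * K2 * s) = K1 * K2 * s * K2 := by
      rw [mul_assoc (K1 * K2), sK2, ← mul_assoc, ← mul_assoc, ← mul_assoc, ← h.comm]
    simp only [mul_add, add_mul, Algebra.TensorProduct.tmul_mul_tmul, h.K2F, h'.K2F, this,
      smul_add, TensorProduct.tmul_smul, TensorProduct.smul_tmul', mul_one, one_mul]
  · simp only [mul_add, add_mul, Algebra.TensorProduct.tmul_mul_tmul, h.EE, h'.EE, sE, cE,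
      TensorProduct.neg_tmul, TensorProduct.zero_tmul, TensorProduct.tmul_zero]
    abel
  · have e1 : F * (K1 * K2 * s) = K1 * K2 * (F * s) := by
      rw [← mul_assoc, ← h.KF, mul_assoc]
    have e2 : (K1 * K2 * s) * F = - (K1 * K2 * (F * s)) := by
      rw [mul_assoc, sF, mul_neg]
    simp only [mul_add, add_mul, Algebra.TensorProduct.tmul_mul_tmul, h.FF, h'.FF, e1, e2,
      TensorProduct.neg_tmul, TensorProduct.zero_tmul, TensorProduct.tmul_zero, mul_one, one_mul]
    abel
  · have e1 : E * (K1 * K2 * s) = K1 * K2 * (E * s) := by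
      rw [← mul_assoc, ← h.KE, mul_assoc]
    have e2 : (K1 * K2 * s) * E = - (K1 * K2 * (E * s)) := by
      rw [mul_assoc, sE, mul_neg]
    have e3 : s * (K1 * K2 * s) = K1 * K2 := by
      rw [← mul_assoc, ← mul_assoc, sK1, mul_assoc K1, sK2, mul_assoc, mul_assoc, hs, mul_one]
    have e4 : (K1 * K2 * s) * s = K1 * K2 := by rw [mul_assoc, hs, mul_one]
    have key : (E ⊗ₜ[Cq] (K1inv' * K2inv') + s ⊗ₜ[Cq] E') * (F ⊗ₜ[Cq] 1 + (K1 * K2 * s) ⊗ₜ[Cq] F') +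
        (F ⊗ₜ[Cq] 1 + (K1 * K2 * s) ⊗ₜ[Cq] F') * (E ⊗ₜ[Cq] (K1inv' * K2inv') + s ⊗ₜ[Cq] E') =
        (E * F + F * E) ⊗ₜ[Cq] (K1inv' * K2inv') + (K1 * K2) ⊗ₜ[Cq] (E' * F' + F' * E') := by
      simp only [mul_add, add_mul, Algebra.TensorProduct.tmul_mul_tmul, e1, e2, e3, e4, cF, sF,
        TensorProduct.neg_tmul, TensorProduct.add_tmul, TensorProduct.tmul_add, mul_one, one_mul]
      abel
    rw [key, h.EF, h'.EF]
    simp only [Algebra.TensorProduct.tmul_mul_tmul, TensorProduct.tmul_smul,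
      TensorProduct.smul_tmul', TensorProduct.sub_tmul, TensorProduct.tmul_sub, smul_sub]
    abel

/-! Super-modules over `U_q(gl(1|1))`. -/

/-- A super-module over `U_q(gl(1|1))`: a vector space with a `ℤ/2`-grading, given by its parity
operator (`1` on even and `-1` on odd vectors), and an action of `U_q(gl(1|1))` for which `E` and `F`
are odd and `K_1` and `K_2` are even. -/
structure SuperMod where
  carrier : Type
  [addCommGroup : AddCommGroup carrier]
  [module : Module Cq carrier]
  parity : Module.End Cq carrier
  act : Uq →ₐ[Cq] Module.End Cq carrier
  parity_mul_parity : parity * parity = 1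
  parity_E : parity * act (Uq.gen .E) = -(act (Uq.gen .E) * parity)
  parity_F : parity * act (Uq.gen .F) = -(act (Uq.gen .F) * parity)
  parity_K1 : parity * act (Uq.gen .K1) = act (Uq.gen .K1) * parity
  parity_K2 : parity * act (Uq.gen .K2) = act (Uq.gen .K2) * parity

attribute [instance] SuperMod.addCommGroup SuperMod.module

namespace SuperMod

open TensorProduct

variable (M N : SuperMod)

/-- `a ⊗ b`, as an endomorphism of `M ⊗ N`. -/
def endTensor : Module.End Cq M.carrier ⊗[Cq] Module.End Cq N.carrier →ₐ[Cq]
    Module.End Cq (M.carrier ⊗[Cq] N.carrier) := Module.endTensorEndAlgHom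

theorem commute_inv {A : Type*} [Ring A] {s x y : A} (h1 : y * x = 1) (h2 : x * y = 1)
    (h3 : s * x = x * s) : s * y = y * s := by
  calc s * y = (y * x) * (s * y) := by rw [h1, one_mul]
    _ = y * (x * s) * y := by simp only [mul_assoc]
    _ = y * (s * x) * y := by rw [h3]
    _ = y * s * (x * y) := by simp only [mul_assoc]
    _ = y * s := by rw [h2, mul_one]

theorem tensor_family : UFamily
    (endTensor M N (M.act (Uq.gen .E) ⊗ₜ[Cq] (N.act (Uq.gen .K1inv) * N.act (Uq.gen .K2inv)) +
      M.parity ⊗ₜ[Cq] N.act (Uq.gen .E)))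
    (endTensor M N (M.act (Uq.gen .F) ⊗ₜ[Cq] 1 +
      (M.act (Uq.gen .K1) * M.act (Uq.gen .K2) * M.parity) ⊗ₜ[Cq] N.act (Uq.gen .F)))
    (endTensor M N (M.act (Uq.gen .K1) ⊗ₜ[Cq] N.act (Uq.gen .K1)))
    (endTensor M N (M.act (Uq.gen .K1inv) ⊗ₜ[Cq] N.act (Uq.gen .K1inv)))
    (endTensor M N (M.act (Uq.gen .K2) ⊗ₜ[Cq] N.act (Uq.gen .K2)))
    (endTensor M N (M.act (Uq.gen .K2inv) ⊗ₜ[Cq] N.act (Uq.gen .K2inv))) :=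
  ((Uq.family.map M.act).tensor (Uq.family.map N.act) M.parity_mul_parity
    M.parity_E M.parity_F M.parity_K1 M.parity_K2).map (endTensor M N)

/-- The tensor product of two super-modules, on which `U_q(gl(1|1))` acts through the
comultiplication `Δ(E) = E ⊗ K⁻¹ + 1 ⊗ E`, `Δ(F) = F ⊗ 1 + K ⊗ F`, `Δ(K_i) = K_i ⊗ K_i`, with the
usual sign rule. -/
def tensor : SuperMod where
  carrier := M.carrier ⊗[Cq] N.carrier
  parity := endTensor M N (M.parity ⊗ₜ N.parity)
  act := (tensor_family M N).lift
  parity_mul_parity := by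
    rw [← map_mul, Algebra.TensorProduct.tmul_mul_tmul, M.parity_mul_parity, N.parity_mul_parity]
    exact (endTensor M N).map_one
  parity_E := by
    rw [UFamily.lift_gen]
    simp only [UGen.pick]
    have h1 := commute_inv (by rw [← map_mul, Uq.family.inv1', map_one])
      (by rw [← map_mul, Uq.family.inv1, map_one]) N.parity_K1
    have h2 := commute_inv (by rw [← map_mul, Uq.family.inv2', map_one])
      (by rw [← map_mul, Uq.family.inv2, map_one]) N.parity_K2
    have h3 : N.parity * (N.act (Uq.gen .K1inv) * N.act (Uq.gen .K2inv)) =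
        N.act (Uq.gen .K1inv) * N.act (Uq.gen .K2inv) * N.parity := by
      rw [← mul_assoc, h1, mul_assoc, h2, mul_assoc]
    rw [← map_mul (endTensor M N), ← map_mul (endTensor M N), ← map_neg (endTensor M N)]
    simp only [mul_add, add_mul, Algebra.TensorProduct.tmul_mul_tmul, M.parity_E, N.parity_E, h3,
      TensorProduct.neg_tmul, TensorProduct.tmul_neg, neg_add]
  parity_F := by
    rw [UFamily.lift_gen]
    simp only [UGen.pick]
    have h3 : M.parity * (M.act (Uq.gen .K1) * M.act (Uq.gen .K2) * M.parity) =
        M.act (Uq.gen .K1) * M.act (Uq.gen .K2) * M.parity * M.parity := by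
      rw [← mul_assoc, ← mul_assoc, M.parity_K1, mul_assoc (M.act (Uq.gen .K1)), M.parity_K2]
      simp only [mul_assoc]
    rw [← map_mul (endTensor M N), ← map_mul (endTensor M N), ← map_neg (endTensor M N)]
    simp only [mul_add, add_mul, Algebra.TensorProduct.tmul_mul_tmul, M.parity_F, N.parity_F, h3,
      TensorProduct.neg_tmul, TensorProduct.tmul_neg, neg_add, mul_one, one_mul]
  parity_K1 := by
    rw [UFamily.lift_gen]
    simp only [UGen.pick]
    rw [← map_mul, ← map_mul, Algebra.TensorProduct.tmul_mul_tmul,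
      Algebra.TensorProduct.tmul_mul_tmul, M.parity_K1, N.parity_K1]
  parity_K2 := by
    rw [UFamily.lift_gen]
    simp only [UGen.pick]
    rw [← map_mul, ← map_mul, Algebra.TensorProduct.tmul_mul_tmul,
      Algebra.TensorProduct.tmul_mul_tmul, M.parity_K2, N.parity_K2]

theorem tensor_act_E : (M.tensor N).act (Uq.gen .E) =
    endTensor M N (M.act (Uq.gen .E) ⊗ₜ[Cq] (N.act (Uq.gen .K1inv) * N.act (Uq.gen .K2inv)) +
      M.parity ⊗ₜ[Cq] N.act (Uq.gen .E)) := (tensor_family M N).lift_gen _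

theorem tensor_act_F : (M.tensor N).act (Uq.gen .F) =
    endTensor M N (M.act (Uq.gen .F) ⊗ₜ[Cq] 1 +
      (M.act (Uq.gen .K1) * M.act (Uq.gen .K2) * M.parity) ⊗ₜ[Cq] N.act (Uq.gen .F)) :=
  (tensor_family M N).lift_gen _

theorem tensor_act_K1 : (M.tensor N).act (Uq.gen .K1) =
    endTensor M N (M.act (Uq.gen .K1) ⊗ₜ[Cq] N.act (Uq.gen .K1)) := (tensor_family M N).lift_gen _

theorem tensor_act_K2 : (M.tensor N).act (Uq.gen .K2) =
    endTensor M N (M.act (Uq.gen .K2) ⊗ₜ[Cq] N.act (Uq.gen .K2)) := (tensor_family M N).lift_gen _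

theorem triv_family : UFamily (0 : Module.End Cq Cq) 0 1 1 1 1 := by
  constructor <;> simp

/-- The trivial module, on which `U_q(gl(1|1))` acts through the counit. -/
def triv : SuperMod where
  carrier := Cq
  parity := 1
  act := triv_family.lift
  parity_mul_parity := one_mul 1
  parity_E := by simp [UFamily.lift_gen, UGen.pick]
  parity_F := by simp [UFamily.lift_gen, UGen.pick]
  parity_K1 := rfl
  parity_K2 := rfl

theorem vec_family : UFamily (A := Module.End Cq (Fin 2 → Cq)) (Matrix.toLin' !![0, 1; 0, 0])
    (Matrix.toLin' !![0, 0; 1, 0]) (Matrix.toLin' !![qq, 0; 0, 1])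
    (Matrix.toLin' !![qq⁻¹, 0; 0, 1]) (Matrix.toLin' !![1, 0; 0, qq])
    (Matrix.toLin' !![1, 0; 0, qq⁻¹]) := by
  have h : UFamily (A := Matrix (Fin 2) (Fin 2) Cq) !![0, 1; 0, 0] !![0, 0; 1, 0]
      !![qq, 0; 0, 1] !![qq⁻¹, 0; 0, 1] !![1, 0; 0, qq] !![1, 0; 0, qq⁻¹] := by
    have h1 := qq_ne_zero
    have h2 := inv_mul_cancel₀ qq_sub_ne_zero
    constructor <;> ext i j <;> fin_cases i <;> fin_cases j <;>
      simp [Matrix.mul_apply, Fin.sum_univ_two, h1, h2]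
  exact h.map (Matrix.toLinAlgEquiv' : Matrix (Fin 2) (Fin 2) Cq ≃ₐ[Cq] _).toAlgHom

/-- The vector representation `V`, with basis `v_0` (even) and `v_1` (odd): `E v_1 = v_0`,
`F v_0 = v_1`, `E v_0 = F v_1 = 0`; the weight of `v_0` is `ε_1` and the weight of `v_1` is `ε_2`. -/
def vec : SuperMod where
  carrier := Fin 2 → Cq
  parity := Matrix.toLin' !![1, 0; 0, -1]
  act := vec_family.lift
  parity_mul_parity := by
    rw [Module.End.mul_eq_comp, ← Matrix.toLin'_mul, Module.End.one_eq_id, ← Matrix.toLin'_one]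
    congr 1
    ext i j
    fin_cases i <;> fin_cases j <;> simp
  parity_E := by
    simp only [UFamily.lift_gen, UGen.pick, Module.End.mul_eq_comp, ← Matrix.toLin'_mul, ← map_neg]
    simp
  parity_F := by
    simp only [UFamily.lift_gen, UGen.pick, Module.End.mul_eq_comp, ← Matrix.toLin'_mul, ← map_neg]
    simp
  parity_K1 := by
    simp only [UFamily.lift_gen, UGen.pick, Module.End.mul_eq_comp, ← Matrix.toLin'_mul]
    simp
  parity_K2 := by
    simp only [UFamily.lift_gen, UGen.pick, Module.End.mul_eq_comp, ← Matrix.toLin'_mul]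
    simp

/-- The tensor power `V^{⊗ n}`. -/
def tpow : ℕ → SuperMod
  | 0 => triv
  | n + 1 => (tpow n).tensor vec

/-- The standard basis vector of `V^{⊗ n}` with `v_0` in the position `i + 1`, for `i ∈ y`, and with
`v_1` in the other positions. -/
def std (y : Finset ℕ) : (n : ℕ) → (tpow n).carrier
  | 0 => (1 : Cq)
  | n + 1 => (std y n ⊗ₜ[Cq] (if n ∈ y then Pi.single 0 1 else Pi.single 1 1 : Fin 2 → Cq) :
      (tpow n).carrier ⊗[Cq] (Fin 2 → Cq))

/-- The weight space `(V^{⊗ n})_k`, of weight `k ε_1 + (n - k) ε_2`: the space of the vectors on which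
`K_1` acts as `q^k` and `K_2` acts as `q^{n-k}`. -/
def weightSpace (n k : ℕ) : Submodule Cq (tpow n).carrier :=
  LinearMap.ker ((tpow n).act (Uq.gen .K1) - algebraMap Cq _ (qq ^ k)) ⊓
    LinearMap.ker ((tpow n).act (Uq.gen .K2) - algebraMap Cq _ (qq ^ ((n : ℤ) - k)))

theorem mem_weightSpace {n k : ℕ} {v : (tpow n).carrier} : v ∈ weightSpace n k ↔
    (tpow n).act (Uq.gen .K1) v = qq ^ k • v ∧
      (tpow n).act (Uq.gen .K2) v = qq ^ ((n : ℤ) - k) • v := by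
  rw [weightSpace, Submodule.mem_inf, LinearMap.mem_ker, LinearMap.mem_ker, LinearMap.sub_apply,
    LinearMap.sub_apply, sub_eq_zero, sub_eq_zero]
  rfl

/-- The set of indices of the term of the expansion of `ℓ_{x_k + 1} ∧ ⋯ ∧ ℓ_{x_1 + 1}`, where
`x = {x_1 < ⋯ < x_k}`, in which `q e_i` is chosen from the factor `ℓ_{i+1} = e_{i+1} + q e_i` for
`i ∈ T`, and `e_{i+1}` is chosen for the other `i ∈ x` (the index `i + 1` of `e` is written as
`i`). -/
def shiftDown (x T : Finset ℕ) : Finset ℕ := (x \ T) ∪ T.image (fun i => i - 1)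

/-- The canonical basis vector of `V^{⊗ n}` attached to `x = {x_1 < ⋯ < x_k} ⊆ {0, …, n-1}`, the wedge
product `ℓ_{x_k + 1} ∧ ⋯ ∧ ℓ_{x_1 + 1}`, where `ℓ_1 = e_1` and `ℓ_i = e_i + q e_{i-1}` for `i ≥ 2`,
and `e_{i_k} ∧ ⋯ ∧ e_{i_1}`, for `i_k > ⋯ > i_1`, is the standard basis vector with `v_0` in the
positions `i_1, …, i_k` and `v_1` elsewhere. In each term of the expansion the indices weakly
decrease, and the term is zero when two of them are equal. -/
def canon (n : ℕ) (x : Finset ℕ) : (tpow n).carrier :=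
  ∑ T ∈ (x.erase 0).powerset,
    if (shiftDown x T).card = x.card then qq ^ T.card • std (shiftDown x T) n else 0

end SuperMod

open SuperMod TensorProduct LaurentPolynomial

/-- The inclusion of `ℤ[q, q⁻¹]` in `ℂ(q)`. -/
instance laurentAlgebra : Algebra ℤ[T;T⁻¹] Cq :=
  (LaurentPolynomial.eval₂ (Int.castRingHom Cq) (Units.mk0 qq qq_ne_zero)).toAlgebra

theorem algebraMap_T (i : ℤ) : algebraMap ℤ[T;T⁻¹] Cq (T i) = qq ^ i := by
  change LaurentPolynomial.eval₂ _ _ (T i) = _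
  simp

variable [NeZero n]

variable (R n k) in
/-- The Grothendieck group of `B_l(n,k)-proj` with scalars extended to `ℂ(q)`. -/
abbrev OSzK0C : Type (u + 1) := Cq ⊗[ℤ[T;T⁻¹]] OSzK0 R n k

variable (R n k) in
/-- The map induced by the functor `F_k` on the Grothendieck groups over `ℂ(q)`. -/
def K0FC : OSzK0C R n (k + 1) →ₗ[Cq] OSzK0C R n k := (K0F R n k).baseChange Cq

/-- An isomorphism of graded modules, of degree `0`. -/
def GrIso {A : Type u} [Ring A] {grA : ℤ → AddSubgroup A} (M N : GrProj A grA) : Prop :=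
  ∃ e : M.carrier ≃ₗ[A] N.carrier, ∀ d, ∀ m ∈ M.gr d, e m ∈ N.gr d

/-- The family of maps `Φ_k : K_0(B_l(n,k)) ⊗ ℂ(q) ≃ (V^{⊗ n})_k` sends `[P(x)]` to the canonical basis
vector attached to `x`. -/
def IsCanonicalIdent (Φ : (k : ℕ) → OSzK0C R n k ≃ₗ[Cq] weightSpace n k) : Prop :=
  ∀ (k : ℕ) (x : LState n k), (Φ k (1 ⊗ₜ[ℤ[T;T⁻¹]] K0.cls (projP x)) : (tpow n).carrier) =
    canon n x.1.1

end

end OSz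

/-! ### The bimodule `F_k`: vanishing of the square and values on the modules `P(x)` -/

namespace OSz

noncomputable section

universe u

variable {R : Type u} [CommRing R] {n k : ℕ}

open BZero OSzAlg

/-! The right action on `F_k` goes through `ψ`, which kills every `f_{x,y}` unless `0` lies in both
`x` and `y`. In particular `ψ` kills `e^∨`, the sum of the idempotents with `0 ∉ x`, hence all of
`F_{k+1}`, whose elements satisfy `r = r e^∨`. So `p ⊗ r e^∨ = p ψ(r) ⊗ e^∨ = 0`, and the same
computation inside an iterated tensor product shows that the functor squares to zero
(`bt_coe_smul_eq_zero`). Since `P(x)` is generated by `I_x`, tensoring it with `F_k` gives `F_k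
ψ(I_x)`, which is `P(x \ {0})` if `0 ∈ x` and zero otherwise (`grIso_tensorF_projP`,
`subsingleton_tensorF_projP`).

Over a field the algebra is graded in degrees `≥ 0`, and its degree-`0` part is a product of copies
of the field, one for each `I_x`; the projections to them extend to augmentations `aug x` of the
whole algebra. This gives a graded Nakayama argument: the lowest degree of a nonzero finitely
generated projective module is detected by some `aug x`, which produces a homogeneous surjection
onto a shift of `P(x)` (`GrProj.exists_surjective_projP`). The surjection splits
(`GrProj.exists_ker`), and the kernel has smaller rank, so the classes `[P(x)]` span `K_0` over
`ℤ[q, q⁻¹]`. Counting the forms that factor through `aug x`, degree by degree, gives functionals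
dual to the `[P(x)]` (`GrProj.mult`), so these classes form a basis.

On the quantum group side the canonical vectors obey a recursion in the number of tensor factors,
obtained by expanding the top factor `ℓ_{n+1} = e_{n+1} + q e_n` (`canon_succ`,
`canon_succ_insert`). The operator `e_n ∧ -` fails to commute with `F` by exactly the term that the
comultiplication creates (`act_F_raiseTop`). The two cancel, except at the first tensor factor,
where `F v_0 = v_1`. Hence `F` sends the canonical vector of `x` to that of `x \ {0}`, or to zero if
`0 ∉ x` (`act_F_canon`). The canonical vectors form a basis of each weight space, indexed by the
same `x` as the `[P(x)]`. Matching the two bases gives the unique identification, and the two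
descriptions of removing `0` agree. -/

theorem LState.zero_notMem_removeZero (x : LState n (k + 1)) (h : 0 ∈ x.1.1) :
    0 ∉ (x.removeZero h).1.1 := by
  simp [LState.removeZero, BZero.removeZero]

namespace OSzAlg

/-- The idempotents that make up `e^∨` are exactly the ones that `ψ` kills. The vanishing of the
square rests on this. -/
theorem psi_eVee : psi R n k (eVee R n (k + 1)) = 0 := by
  rw [eVee, map_sum]
  exact Finset.sum_eq_zero fun x hx => psi_gen_zero _ _ (Or.inl (Finset.mem_filter.1 hx).2) _

theorem psi_coe_FBim (r : FBim R n (k + 1)) : psi R n k r.1 = 0 := by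
  rw [← FBim.mul_eVee, map_mul, psi_eVee, mul_zero]

theorem psi_idem (x : LState n (k + 1)) (h : 0 ∈ x.1.1) :
    psi R n k (idem x) = idem (x.removeZero h) :=
  psi_gen x x h h 1

theorem psi_idem_zero (x : LState n (k + 1)) (h : 0 ∉ x.1.1) : psi R n k (idem x) = 0 :=
  psi_gen_zero x x (Or.inl h) 1

theorem idem_mul_eVee (x : LState n k) (h : 0 ∉ x.1.1) :
    idem x * eVee R n k = idem x :=
  gen_mul_eVee x x h 1

end OSzAlg

/-- The generator `e^∨` of `F_k`. -/
def FBim.vee : FBim R n k := ⟨eVee R n k, Ideal.mem_span_singleton_self _⟩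

theorem FBim.smul_vee (r : FBim R n k) : r.1 • (FBim.vee : FBim R n k) = r :=
  Subtype.ext (FBim.mul_eVee r)

/-- The generator `I_x` of `P(x)`. -/
def idemP (x : LState n k) : Ideal.span {(idem x : OSzAlg R n k)} :=
  ⟨idem x, Ideal.mem_span_singleton_self _⟩

theorem coe_mul_idem (x : LState n k) (r : Ideal.span {(idem x : OSzAlg R n k)}) :
    r.1 * idem x = r.1 :=
  congrArg Subtype.val (mulRightIdem_coe _ (idem_mul_idem x) r)

theorem smul_idemP (x : LState n k) (r : Ideal.span {(idem x : OSzAlg R n k)}) :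
    r.1 • idemP x = r :=
  Subtype.ext (coe_mul_idem x r)

section

variable [NeZero n]

theorem FBim.op_smul_coe (p : FBim R n k) (r : FBim R n (k + 1)) :
    MulOpposite.op r.1 • p = 0 :=
  Subtype.ext (by rw [FBim.coe_op_smul, psi_coe_FBim, mul_zero]; rfl)

/-- Moving `r` across the tensor sign turns it into right multiplication by `ψ(r)`, and `ψ(r) = ψ(r)
ψ(e^∨) = 0`. The module `M` is arbitrary so that it can be `F_{k+1}` itself or a tensor product of
`F_{k+1}` with another module. -/
theorem bt_coe_smul_eq_zero {M : Type*} [AddCommGroup M] [Module (OSzAlg R n (k + 1)) M]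
    (p : FBim R n k) (r : FBim R n (k + 1)) (m : M) :
    (bt (OSzAlg R n (k + 1)) p (r.1 • m) :
      BTensor (OSzAlg R n (k + 1)) (OSzAlg R n k) (FBim R n k) M) = 0 := by
  rw [← bt_smul, FBim.op_smul_coe, ← btHom_apply, map_zero, AddMonoidHom.zero_apply]

theorem subsingleton_of_bt {A B F M : Type*} [Ring A] [Ring B] [AddCommGroup F] [AddCommGroup M]
    [Module B F] [Module Aᵐᵒᵖ F] [SMulCommClass B Aᵐᵒᵖ F] [Module A M]
    (h : ∀ f m, (bt A f m : BTensor A B F M) = 0) : Subsingleton (BTensor A B F M) :=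
  subsingleton_of_forall_eq 0 fun t => bt_induction A (K := ⊥) h t

variable (R n k) in
theorem subsingleton_FBim_tensor_FBim :
    Subsingleton (BTensor (OSzAlg R n (k + 1)) (OSzAlg R n k) (FBim R n k) (FBim R n (k + 1))) :=
  subsingleton_of_bt fun p r => by rw [← FBim.smul_vee r, bt_coe_smul_eq_zero]

theorem subsingleton_tensorF_tensorF (M : OSzProj R n (k + 2)) :
    Subsingleton (tensorF (tensorF M)).carrier := by
  refine subsingleton_of_bt (A := OSzAlg R n (k + 1)) (B := OSzAlg R n k) (F := FBim R n k)
    (M := BTensor (OSzAlg R n (k + 2)) (OSzAlg R n (k + 1)) (FBim R n (k + 1)) M.carrier)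
    fun p t => ?_
  refine bt_induction (OSzAlg R n (k + 2)) (K := (btHom (OSzAlg R n (k + 1)) (OSzAlg R n k) p).ker)
    (fun r m => ?_) t
  -- Here `r ⊗ m = r (e^∨ ⊗ m)`, so the coefficient `r` can be moved to the outer tensor sign, where
  -- it acts on `p` by zero.
  rw [AddMonoidHom.mem_ker, btHom_apply, ← FBim.smul_vee r, ← smul_bt, bt_coe_smul_eq_zero]

/-- The transfer argument again, with the generator `I_x` of `P(x)` in the role of `e^∨`: here `ψ(r)
= ψ(r) ψ(I_x) = 0`. -/
theorem subsingleton_tensorF_projP (x : LState n (k + 1)) (h : 0 ∉ x.1.1) :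
    Subsingleton (tensorF (projP (R := R) x)).carrier := by
  refine subsingleton_of_bt (A := OSzAlg R n (k + 1)) (B := OSzAlg R n k) (F := FBim R n k)
    (M := Ideal.span {(idem x : OSzAlg R n (k + 1))}) fun p r => ?_
  rw [← smul_idemP x r, ← bt_smul,
    show MulOpposite.op r.1 • p = 0 from Subtype.ext ?_, ← btHom_apply, map_zero,
    AddMonoidHom.zero_apply]
  rw [FBim.coe_op_smul, ← coe_mul_idem, map_mul, psi_idem_zero x h, mul_zero, mul_zero]
  rfl

/-- The maps `p ⊗ r ↦ p ψ(r)` and `a ↦ a ⊗ I_x` are mutually inverse. One composite is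
multiplication by `ψ(I_x) = I_{x \ 0}`, the identity on `P(x \ {0})`; the other sends `p ⊗ r` to `p
ψ(r) ⊗ I_x = p ⊗ r I_x`. Degrees are preserved because `ψ` preserves them. -/
theorem grIso_tensorF_projP (x : LState n (k + 1)) (h : 0 ∈ x.1.1) :
    GrIso (tensorF (projP (R := R) x)) (projP (x.removeZero h)) := by
  -- Since `r = r I_x`, its image is `ψ(r) I_{x \ 0}`, so products `p ψ(r)` land in `P(x \ {0})`.
  have hp : ∀ r : Ideal.span {(idem x : OSzAlg R n (k + 1))},
      psi R n k r.1 ∈ Ideal.span {(idem (x.removeZero h) : OSzAlg R n k)} := fun r =>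
    Ideal.mem_span_singleton'.2 ⟨psi R n k r.1, by
      rw [← psi_idem x h, ← map_mul, coe_mul_idem]⟩
  obtain ⟨α, hα⟩ := exists_btLiftLinear (B := OSzAlg R n k) (F := FBim R n k)
    (M := Ideal.span {(idem x : OSzAlg R n (k + 1))})
    (N := Ideal.span {(idem (x.removeZero h) : OSzAlg R n k)}) (OSzAlg R n (k + 1))
    (AddMonoidHom.mk' (fun p => AddMonoidHom.mk'
        (fun r => ⟨p.1 * psi R n k r.1, Ideal.mul_mem_left _ _ (hp r)⟩)
        (fun r s => Subtype.ext (by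
          change _ * psi R n k (r.1 + s.1) = _ * _ + _ * _
          rw [map_add, mul_add])))
      (fun p p' => by ext r; exact add_mul p.1 p'.1 _))
    (fun p a r => Subtype.ext (by
      change p.1 * psi R n k a * psi R n k r.1 = p.1 * psi R n k (a * r.1)
      rw [map_mul, mul_assoc]))
    (fun b p r => Subtype.ext (mul_assoc b p.1 _))
  -- As `x \ {0}` does not contain `0`, its idempotent is absorbed by `e^∨`; thus `P(x \ {0})` sits
  -- inside `F_k` and its elements may serve as left tensor factors.
  have hmem : ∀ a : Ideal.span {(idem (x.removeZero h) : OSzAlg R n k)},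
      a.1 ∈ Ideal.span {eVee R n k} := fun a => Ideal.mem_span_singleton'.2 ⟨a.1, by
    rw [← coe_mul_idem, mul_assoc, idem_mul_eVee _ (x.zero_notMem_removeZero h)]⟩
  let ι : Ideal.span {(idem (x.removeZero h) : OSzAlg R n k)} →+ FBim R n k :=
    AddMonoidHom.mk' (fun a => ⟨a.1, hmem a⟩) fun _ _ => rfl
  let β : Ideal.span {(idem (x.removeZero h) : OSzAlg R n k)} →ₗ[OSzAlg R n k]
      BTensor (OSzAlg R n (k + 1)) (OSzAlg R n k) (FBim R n k)
        (Ideal.span {(idem x : OSzAlg R n (k + 1))}) :=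
    { ((btHom (OSzAlg R n (k + 1)) (OSzAlg R n k)).flip (idemP x)).comp ι with
      map_smul' := fun b a => (smul_bt _ b (ι a) (idemP x)).symm }
  have hαβ : α ∘ₗ β = LinearMap.id := by
    refine LinearMap.ext fun a => Subtype.ext ?_
    have h1 : α (bt _ ⟨a.1, hmem a⟩ (idemP x)) = _ := hα _ _
    refine (congrArg Subtype.val h1).trans ?_
    change a.1 * psi R n k (idem x) = a.1
    rw [psi_idem x h, coe_mul_idem]
  have hβα : β ∘ₗ α = LinearMap.id := by
    refine bt_linear_ext _ fun p r => ?_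
    rw [LinearMap.comp_apply, hα, LinearMap.id_apply]
    conv_rhs => rw [← smul_idemP x r, ← bt_smul]
    rfl
  have hgr : ∀ d, ∀ t ∈ btGr (OSzAlg R n (k + 1)) (OSzAlg R n k)
      (idealGr (OSzAlg.gr R n k) (Ideal.span {eVee R n k}))
      (idealGr (OSzAlg.gr R n (k + 1)) (Ideal.span {(idem x : OSzAlg R n (k + 1))})) d,
      α t ∈ idealGr (OSzAlg.gr R n k) _ d := by
    intro d
    refine map_btGr _ α.toAddMonoidHom _ ?_
    rintro i j p r rfl hp hr
    change α _ ∈ _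
    rw [hα]
    exact mul_mem_gr (R := R) hp (psi_mem_gr (R := R) hr)
  exact ⟨LinearEquiv.ofLinearMap α β hαβ hβα, hgr⟩

end

end

end OSz

/-! ### The degree-zero part of the algebra and the augmentations -/

namespace OSz

noncomputable section

universe u

variable {R : Type u} [CommRing R] {n k : ℕ}

open BZero OSzAlg

/-- The counting function `v^x` drops from `i` to `i + 1` by the number of elements of `x` equal to
`i + 1`. So `v^x` determines all positive elements of `x`. -/
theorem IState.mem_iff_vvec (x : IState n k) (i : ℕ) :
    i + 1 ∈ x.1 ↔ vvec x i ≠ vvec x (i + 1) := by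
  have h : x.1.filter (fun a => i + 1 < a) = (x.1.filter (fun a => i < a)).erase (i + 1) := by
    ext a
    simp only [Finset.mem_filter, Finset.mem_erase]
    grind
  unfold vvec
  by_cases hi : i + 1 ∈ x.1
  · have h1 : i + 1 ∈ x.1.filter (fun a => i < a) := by simp [hi]
    have h2 := Finset.card_erase_add_one h1
    rw [h]
    exact iff_of_true hi (by omega)
  · rw [h, Finset.erase_eq_of_notMem (by simp [hi])]
    simp [hi]

/-- The element `0` is never counted by `v^x`; its presence is read off from the total number of
elements `k`. -/
theorem IState.zero_mem_iff_vvec (x : IState n k) : 0 ∈ x.1 ↔ vvec x 0 ≠ k := by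
  have hk := (Finset.mem_powersetCard.1 x.2).2
  have h : x.1.filter (fun a => 0 < a) = x.1.erase 0 := by
    ext a
    simp only [Finset.mem_filter, Finset.mem_erase]
    grind
  unfold vvec
  rw [h]
  by_cases h0 : 0 ∈ x.1
  · have h2 := Finset.card_erase_add_one h0
    exact iff_of_true h0 (by omega)
  · rw [Finset.erase_eq_of_notMem h0, hk]
    simp [h0]

/-- A sum of absolute values vanishes only if `v^x = v^y` (both are zero from index `n` on), and an
I-state is recovered from its counting function. Consequently only diagonal elements live in degree
`0`. -/
theorem fdeg_eq_zero {x y : IState n k} : fdeg x y = 0 ↔ x = y := by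
  constructor
  · intro h
    have h1 : ∀ i, vvec x i = vvec y i := by
      have hz : ∀ (x : IState n k) i, n ≤ i → vvec x i = 0 := by
        intro x i hi
        refine Finset.card_eq_zero.2 (Finset.filter_eq_empty_iff.2 fun {a} ha => ?_)
        have := Finset.mem_range.1 ((Finset.mem_powersetCard.1 x.2).1 ha)
        omega
      intro i
      rcases lt_or_ge i n with hi | hi
      · have := (Finset.sum_eq_zero_iff.1 h) ⟨i, hi⟩ (Finset.mem_univ _)
        simp only [vdist] at this
        omega
      · rw [hz x i hi, hz y i hi]
    refine Subtype.ext (Finset.ext fun a => ?_)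
    cases a with
    | zero => rw [x.zero_mem_iff_vvec, y.zero_mem_iff_vvec, h1]
    | succ a => rw [x.mem_iff_vvec, y.mem_iff_vvec, h1, h1]
  · rintro rfl
    simp [fdeg, vdist]

/-- By `degree_gvec`, the total degree of the exponent of a loop from `x` through `y` is half of
`deg f_{x,y} + deg f_{y,x}`, so a nontrivial loop always picks up some `U_i`. -/
theorem gvec_eq_zero {x y : IState n k} : gvec x y x = 0 ↔ x = y := by
  constructor
  · intro h
    have h1 := degree_gvec x y x
    have h2 : fdeg x x = 0 := fdeg_eq_zero.2 rfl
    rw [h, map_zero, h2] at h1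
    exact fdeg_eq_zero.1 (by omega)
  · rintro rfl
    exact gvec_left x x

namespace BZero

/-- The constant coefficient of the entry at `(x, x)`. It is multiplicative, since a path from `x`
to `x` through another I-state is divisible by some `U_i`. -/
def augZero (x : IState n k) : BZero R n k →+* R where
  toFun a := MvPolynomial.constantCoeff (a.coeff x x)
  map_zero' := by simp
  map_one' := by simp [coeff_one]
  map_add' a b := by simp
  map_mul' a b := by
    rw [coeff_mul, map_sum, Finset.sum_eq_single x]
    · rw [gvec_left]; simp
    · intro y _ hy
      have : gvec x y x ≠ 0 := fun h => hy (gvec_eq_zero.1 h).symm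
      rw [map_mul, MvPolynomial.constantCoeff_monomial, if_neg this, zero_mul]
    · simp

theorem augZero_f (w x y : IState n k) (p : MvPolynomial (Fin n) R) :
    augZero w (p • f x y) = if w = x ∧ w = y then MvPolynomial.constantCoeff p else 0 := by
  change MvPolynomial.constantCoeff _ = _
  rw [coeff_smul, coeff_f]
  split_ifs <;> simp

theorem augZero_smul (w : IState n k) (p : MvPolynomial (Fin n) R) (a : BZero R n k) :
    augZero w (p • a) = MvPolynomial.constantCoeff p * augZero w a := by
  change MvPolynomial.constantCoeff _ = _ * MvPolynomial.constantCoeff _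
  rw [coeff_smul, map_mul]

theorem augZero_f_of_ne (w : IState n k) {x y : IState n k} (h : x ≠ y) :
    augZero w (f x y : BZero R n k) = 0 := by
  have := augZero_f (R := R) w x y 1
  rw [one_smul, if_neg] at this
  · exact this
  · rintro ⟨rfl, h'⟩
    exact h h'

theorem StepR.ne {i : ℕ} {x y : IState n k} (h : StepR i x y) : x ≠ y := by
  rintro rfl
  exact h.2.1 (h.2.2 ▸ Finset.mem_insert_self _ _)

theorem StepL.ne {i : ℕ} {x y : IState n k} (h : StepL i x y) : x ≠ y := by
  rintro rfl
  exact h.2.1 (h.2.2 ▸ Finset.mem_insert_self _ _)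

/-- A step moves an element, so both quadratic relations have an off-diagonal factor, on which the
augmentation vanishes. The remaining relation is a multiple of a variable `U_i`. -/
theorem ElRel.augZero_eq (w : IState n k) {x z : IState n k} {e : BZero R n k} (h : ElRel x z e) :
    augZero w e = 0 := by
  cases h with
  | RR i j h x y z h1 h2 => rw [map_mul, augZero_f_of_ne w h1.ne, zero_mul]
  | LL i j h x y z h1 h2 => rw [map_mul, augZero_f_of_ne w h1.ne, zero_mul]
  | U i x h h' => rw [augZero_smul, MvPolynomial.constantCoeff_X, zero_mul]

theorem augZero_relIdeal (w : IState n k) (a : BZero R n k) (ha : a ∈ relIdeal R n k) :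
    augZero w a = 0 := by
  refine relIdeal_le (K := (augZero w : BZero R n k →+* R).toAddMonoidHom.ker) ?_ a ha
  intro x z a b e p he
  change augZero w _ = 0
  rw [augZero_smul, map_mul, map_mul, he.augZero_eq, mul_zero, zero_mul, mul_zero]

/-- The constant coefficient at `(x, x)`, on `B(n,k)`. -/
def augFull (x : IState n k) : BFull R n k →+* R :=
  Ideal.Quotient.lift (relIdeal R n k) (augZero x) (augZero_relIdeal x)

theorem augFull_toB (x : IState n k) (a : BZero R n k) : augFull x (toB a) = augZero x a :=
  rfl

end BZero

namespace OSzAlg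

/-- The augmentation of `B_l(n,k)` at `x`: the constant coefficient at `(x, x)`. -/
def aug (x : LState n k) : OSzAlg R n k →+* R where
  toFun b := augFull x.1 (val R n k b)
  map_zero' := by rw [map_zero, map_zero]
  map_one' := by
    rw [val_one, eLeft, map_sum, Finset.sum_eq_single x]
    · rw [augFull_toB, ← one_smul (MvPolynomial (Fin n) R) (f x.1 x.1), augZero_f]
      simp
    · intro y _ hy
      rw [augFull_toB, ← one_smul (MvPolynomial (Fin n) R) (f y.1 y.1), augZero_f, if_neg]
      exact fun h => hy (Subtype.ext h.1.symm)
    · simp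
  map_add' a b := by rw [map_add, map_add]
  map_mul' a b := by rw [map_mul, map_mul]

theorem aug_gen (w x y : LState n k) (p : MvPolynomial (Fin n) R) :
    aug w (gen x y p) = if w = x ∧ w = y then MvPolynomial.constantCoeff p else 0 := by
  change augFull w.1 (val R n k (gen x y p)) = _
  rw [val_gen, augFull_toB, augZero_f]
  simp only [Subtype.ext_iff]

theorem aug_idem (w x : LState n k) :
    aug w (idem x : OSzAlg R n k) = if w = x then 1 else 0 := by
  rw [idem, aug_gen]
  simp

/-- The augmentation sees only constant multiples of `I_w`, which have degree `0`. -/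
theorem aug_of_mem_gr (w : LState n k) {d : ℤ} (hd : d ≠ 0) {b : OSzAlg R n k}
    (hb : b ∈ gr R n k d) : aug w b = 0 := by
  induction hb using AddSubgroup.closure_induction with
  | mem b hb =>
    obtain ⟨x, y, m, c, hm, rfl⟩ := hb
    rw [aug_gen]
    split_ifs with h
    · obtain ⟨rfl, rfl⟩ := h
      rw [MvPolynomial.constantCoeff_monomial, if_neg]
      rintro rfl
      rw [map_zero, fdeg_eq_zero.2 rfl] at hm
      exact hd (by simpa using hm.symm)
    · rfl
  | zero => exact map_zero _
  | add a b _ _ ha hb => rw [map_add, ha, hb, add_zero]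
  | neg a _ ha => rw [map_neg, ha, neg_zero]

theorem gr_of_neg {d : ℤ} (hd : d < 0) {b : OSzAlg R n k} (hb : b ∈ gr R n k d) : b = 0 := by
  induction hb using AddSubgroup.closure_induction with
  | mem b hb =>
    obtain ⟨x, y, m, c, hm, rfl⟩ := hb
    omega
  | zero => rfl
  | add a b _ _ ha hb => rw [ha, hb, add_zero]
  | neg a _ ha => rw [ha, neg_zero]

/-- The part of degree `0` is spanned by the idempotents. -/
theorem eq_sum_of_mem_gr_zero {b : OSzAlg R n k} (hb : b ∈ gr R n k 0) :
    b = ∑ x : LState n k, gen x x (MvPolynomial.C (aug x b)) := by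
  induction hb using AddSubgroup.closure_induction with
  | mem b hb =>
    obtain ⟨x, y, m, c, hm, rfl⟩ := hb
    have h1 : x = y := Subtype.ext (fdeg_eq_zero.1 (by omega))
    have h2 : m = 0 := (Finsupp.degree_eq_zero_iff m).1 (by omega)
    subst h1 h2
    rw [Finset.sum_eq_single x]
    · rw [aug_gen]; simp
    · intro w _ hw
      rw [aug_gen, if_neg (fun h => hw h.1), map_zero, gen_zero]
    · simp
  | zero => simp [gen_zero]
  | add a b _ _ ha hb =>
    conv_lhs => rw [ha, hb]
    simp only [map_add, gen_add, Finset.sum_add_distrib]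
  | neg a _ ha =>
    have h : ∀ (x : LState n k) (c : R), gen x x (-MvPolynomial.C c) =
        -gen x x (MvPolynomial.C c) := fun x c => by
      rw [eq_neg_iff_add_eq_zero, ← gen_add, neg_add_cancel, gen_zero]
    conv_lhs => rw [ha]
    simp only [map_neg, h, Finset.sum_neg_distrib]

/-- The augmentations are the coordinates of the degree-`0` part with respect to the idempotents. -/
theorem exists_aug_ne_zero {b : OSzAlg R n k} (hb : b ∈ gr R n k 0) (h : b ≠ 0) :
    ∃ x, aug x b ≠ 0 := by
  by_contra! h'
  refine h ((eq_sum_of_mem_gr_zero hb).trans ?_)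
  simp [h', gen_zero]

theorem mul_idem_of_mem_gr_zero {b : OSzAlg R n k} (hb : b ∈ gr R n k 0) (x : LState n k) :
    b * idem x = gen x x (MvPolynomial.C (aug x b)) := by
  conv_lhs => rw [eq_sum_of_mem_gr_zero hb]
  rw [Finset.sum_mul, Finset.sum_eq_single x]
  · rw [idem, gen_mul_gen, gvec_left]; simp
  · intro y _ hy
    exact gen_mul_gen_ne hy _ _
  · simp

end OSzAlg

end

end OSz

/-! ### Graded Nakayama argument: a shift of some `P(x)` as a quotient -/

namespace OSz

noncomputable section

universe u

open BZero OSzAlg LaurentPolynomial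

section Components

variable {M N : Type*} [AddCommGroup M] [AddCommGroup N] {grM : ℤ → AddSubgroup M}
  {grN : ℤ → AddSubgroup N}

theorem comp_mem (h : DirectSum.IsInternal grM) (d : ℤ) (m : M) : comp h d m ∈ grM d :=
  SetLike.coe_mem (decomp h m d)

theorem comp_of_mem_same (h : DirectSum.IsInternal grM) {d : ℤ} {m : M} (hm : m ∈ grM d) :
    comp h d m = m := by
  rw [comp_of_mem h d d m hm, if_pos rfl]

theorem finite_comp_ne_zero (h : DirectSum.IsInternal grM) (m : M) :
    {d | comp h d m ≠ 0}.Finite := by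
  refine (DFinsupp.finite_support (decomp h m)).subset fun d hd h0 => hd ?_
  change ((decomp h m d : grM d) : M) = 0
  rw [h0]
  rfl

/-- Two additive maps agree if they agree on the homogeneous elements. -/
theorem addHom_eq_of_homogeneous (h : DirectSum.IsInternal grM) {φ ψ : M →+ N}
    (H : ∀ d, ∀ m ∈ grM d, φ m = ψ m) (m : M) : φ m = ψ m := by
  have := induction_homogeneous h (K := (φ - ψ).ker) (fun d m hm => by
    rw [AddMonoidHom.mem_ker, AddMonoidHom.sub_apply, H d m hm, sub_self]) m
  rwa [AddMonoidHom.mem_ker, AddMonoidHom.sub_apply, sub_eq_zero] at this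

/-- Homogeneous maps commute with taking components. -/
theorem map_comp (hM : DirectSum.IsInternal grM) (hN : DirectSum.IsInternal grN) (φ : M →+ N)
    (i : ℤ) (hφ : ∀ d, ∀ m ∈ grM d, φ m ∈ grN (d + i)) (d : ℤ) (m : M) :
    φ (comp hM d m) = comp hN (d + i) (φ m) := by
  refine addHom_eq_of_homogeneous hM (φ := φ.comp (comp hM d))
    (ψ := (comp hN (d + i)).comp φ) (fun e m hm => ?_) m
  simp only [AddMonoidHom.comp_apply]
  rw [comp_of_mem hM d e m hm, comp_of_mem hN _ _ _ (hφ e m hm)]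
  by_cases h : e = d
  · rw [if_pos h, if_pos (by omega)]
  · rw [if_neg h, if_neg (by omega), map_zero]

/-- The inverse of a bijective homogeneous map is homogeneous. -/
theorem mem_of_map_mem (hM : DirectSum.IsInternal grM) (hN : DirectSum.IsInternal grN) (φ : M →+ N)
    (hinj : Function.Injective φ) (i : ℤ) (hφ : ∀ d, ∀ m ∈ grM d, φ m ∈ grN (d + i)) {d : ℤ} {m : M}
    (hm : φ m ∈ grN (d + i)) : m ∈ grM d := by
  -- The component of `φ m` in degree `d + i` is the image of the component of `m` in degree `d`; as
  -- `φ m` equals its own component, injectivity identifies `m` with its component.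
  have h := map_comp hM hN φ i hφ d m
  rw [comp_of_mem_same hN hm] at h
  exact hinj h ▸ comp_mem hM d m

variable {A : Type*} [Ring A] {grA : ℤ → AddSubgroup A} [Module A M] [Module A N]

theorem comp_smul (hM : DirectSum.IsInternal grM)
    (hAM : ∀ i j, ∀ a ∈ grA i, ∀ m ∈ grM j, a • m ∈ grM (i + j)) {i : ℤ} {a : A}
    (ha : a ∈ grA i) (d : ℤ) (m : M) : comp hM (d + i) (a • m) = a • comp hM d m :=
  (map_comp hM hM (DistribSMul.toAddMonoidHom M a) i
    (fun e m hm => by rw [add_comm]; exact hAM i e a ha m hm) d m).symm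

/-- The component of degree `s` of a linear map. -/
theorem exists_linearMap_comp (hA : DirectSum.IsInternal grA) (hM : DirectSum.IsInternal grM)
    (hN : DirectSum.IsInternal grN)
    (hAM : ∀ i j, ∀ a ∈ grA i, ∀ m ∈ grM j, a • m ∈ grM (i + j))
    (hAN : ∀ i j, ∀ a ∈ grA i, ∀ m ∈ grN j, a • m ∈ grN (i + j)) (φ : M →ₗ[A] N) (s : ℤ) :
    ∃ ψ : M →ₗ[A] N, ∀ e, ∀ m ∈ grM e, ψ m = comp hN (e + s) (φ m) := by
  classical
  let ψ₀ : M →+ N := (DirectSum.toAddMonoid (β := fun e => grM e) fun e =>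
    ((comp hN (e + s)).comp φ.toAddMonoidHom).comp (grM e).subtype).comp (decomp hM).toAddMonoidHom
  have hψ : ∀ e, ∀ m ∈ grM e, ψ₀ m = comp hN (e + s) (φ m) := by
    intro e m hm
    change DirectSum.toAddMonoid _ (decomp hM m) = _
    rw [decomp_of_mem hM e m hm, DirectSum.toAddMonoid_of]
    rfl
  refine ⟨{ ψ₀ with map_smul' := fun a m => ?_ }, hψ⟩
  -- Both sides of the linearity equation are additive in `m` and in `a`, so homogeneous `m` and `a`
  -- suffice; there the claim is that taking components commutes with a homogeneous scalar.
  refine addHom_eq_of_homogeneous hM (φ := ψ₀.comp (DistribSMul.toAddMonoidHom M a))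
    (ψ := (DistribSMul.toAddMonoidHom N a).comp ψ₀) (fun e m hm => ?_) m
  refine addHom_eq_of_homogeneous hA (φ := ψ₀.comp (AddMonoidHom.flip (smulAddHom A M) m))
    (ψ := AddMonoidHom.flip (smulAddHom A N) (ψ₀ m)) (fun i a ha => ?_) a
  change ψ₀ (a • m) = a • ψ₀ m
  rw [hψ _ _ (hAM i e a ha m hm), hψ e m hm, map_smul, ← comp_smul hN hAN ha,
    show i + e + s = e + s + i by ring]

end Components

/-- A finitely generated projective module is a retract of some `A^N`: the `s j` are the images of
the standard basis, and the `g j` are the coordinates of the section. This supplies linear forms on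
`M`, with no homogeneity claimed. -/
theorem exists_dual_basis (A M : Type*) [Ring A] [AddCommGroup M] [Module A M] [Module.Finite A M]
    [Module.Projective A M] :
    ∃ (N : ℕ) (s : Fin N → M) (g : Fin N → M →ₗ[A] A), ∀ m, m = ∑ j, g j m • s j := by
  obtain ⟨N, s, g, -, -, hs⟩ := Module.Finite.exists_comp_eq_id_of_projective A M
  refine ⟨N, fun j => s (Pi.single j 1), fun j => LinearMap.proj j ∘ₗ g, fun m => ?_⟩
  conv_lhs => rw [← LinearMap.id_apply (R := A) m, ← hs, LinearMap.comp_apply]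
  simp only [← map_smul]
  rw [← map_sum]
  congr 1
  funext i
  simp [Finset.sum_apply, Pi.single_apply]

variable {𝕜 : Type u} [Field 𝕜] {n k : ℕ}

namespace GrProj

variable (M : OSzProj 𝕜 n k)

/-- The algebra has no elements of negative degree, so acting by it cannot create components below
those of `m`. -/
theorem comp_smul_eq_zero {D d : ℤ} (hd : d < D) (a : OSzAlg 𝕜 n k) {m : M.carrier}
    (hm : ∀ e, e < D → comp M.isInternal e m = 0) : comp M.isInternal d (a • m) = 0 := by
  refine addHom_eq_of_homogeneous gr_isInternal
    (φ := (comp M.isInternal d).comp (AddMonoidHom.flip (smulAddHom (OSzAlg 𝕜 n k) M.carrier) m))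
    (ψ := 0) (fun i a ha => ?_) a
  change comp M.isInternal d (a • m) = 0
  rcases lt_or_ge i 0 with hi | hi
  · rw [gr_of_neg hi ha, zero_smul, map_zero]
  · have := comp_smul M.isInternal M.smul_mem ha (d - i) m
    rw [sub_add_cancel] at this
    rw [this, hm _ (by omega), smul_zero]

/-- Finitely many generators have only finitely many nonzero components; a lower bound for their
degrees is one for all of `M`, since scalars never lower degrees. -/
theorem exists_lower_bound : ∃ D : ℤ, ∀ e, e < D → ∀ m : M.carrier, comp M.isInternal e m = 0 := by
  obtain ⟨s, hs⟩ := (inferInstance : Module.Finite (OSzAlg 𝕜 n k) M.carrier)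
  have hfin : (⋃ g ∈ s, {d | comp M.isInternal d g ≠ 0}).Finite :=
    s.finite_toSet.biUnion fun g _ => finite_comp_ne_zero M.isInternal g
  obtain ⟨D, hD⟩ := hfin.bddBelow
  refine ⟨D, fun e he m => ?_⟩
  have hm : m ∈ Submodule.span (OSzAlg 𝕜 n k) (s : Set M.carrier) := hs ▸ Submodule.mem_top
  -- The induction needs all degrees below `D` at once: a scalar of positive degree brings a
  -- component up from a lower degree.
  suffices ∀ e, e < D → comp M.isInternal e m = 0 from this e he
  induction hm using Submodule.span_induction with
  | mem g hg =>
    intro e he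
    by_contra h
    exact absurd (hD (Set.mem_biUnion hg h)) (not_le.2 he)
  | zero => exact fun e _ => map_zero _
  | add a b _ _ ha hb => exact fun e he => by rw [map_add, ha e he, hb e he, add_zero]
  | smul a m _ hm => exact fun e he => M.comp_smul_eq_zero he a hm

theorem exists_lowest_degree [Nontrivial M.carrier] : ∃ (d : ℤ) (m : M.carrier), m ∈ M.gr d ∧
    m ≠ 0 ∧ ∀ e, e < d → ∀ m : M.carrier, comp M.isInternal e m = 0 := by
  obtain ⟨D, hD⟩ := M.exists_lower_bound
  obtain ⟨d, ⟨m, hm⟩, hd⟩ := Int.exists_least_of_bdd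
    (P := fun d => ∃ m : M.carrier, comp M.isInternal d m ≠ 0) ⟨D, fun e ⟨m, hm⟩ => by
      by_contra h
      exact hm (hD e (not_le.1 h) m)⟩ (by
      -- If no degree had a nonzero component, every homogeneous element would be zero, and with
      -- them the whole module.
      by_contra! h
      obtain ⟨m, hm⟩ := exists_ne (0 : M.carrier)
      refine hm (addHom_eq_of_homogeneous M.isInternal (φ := AddMonoidHom.id _) (ψ := 0)
        (fun d m hm => ?_) m)
      exact (comp_of_mem_same M.isInternal hm).symm.trans (h d m))
  refine ⟨d, _, comp_mem M.isInternal d m, hm, fun e he m => ?_⟩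
  by_contra h
  exact absurd (hd e ⟨m, h⟩) (not_le.2 he)

/-- In degree `d` only the degree-`0` part of `a` can act: parts of positive degree would need
components of `m` below `d`, and there are no parts of negative degree. -/
theorem comp_smul_of_lowest {d : ℤ} (hd : ∀ e, e < d → ∀ m : M.carrier, comp M.isInternal e m = 0)
    (a : OSzAlg 𝕜 n k) (m : M.carrier) : comp M.isInternal d (a • m) =
      comp (gr_isInternal (R := 𝕜)) 0 a • comp M.isInternal d m := by
  refine addHom_eq_of_homogeneous gr_isInternal
    (φ := (comp M.isInternal d).comp (AddMonoidHom.flip (smulAddHom (OSzAlg 𝕜 n k) M.carrier) m))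
    (ψ := (AddMonoidHom.flip (smulAddHom (OSzAlg 𝕜 n k) M.carrier) (comp M.isInternal d m)).comp
      (comp gr_isInternal 0)) (fun i a ha => ?_) a
  change comp M.isInternal d (a • m) =
    comp (gr_isInternal (R := 𝕜)) 0 a • comp M.isInternal d m
  have h := comp_smul M.isInternal M.smul_mem ha (d - i) m
  rw [sub_add_cancel] at h
  rw [h, comp_of_mem _ 0 i a ha]
  rcases lt_trichotomy i 0 with hi | rfl | hi
  · rw [gr_of_neg hi ha, if_neg hi.ne, zero_smul, zero_smul]
  · rw [sub_zero, if_pos rfl]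
  · rw [hd _ (by omega), if_neg hi.ne', smul_zero, zero_smul]

/-- A nonzero module has a linear form that does not vanish modulo the augmentation ideal. -/
theorem exists_linearForm [Nontrivial M.carrier] : ∃ (d : ℤ) (m : M.carrier)
    (f : M.carrier →ₗ[OSzAlg 𝕜 n k] OSzAlg 𝕜 n k) (x : LState n k),
    m ∈ M.gr d ∧ aug x (comp (gr_isInternal (R := 𝕜)) 0 (f m)) ≠ 0 := by
  obtain ⟨d, m, hm, hm0, hd⟩ := M.exists_lowest_degree
  obtain ⟨N, s, g, hs⟩ := exists_dual_basis (OSzAlg 𝕜 n k) M.carrier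
  -- Taking the component of degree `d` of `m = ∑ g_j(m) s_j` leaves only the degree-`0` parts of
  -- the coefficients. If all of them vanished, `m` would be zero.
  have h2 : ∃ j, comp (gr_isInternal (R := 𝕜)) 0 (g j m) ≠ 0 := by
    by_contra! h
    refine hm0 ?_
    rw [← comp_of_mem_same M.isInternal hm, hs m, map_sum]
    refine Finset.sum_eq_zero fun j _ => ?_
    rw [M.comp_smul_of_lowest hd, h, zero_smul]
  obtain ⟨j, hj⟩ := h2
  obtain ⟨x, hx⟩ := exists_aug_ne_zero (comp_mem (gr_isInternal (R := 𝕜)) 0 (g j m)) hj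
  exact ⟨d, m, g j, x, hm, hx⟩

/-- A nonzero module maps onto a shift of some `P(x)`. -/
theorem exists_surjective_projP [Nontrivial M.carrier] : ∃ (s : ℤ) (x : LState n k)
    (ψ : M.carrier →ₗ[OSzAlg 𝕜 n k] (projP (R := 𝕜) x).carrier),
    (∀ e, ∀ m ∈ M.gr e, ψ m ∈ (projP (R := 𝕜) x).gr (e + s)) ∧ ∃ m ∈ M.gr (-s), ψ m = idemP x := by
  obtain ⟨d, m, f, x, hm, hx⟩ := M.exists_linearForm
  -- The form followed by right multiplication by `I_x` need not be homogeneous; its component of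
  -- degree `-d` is, and it brings `m`, of degree `d`, to degree `0`.
  obtain ⟨ψ, hψ⟩ := exists_linearMap_comp gr_isInternal M.isInternal (projP (R := 𝕜) x).isInternal
    M.smul_mem (projP (R := 𝕜) x).smul_mem ((mulRightIdem (idem x)).comp f) (-d)
  set c := aug x (comp (gr_isInternal (R := 𝕜)) 0 (f m)) with hc
  have h0 : gen x x (MvPolynomial.C c⁻¹) ∈ OSzAlg.gr 𝕜 n k 0 := by
    have := gen_monomial_mem x x 0 c⁻¹
    rwa [map_zero, fdeg_eq_zero.2 rfl] at this
  -- The degree-`0` component of `f(m) I_x` is the degree-`0` part of `f(m)` times `I_x`, that is `c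
  -- I_x`. As `c` is a nonzero scalar of the field, replacing `m` by `c⁻¹ I_x m` hits `I_x` exactly,
  -- without changing the degree.
  have h1 : ψ m = (⟨gen x x (MvPolynomial.C c), Ideal.mem_span_singleton'.2
      ⟨gen x x (MvPolynomial.C c), by rw [idem, gen_mul_gen, gvec_right]; simp⟩⟩ : Ideal.span {(idem x : OSzAlg 𝕜 n k)}) := by
    rw [hψ d m hm, add_neg_cancel]
    have h2 := map_comp gr_isInternal (projP (R := 𝕜) x).isInternal
      (mulRightIdem (idem x : OSzAlg 𝕜 n k)).toAddMonoidHom 0 (fun e a ha => by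
        rw [add_zero]
        have := mul_mem_gr ha (idem_mem_gr x)
        rwa [add_zero] at this) 0 (f m)
    rw [add_zero] at h2
    refine h2.symm.trans (Subtype.ext ?_)
    exact mul_idem_of_mem_gr_zero (comp_mem _ 0 _) x
  refine ⟨-d, x, ψ, fun e m hm => ?_, gen x x (MvPolynomial.C c⁻¹) • m, ?_, ?_⟩
  · rw [hψ e m hm]
    exact comp_mem _ _ _
  · have := M.smul_mem 0 d _ h0 m hm
    rwa [neg_neg, ← zero_add d]
  · rw [map_smul, h1]
    refine Subtype.ext ?_
    change gen x x _ * gen x x _ = gen x x 1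
    rw [gen_mul_gen, gvec_right, ← map_mul, inv_mul_cancel₀ hx]
    simp

end GrProj

end

end OSz

/-! ### The classes of the `P(x)` form a basis of the Grothendieck group -/

namespace OSz

noncomputable section

universe u

open BZero OSzAlg LaurentPolynomial

section K0

variable {A : Type u} [Ring A] {grA : ℤ → AddSubgroup A}

/-- The module `q^i M`. -/
def GrProj.shift (M : GrProj A grA) (i : ℤ) : GrProj A grA where
  carrier := M.carrier
  gr d := M.gr (d - i)
  isInternal := by
    refine isInternal_of_proj _ (AddMonoidHom.id _) (fun _ _ h => h)
      (fun d => OSz.comp M.isInternal (d - i)) (fun d e m hm => ?_) fun m => ?_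
    · rw [comp_of_mem M.isInternal _ _ m hm]
      exact if_congr (by omega) rfl rfl
    · have h : (⨆ d, M.gr (d - i)) = ⨆ d, M.gr d := (Equiv.subRight i).iSup_comp (g := M.gr)
      rw [h]
      exact mem_iSup_of_isInternal M.isInternal m
  smul_mem a b r hr m hm := by
    have := M.smul_mem a (b - i) r hr m hm
    rwa [← add_sub_assoc] at this

namespace K0

variable (A grA) in
/-- The quotient map of the presentation of the Grothendieck group. -/
def mk : (GrProj A grA →₀ ℤ[T;T⁻¹]) →ₗ[ℤ[T;T⁻¹]] K0 A grA :=
  (Submodule.span ℤ[T;T⁻¹] {r | K0Rel A grA r}).mkQ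

theorem mk_single (M : GrProj A grA) (c : ℤ[T;T⁻¹]) :
    mk A grA (Finsupp.single M c) = c • cls M := by
  rw [← mul_one c, ← smul_eq_mul, ← Finsupp.smul_single, map_smul, smul_eq_mul, mul_one]
  rfl

theorem mk_rel {r : GrProj A grA →₀ ℤ[T;T⁻¹]} (h : K0Rel A grA r) : mk A grA r = 0 :=
  (Submodule.Quotient.mk_eq_zero _).2 (Submodule.subset_span h)

theorem cls_sum {L N M : GrProj A grA} (e : (L.carrier × N.carrier) ≃ₗ[A] M.carrier)
    (he : ∀ d, ∀ l ∈ L.gr d, ∀ m ∈ N.gr d, e (l, m) ∈ M.gr d) :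
    (cls M : K0 A grA) = cls L + cls N := by
  have h := mk_rel (K0Rel.sum L N M e he)
  rwa [map_sub, map_sub, sub_sub, sub_eq_zero, mk_single, mk_single, mk_single, one_smul, one_smul,
    one_smul] at h

theorem cls_of_shift {M M' : GrProj A grA} (i : ℤ) (e : M.carrier ≃ₗ[A] M'.carrier)
    (he : ∀ d, ∀ m ∈ M.gr d, e m ∈ M'.gr (d + i)) :
    (cls M' : K0 A grA) = (T i : ℤ[T;T⁻¹]) • cls M := by
  have h := mk_rel (K0Rel.shift i M M' e he)
  rwa [map_sub, sub_eq_zero, mk_single, mk_single, one_smul] at h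

theorem cls_shift (M : GrProj A grA) (i : ℤ) :
    (cls (M.shift i) : K0 A grA) = (T i : ℤ[T;T⁻¹]) • cls M :=
  cls_of_shift i (LinearEquiv.refl A M.carrier) fun d m hm => by
    change m ∈ M.gr (d + i - i)
    rwa [add_sub_cancel_right]

/-- Isomorphism invariance is contained in the shift relation, as the shift by `0`. -/
theorem cls_of_grIso {M N : GrProj A grA} (h : GrIso M N) : (cls M : K0 A grA) = cls N := by
  obtain ⟨e, he⟩ := h
  rw [cls_of_shift 0 e fun d m hm => by rw [add_zero]; exact he d m hm, T_zero, one_smul]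

/-- A zero module is isomorphic to the sum of two copies of itself, so its class equals twice
itself. -/
theorem cls_of_subsingleton (M : GrProj A grA) [Subsingleton M.carrier] :
    (cls M : K0 A grA) = 0 := by
  have h : (cls M : K0 A grA) = cls M + cls M :=
    cls_sum (LinearEquiv.ofSubsingleton (R := A) (M.carrier × M.carrier) M.carrier)
      fun d l hl m hm => by convert hl
  exact left_eq_add.1 h

/-- An additive function on the modules that is compatible with shifts induces a linear map on the
Grothendieck group. -/
theorem exists_lift {N : Type*} [AddCommGroup N] [Module ℤ[T;T⁻¹] N] (f : GrProj A grA → N)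
    (hsum : ∀ (L N M : GrProj A grA) (e : (L.carrier × N.carrier) ≃ₗ[A] M.carrier)
      (_ : ∀ d, ∀ l ∈ L.gr d, ∀ m ∈ N.gr d, e (l, m) ∈ M.gr d), f M = f L + f N)
    (hshift : ∀ (i : ℤ) (M M' : GrProj A grA) (e : M.carrier ≃ₗ[A] M'.carrier)
      (_ : ∀ d, ∀ m ∈ M.gr d, e m ∈ M'.gr (d + i)), f M' = (T i : ℤ[T;T⁻¹]) • f M) :
    ∃ Φ : K0 A grA →ₗ[ℤ[T;T⁻¹]] N, ∀ M, Φ (cls M) = f M := by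
  refine ⟨Submodule.liftQ _ (Finsupp.linearCombination ℤ[T;T⁻¹] f) (Submodule.span_le.2 ?_),
    fun M => ?_⟩
  · rintro _ (⟨L, N, M, e, he⟩ | ⟨i, M, M', e, he⟩)
    · simp [hsum L N M e he]
    · simp [hshift i M M' e he]
  · refine (Submodule.liftQ_apply _ _ _).trans ?_
    rw [Finsupp.linearCombination_single, one_smul]

theorem span_cls : Submodule.span ℤ[T;T⁻¹] (Set.range (cls : GrProj A grA → K0 A grA)) = ⊤ := by
  refine Submodule.eq_top_iff'.2 fun z => ?_
  obtain ⟨v, rfl⟩ : ∃ v, mk A grA v = z := Submodule.mkQ_surjective _ z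
  induction v using Finsupp.induction_linear with
  | zero => rw [map_zero]; exact zero_mem _
  | add v w hv hw => rw [map_add]; exact add_mem hv hw
  | single M c =>
    rw [mk_single]
    exact Submodule.smul_mem _ _ (Submodule.subset_span ⟨M, rfl⟩)

end K0

end K0

variable {𝕜 : Type u} [Field 𝕜] {n k : ℕ}

namespace GrProj

/-- A lift `m₀` of the generator `I_x` gives the section `r ↦ r m₀`, because `r I_x = r` on `P(x)`.
Hence `M` is the sum of `ker ψ` and a shifted `P(x)`. The kernel is a homogeneous direct summand of
`M`, so it is again an object of the category. -/
theorem exists_ker (M : OSzProj 𝕜 n k) (s : ℤ) (x : LState n k)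
    (ψ : M.carrier →ₗ[OSzAlg 𝕜 n k] (projP (R := 𝕜) x).carrier)
    (hψ : ∀ e, ∀ m ∈ M.gr e, ψ m ∈ (projP (R := 𝕜) x).gr (e + s))
    (m₀ : M.carrier) (hm₀ : m₀ ∈ M.gr (-s)) (h : ψ m₀ = idemP x) :
    ∃ (K : OSzProj 𝕜 n k)
      (e : (K.carrier × ((projP (R := 𝕜) x).shift (-s)).carrier) ≃ₗ[OSzAlg 𝕜 n k] M.carrier),
      ∀ d, ∀ l ∈ K.gr d, ∀ m ∈ ((projP (R := 𝕜) x).shift (-s)).gr d, e (l, m) ∈ M.gr d := by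
  let σ : (projP (R := 𝕜) x).carrier →ₗ[OSzAlg 𝕜 n k] M.carrier :=
    (LinearMap.toSpanSingleton (OSzAlg 𝕜 n k) M.carrier m₀).comp
      (Submodule.subtype (Ideal.span {(idem x : OSzAlg 𝕜 n k)}))
  have hσ : ∀ d, ∀ r ∈ (projP (R := 𝕜) x).gr d, σ r ∈ M.gr (d - s) := fun d r hr =>
    M.smul_mem d (-s) _ hr m₀ hm₀
  have hψσ : ∀ r, ψ (σ r) = r := fun r => by
    change ψ (r.1 • m₀) = r
    rw [map_smul, h]
    exact smul_idemP x r
  let ρ : M.carrier →ₗ[OSzAlg 𝕜 n k] LinearMap.ker ψ :=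
    LinearMap.codRestrict _ (LinearMap.id - σ ∘ₗ ψ) fun m => by
      rw [LinearMap.mem_ker, LinearMap.sub_apply, LinearMap.comp_apply, map_sub, hψσ,
        LinearMap.id_apply, sub_self]
  have hρ : ∀ m, (ρ m : M.carrier) = m - σ (ψ m) := fun m => rfl
  have hρι : ∀ l : LinearMap.ker ψ, ρ l = l := fun l => Subtype.ext (by
    rw [hρ, LinearMap.mem_ker.1 l.2, map_zero, sub_zero])
  have hfin : Module.Finite (OSzAlg 𝕜 n k) (LinearMap.ker ψ) :=
    Module.Finite.of_surjective ρ fun l => ⟨l, hρι l⟩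
  have hproj : Module.Projective (OSzAlg 𝕜 n k) (LinearMap.ker ψ) :=
    Module.Projective.of_split (Submodule.subtype _) ρ (LinearMap.ext hρι)
  let K : OSzProj 𝕜 n k :=
    { carrier := LinearMap.ker ψ
      gr := fun d => (M.gr d).comap (Submodule.subtype (LinearMap.ker ψ)).toAddMonoidHom
      -- The projection `id - σψ` preserves degrees, since `ψ` raises them by `s` and `σ` lowers
      -- them by `s`.
      isInternal := isInternal_comap M.isInternal _ Subtype.val_injective ρ.toAddMonoidHom hρι
        fun d m hm => by
          have := hσ _ _ (hψ d m hm)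
          rw [add_sub_cancel_right] at this
          exact sub_mem hm this
      smul_mem := fun i j a ha m hm => M.smul_mem i j a ha m.1 hm }
  refine ⟨K, LinearEquiv.ofLinearMap (M := LinearMap.ker ψ × (projP (R := 𝕜) x).carrier)
    ((Submodule.subtype _).coprod σ) (ρ.prod ψ) ?_ ?_, ?_⟩
  · refine LinearMap.ext fun m => ?_
    change (ρ m : M.carrier) + σ (ψ m) = m
    rw [hρ, sub_add_cancel]
  · refine LinearMap.ext fun p => Prod.ext (Subtype.ext ?_) ?_
    · change (p.1.1 + σ p.2) - σ (ψ (p.1.1 + σ p.2)) = p.1.1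
      rw [map_add, LinearMap.mem_ker.1 p.1.2, hψσ, zero_add, add_sub_cancel_right]
    · change ψ (p.1.1 + σ p.2) = p.2
      rw [map_add, LinearMap.mem_ker.1 p.1.2, hψσ, zero_add]
  · intro d l hl r hr
    refine add_mem (S := AddSubgroup M.carrier) hl ?_
    have := hσ _ _ hr
    rwa [sub_neg_eq_add, add_sub_cancel_right] at this

/-- The forms on `M` that factor through the top at `x`, and vanish in the degrees outside `D`. -/
def coinv (x : LState n k) (D : Set ℤ) (M : OSzProj 𝕜 n k) : Submodule 𝕜 (M.carrier →+ 𝕜) where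
  carrier := {φ | (∀ (a : OSzAlg 𝕜 n k) (m : M.carrier), φ (a • m) = aug x a * φ m) ∧
    ∀ d ∉ D, ∀ m ∈ M.gr d, φ m = 0}
  zero_mem' := ⟨fun a m => (mul_zero _).symm, fun _ _ _ _ => rfl⟩
  add_mem' := fun {φ χ} hφ hχ => ⟨fun a m => by
    rw [AddMonoidHom.add_apply, AddMonoidHom.add_apply, hφ.1, hχ.1, mul_add], fun d hd m hm => by
    rw [AddMonoidHom.add_apply, hφ.2 d hd m hm, hχ.2 d hd m hm, add_zero]⟩
  smul_mem' := fun c φ hφ => ⟨fun a m => by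
    rw [AddMonoidHom.smul_apply, AddMonoidHom.smul_apply, hφ.1, smul_eq_mul, smul_eq_mul,
      mul_left_comm], fun d hd m hm => by
    rw [AddMonoidHom.smul_apply, hφ.2 d hd m hm, smul_zero]⟩

variable {x : LState n k} {D : Set ℤ} {L N M M' : OSzProj 𝕜 n k}

/-- Algebra elements act on the values of such a form by scalars, so vanishing propagates from
generators. This bounds both the dimension of the space of forms and the degrees in which a nonzero
form exists. -/
theorem coinv_ext_generators {s : Set M.carrier} (hs : Submodule.span (OSzAlg 𝕜 n k) s = ⊤)
    {φ : M.carrier →+ 𝕜} (hφ : φ ∈ coinv x D M) (h : ∀ g ∈ s, φ g = 0) : φ = 0 := by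
  ext m
  have hm : m ∈ Submodule.span (OSzAlg 𝕜 n k) s := hs ▸ Submodule.mem_top
  induction hm using Submodule.span_induction with
  | mem g hg => exact h g hg
  | zero => exact map_zero φ
  | add a b _ _ ha hb => rw [map_add, ha, hb, map_add]
  | smul a m _ hm => rw [hφ.1, hm]; exact mul_zero _

instance finite_coinv : Module.Finite 𝕜 (coinv x D M) := by
  obtain ⟨s, hs⟩ := (inferInstance : Module.Finite (OSzAlg 𝕜 n k) M.carrier)
  let ev : coinv x D M →ₗ[𝕜] (s → 𝕜) :=
    { toFun := fun φ g => φ.1 g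
      map_add' := fun _ _ => rfl
      map_smul' := fun _ _ => rfl }
  refine Module.Finite.of_injective ev (LinearMap.ker_eq_bot.1 (LinearMap.ker_eq_bot'.2
    fun φ hφ => Subtype.ext (coinv_ext_generators hs φ.2 fun g hg => congrFun hφ ⟨g, hg⟩)))

instance free_coinv : Module.Free 𝕜 (coinv x D M) :=
  @Module.Free.of_divisionRing 𝕜 _ _ (Submodule.addCommGroup (coinv x D M)) _

theorem coinv_apply_comp {φ : M.carrier →+ 𝕜} {d : ℤ} (hφ : φ ∈ coinv x {d} M) (m : M.carrier) :
    φ m = φ (OSz.comp M.isInternal d m) := by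
  refine addHom_eq_of_homogeneous M.isInternal (φ := φ) (ψ := φ.comp (OSz.comp M.isInternal d))
    (fun e m hm => ?_) m
  rw [AddMonoidHom.comp_apply, comp_of_mem M.isInternal d e m hm]
  split_ifs with h
  · rfl
  · rw [map_zero]
    exact hφ.2 e h m hm

/-- A form concentrated in degree `d` sees only the component of degree `d` of each generator. If no
generator has such a component, the form is zero, and finitely many generators have only finitely
many components. This makes the sum in `mult` finite. -/
theorem finite_finrank_coinv_ne_zero (x : LState n k) (M : OSzProj 𝕜 n k) :
    {d : ℤ | Module.finrank 𝕜 (coinv x {d} M) ≠ 0}.Finite := by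
  obtain ⟨s, hs⟩ := (inferInstance : Module.Finite (OSzAlg 𝕜 n k) M.carrier)
  have hfin : (⋃ g ∈ s, {d | OSz.comp M.isInternal d g ≠ 0}).Finite :=
    s.finite_toSet.biUnion fun g _ => finite_comp_ne_zero M.isInternal g
  refine hfin.subset fun d hd => ?_
  by_contra h
  simp only [Set.mem_iUnion, Set.mem_ofPred_eq, not_exists, not_not] at h
  have h0 : coinv x {d} M = ⊥ := (Submodule.eq_bot_iff _).2 fun φ hφ =>
    coinv_ext_generators hs hφ fun g hg => by rw [coinv_apply_comp hφ, h g hg, map_zero]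
  exact hd (by rw [h0, finrank_bot])

/-- Forms on a direct sum are pairs of forms. The degree condition transfers in both directions
because `e⁻¹` is homogeneous as well. -/
theorem finrank_coinv_sum (e : (L.carrier × N.carrier) ≃ₗ[OSzAlg 𝕜 n k] M.carrier)
    (he : ∀ d, ∀ l ∈ L.gr d, ∀ m ∈ N.gr d, e (l, m) ∈ M.gr d) :
    Module.finrank 𝕜 (coinv x D M) =
      Module.finrank 𝕜 (coinv x D L) + Module.finrank 𝕜 (coinv x D N) := by
  -- The hypothesis concerns `e` only; for the inverse, compare components: `e` carries the pair of
  -- degree-`d` components to the degree-`d` component of the image.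
  have he' : ∀ d, ∀ m ∈ M.gr d, (e.symm m).1 ∈ L.gr d ∧ (e.symm m).2 ∈ N.gr d := by
    intro d m hm
    have h1 : ∀ l n, e (OSz.comp L.isInternal d l, OSz.comp N.isInternal d n) =
        OSz.comp M.isInternal d (e (l, n)) := by
      intro l n
      have hl := map_comp L.isInternal M.isInternal
        (e.toLinearMap ∘ₗ LinearMap.inl _ _ _).toAddMonoidHom 0
        (fun d l hl => by rw [add_zero]; exact he d l hl 0 (zero_mem _)) d l
      have hn := map_comp N.isInternal M.isInternal
        (e.toLinearMap ∘ₗ LinearMap.inr _ _ _).toAddMonoidHom 0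
        (fun d n hn => by rw [add_zero]; exact he d 0 (zero_mem _) n hn) d n
      rw [add_zero] at hl hn
      have h2 : ∀ (a : L.carrier) (b : N.carrier), e (a, b) = e (a, 0) + e (0, b) := fun a b => by
        rw [← map_add]; simp
      rw [h2 l n, map_add, h2]
      exact congrArg₂ (· + ·) hl hn
    have h3 := h1 (e.symm m).1 (e.symm m).2
    rw [Prod.mk.eta, e.apply_symm_apply, comp_of_mem_same M.isInternal hm] at h3
    have h4 := e.symm_apply_eq.2 h3.symm
    rw [h4]
    exact ⟨comp_mem _ _ _, comp_mem _ _ _⟩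
  have E : coinv x D M ≃ₗ[𝕜] coinv x D L × coinv x D N :=
    { toFun := fun φ =>
        (⟨φ.1.comp (e.toLinearMap ∘ₗ LinearMap.inl _ _ _).toAddMonoidHom,
          fun a l => (congrArg φ.1 (map_smul (e.toLinearMap ∘ₗ LinearMap.inl _ _ _) a l)).trans
            (φ.2.1 a _), fun d hd l hl => φ.2.2 d hd _ (he d l hl 0 (zero_mem _))⟩,
          ⟨φ.1.comp (e.toLinearMap ∘ₗ LinearMap.inr _ _ _).toAddMonoidHom,
          fun a l => (congrArg φ.1 (map_smul (e.toLinearMap ∘ₗ LinearMap.inr _ _ _) a l)).trans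
            (φ.2.1 a _), fun d hd n hn => φ.2.2 d hd _ (he d 0 (zero_mem _) n hn)⟩)
      map_add' := fun _ _ => rfl
      map_smul' := fun _ _ => rfl
      invFun := fun p =>
        ⟨(p.1.1.coprod p.2.1).comp e.symm.toLinearMap.toAddMonoidHom, fun a m => by
          change p.1.1 (e.symm (a • m)).1 + p.2.1 (e.symm (a • m)).2 =
            aug x a * (p.1.1 (e.symm m).1 + p.2.1 (e.symm m).2)
          rw [map_smul, Prod.smul_fst, Prod.smul_snd, p.1.2.1, p.2.2.1, mul_add],
          fun d hd m hm => by
          change p.1.1 (e.symm m).1 + p.2.1 (e.symm m).2 = 0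
          rw [p.1.2.2 d hd _ (he' d m hm).1, p.2.2.2 d hd _ (he' d m hm).2, add_zero]⟩
      left_inv := fun φ => Subtype.ext (AddMonoidHom.ext fun m => by
        change φ.1 (e ((e.symm m).1, 0)) + φ.1 (e (0, (e.symm m).2)) = φ.1 m
        rw [← map_add, ← map_add]
        simp)
      right_inv := fun p => by
        refine Prod.ext (Subtype.ext (AddMonoidHom.ext fun l => ?_))
          (Subtype.ext (AddMonoidHom.ext fun l => ?_))
        · change p.1.1 (e.symm (e (l, 0))).1 + p.2.1 (e.symm (e (l, 0))).2 = p.1.1 l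
          rw [e.symm_apply_apply, map_zero, add_zero]
        · change p.1.1 (e.symm (e (0, l))).1 + p.2.1 (e.symm (e (0, l))).2 = p.2.1 l
          rw [e.symm_apply_apply, map_zero, zero_add] }
  rw [E.finrank_eq, Module.finrank_prod]

theorem finrank_coinv_shift (i d : ℤ) (e : M.carrier ≃ₗ[OSzAlg 𝕜 n k] M'.carrier)
    (he : ∀ d, ∀ m ∈ M.gr d, e m ∈ M'.gr (d + i)) :
    Module.finrank 𝕜 (coinv x {d + i} M') = Module.finrank 𝕜 (coinv x {d} M) := by
  have he' : ∀ d, ∀ m ∈ M'.gr d, e.symm m ∈ M.gr (d - i) := fun d m hm =>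
    mem_of_map_mem M.isInternal M'.isInternal e.toLinearMap.toAddMonoidHom e.injective i he (by
      rw [sub_add_cancel]
      change e (e.symm m) ∈ _
      rwa [e.apply_symm_apply])
  have E : coinv x {d + i} M' ≃ₗ[𝕜] coinv x {d} M :=
    { toFun := fun φ => ⟨φ.1.comp e.toLinearMap.toAddMonoidHom,
        fun a l => (congrArg φ.1 (map_smul e a l)).trans (φ.2.1 a _),
        fun c hc m hm => φ.2.2 (c + i) (fun h => hc (add_right_cancel h)) _ (he c m hm)⟩
      map_add' := fun _ _ => rfl
      map_smul' := fun _ _ => rfl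
      invFun := fun φ => ⟨φ.1.comp e.symm.toLinearMap.toAddMonoidHom,
        fun a l => (congrArg φ.1 (map_smul e.symm a l)).trans (φ.2.1 a _),
        fun c hc m hm => φ.2.2 (c - i) (fun h => hc (sub_eq_iff_eq_add.1 h)) _ (he' c m hm)⟩
      left_inv := fun φ => Subtype.ext (AddMonoidHom.ext fun m =>
        congrArg φ.1 (e.apply_symm_apply m))
      right_inv := fun φ => Subtype.ext (AddMonoidHom.ext fun m =>
        congrArg φ.1 (e.symm_apply_apply m)) }
  exact E.finrank_eq

-- A form on `P(y)` is determined by its value at `I_y`, via `φ(r) = aug x r * φ(I_y)`. Taking `r =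
-- I_y` shows that it vanishes if `x ≠ y`; and since `I_y` has degree `0`, it vanishes if `0 ∉ D`.
-- In the remaining case `aug x` itself spans the space of forms.
open Classical in
theorem finrank_coinv_projP (y : LState n k) :
    Module.finrank 𝕜 (coinv x D (projP (R := 𝕜) y)) = if x = y ∧ 0 ∈ D then 1 else 0 := by
  have key : ∀ φ ∈ coinv x D (projP (R := 𝕜) y), ∀ r : Ideal.span {(idem y : OSzAlg 𝕜 n k)},
      φ r = aug x r.1 * φ (idemP y) := fun φ hφ r =>
    (congrArg φ (smul_idemP y r).symm).trans (hφ.1 r.1 (idemP y))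
  split_ifs with h
  · obtain ⟨rfl, hD⟩ := h
    let φ₀ : (projP (R := 𝕜) x).carrier →+ 𝕜 := (aug x : OSzAlg 𝕜 n k →+* 𝕜).toAddMonoidHom.comp
      (Submodule.subtype (Ideal.span {(idem x : OSzAlg 𝕜 n k)})).toAddMonoidHom
    have h1 : aug x (idem x : OSzAlg 𝕜 n k) = 1 := by rw [aug_idem, if_pos rfl]
    refine finrank_eq_one (⟨φ₀, fun a m => map_mul (aug x) a m.1, fun d hd m hm =>
      aug_of_mem_gr x (by rintro rfl; exact hd hD) hm⟩ : coinv x D (projP (R := 𝕜) x))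
      (fun h0 => ?_) fun φ => ⟨φ.1 (idemP x), ?_⟩
    · have h2 : φ₀ (idemP x) = 0 := DFunLike.congr_fun (congrArg Subtype.val h0) (idemP x)
      exact one_ne_zero (h1.symm.trans h2)
    · refine Subtype.ext (AddMonoidHom.ext fun r => ?_)
      rw [key φ.1 φ.2 r]
      exact mul_comm _ _
  · have h0 : coinv x D (projP (R := 𝕜) y) = ⊥ := (Submodule.eq_bot_iff _).2 fun φ hφ =>
      AddMonoidHom.ext fun r => by
        rw [key φ hφ r]
        by_cases hx : x = y
        · rw [hφ.2 0 (fun hD => h ⟨hx, hD⟩) (idemP y) (idem_mem_gr y), mul_zero]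
          rfl
        · have h1 := key φ hφ (idemP y)
          rw [show (idemP y : Ideal.span {(idem y : OSzAlg 𝕜 n k)}).1 = idem y from rfl, aug_idem,
            if_neg hx, zero_mul] at h1
          rw [h1, mul_zero]
          rfl
    rw [h0, finrank_bot]

/-- With all degrees allowed the grading plays no role, and the two spaces of forms coincide. This
ungraded count is the induction parameter in `cls_mem_span`. -/
theorem finrank_coinv_univ_shift (i : ℤ) : Module.finrank 𝕜 (coinv x Set.univ (M.shift i)) =
    Module.finrank 𝕜 (coinv x Set.univ M) := by
  have h : (coinv x Set.univ (M.shift i) : Submodule 𝕜 (M.carrier →+ 𝕜)) = coinv x Set.univ M :=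
    Submodule.ext fun φ => and_congr Iff.rfl
      (iff_of_true (fun d hd => absurd trivial hd) fun d hd => absurd trivial hd)
  exact congrArg (fun S : Submodule 𝕜 (M.carrier →+ 𝕜) => Module.finrank 𝕜 S) h

/-- The graded multiplicity of `P(x)` in a projective module. -/
def mult (x : LState n k) (M : OSzProj 𝕜 n k) : ℤ[T;T⁻¹] :=
  ∑ᶠ d : ℤ, (Module.finrank 𝕜 (coinv x {d} M) : ℤ[T;T⁻¹]) * T d

theorem finite_support_mult (x : LState n k) (M : OSzProj 𝕜 n k) :
    (Function.support fun d : ℤ =>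
      (Module.finrank 𝕜 (coinv x {d} M) : ℤ[T;T⁻¹]) * T d).Finite := by
  refine (finite_finrank_coinv_ne_zero x M).subset fun d hd h => hd ?_
  dsimp only
  rw [h, Nat.cast_zero, zero_mul]

theorem mult_sum (e : (L.carrier × N.carrier) ≃ₗ[OSzAlg 𝕜 n k] M.carrier)
    (he : ∀ d, ∀ l ∈ L.gr d, ∀ m ∈ N.gr d, e (l, m) ∈ M.gr d) :
    mult x M = mult x L + mult x N := by
  rw [mult, mult, mult, ← finsum_add_distrib (finite_support_mult x L) (finite_support_mult x N)]
  exact finsum_congr fun d => by rw [finrank_coinv_sum e he, Nat.cast_add, add_mul]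

theorem mult_shift (i : ℤ) (e : M.carrier ≃ₗ[OSzAlg 𝕜 n k] M'.carrier)
    (he : ∀ d, ∀ m ∈ M.gr d, e m ∈ M'.gr (d + i)) :
    mult x M' = (T i : ℤ[T;T⁻¹]) • mult x M := by
  rw [mult, mult, smul_eq_mul, mul_finsum' _ _ (finite_support_mult x M),
    ← finsum_comp_equiv (Equiv.addRight i)]
  refine finsum_congr fun d => ?_
  rw [Equiv.coe_addRight, finrank_coinv_shift i d e he, T_add]
  ring

open Classical in
theorem mult_projP (y : LState n k) : mult x (projP (R := 𝕜) y) = if x = y then 1 else 0 := by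
  rw [mult, finsum_eq_single _ 0]
  · rw [finrank_coinv_projP]
    simp
  · intro d hd
    rw [finrank_coinv_projP, if_neg (fun h => hd h.2.symm), Nat.cast_zero, zero_mul]

/-- The class of every module is a combination of the classes of the `P(x)`. -/
theorem cls_mem_span (M : OSzProj 𝕜 n k) : (K0.cls M : K0 _ (OSzAlg.gr 𝕜 n k)) ∈
    Submodule.span ℤ[T;T⁻¹] (Set.range fun x : LState n k => K0.cls (projP (R := 𝕜) x)) := by
  classical
  -- Induction on the total number of forms over all `x`, ignoring degrees. Splitting off a shift of
  -- `P(y)` lowers it by exactly one.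
  obtain ⟨N, hN⟩ : ∃ N, ∑ x : LState n k, Module.finrank 𝕜 (coinv x Set.univ M) = N := ⟨_, rfl⟩
  induction N using Nat.strong_induction_on generalizing M with
  | _ N ih =>
    rcases subsingleton_or_nontrivial M.carrier with hM | hM
    · rw [K0.cls_of_subsingleton]
      exact zero_mem _
    · obtain ⟨s, y, ψ, hψ, m, hm, hψm⟩ := M.exists_surjective_projP
      obtain ⟨K, e, he⟩ := M.exists_ker s y ψ hψ m hm hψm
      have h1 : ∀ x : LState n k, Module.finrank 𝕜 (coinv x Set.univ M) =
          Module.finrank 𝕜 (coinv x Set.univ K) + if x = y then 1 else 0 := by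
        intro x
        rw [finrank_coinv_sum e he]
        congr 1
        rw [finrank_coinv_univ_shift, finrank_coinv_projP]
        simp
      rw [K0.cls_sum e he, K0.cls_shift]
      refine add_mem (ih _ ?_ K rfl) (Submodule.smul_mem _ _ (Submodule.subset_span ⟨y, rfl⟩))
      rw [← hN, Finset.sum_congr rfl fun x _ => h1 x, Finset.sum_add_distrib]
      simp

end GrProj

/-- The multiplicity of `P(x)` is additive and compatible with shifts, so it descends to a linear
functional on `K_0`. It takes the value `1` on `[P(x)]` and `0` on the other `[P(y)]`, hence reads
off the coefficient at `x` of any relation. -/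
theorem linearIndependent_cls_projP :
    LinearIndependent ℤ[T;T⁻¹] fun x : LState n k =>
      (K0.cls (projP (R := 𝕜) x) : K0 _ (OSzAlg.gr 𝕜 n k)) := by
  classical
  rw [Fintype.linearIndependent_iff]
  intro c hc x
  obtain ⟨Φ, hΦ⟩ := K0.exists_lift (GrProj.mult (𝕜 := 𝕜) x)
    (fun L N M e he => GrProj.mult_sum e he) (fun i M M' e he => GrProj.mult_shift i e he)
  have h := congrArg Φ hc
  simpa [hΦ, GrProj.mult_projP] using h

variable (𝕜 n k) in
/-- The basis of the Grothendieck group given by the classes of the `P(x)`. -/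
def K0.basis : Module.Basis (LState n k) ℤ[T;T⁻¹] (K0 (OSzAlg 𝕜 n k) (OSzAlg.gr 𝕜 n k)) :=
  Module.Basis.mk (linearIndependent_cls_projP (𝕜 := 𝕜)) (by
    rw [← K0.span_cls]
    refine Submodule.span_le.2 ?_
    rintro _ ⟨M, rfl⟩
    exact M.cls_mem_span)

theorem K0.basis_apply (x : LState n k) : K0.basis 𝕜 n k x = K0.cls (projP x) :=
  Module.Basis.mk_apply _ _ x

end

end OSz

/-! ### The canonical basis of `V^{⊗ n}` and the action of `F` on it -/

namespace OSz

noncomputable section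

open TensorProduct

namespace SuperMod

/-- `v ↦ v ⊗ v_i`. -/
def append (n : ℕ) (i : Fin 2) : (tpow n).carrier →ₗ[Cq] (tpow (n + 1)).carrier :=
  (TensorProduct.mk Cq (tpow n).carrier (Fin 2 → Cq)).flip (Pi.single i 1)

theorem append_induction {n : ℕ} {S : Submodule Cq (tpow (n + 1)).carrier}
    (h0 : ∀ v, append n 0 v ∈ S) (h1 : ∀ v, append n 1 v ∈ S) (v : (tpow (n + 1)).carrier) :
    v ∈ S := by
  change (tpow n).carrier ⊗[Cq] (Fin 2 → Cq) at v
  induction v using TensorProduct.induction_on with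
  | zero => exact S.zero_mem
  | tmul v w =>
    have hw : w = w 0 • Pi.single 0 1 + w 1 • Pi.single 1 1 := by
      ext i; fin_cases i <;> simp
    have h : (v ⊗ₜ[Cq] w : (tpow n).carrier ⊗[Cq] (Fin 2 → Cq)) =
        v ⊗ₜ[Cq] (w 0 • Pi.single 0 1) + v ⊗ₜ[Cq] (w 1 • Pi.single 1 1) := by
      rw [← TensorProduct.tmul_add, ← hw]
    rw [h, TensorProduct.tmul_smul, TensorProduct.tmul_smul]
    exact S.add_mem (S.smul_mem _ (h0 v)) (S.smul_mem _ (h1 v))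
  | add a b ha hb => exact S.add_mem ha hb

theorem append_ext {n : ℕ} {N : Type*} [AddCommGroup N] [Module Cq N]
    {φ χ : (tpow (n + 1)).carrier →ₗ[Cq] N} (h0 : ∀ v, φ (append n 0 v) = χ (append n 0 v))
    (h1 : ∀ v, φ (append n 1 v) = χ (append n 1 v)) (v : (tpow (n + 1)).carrier) : φ v = χ v :=
  append_induction (S := LinearMap.eqLocus φ χ) h0 h1 v

/-- An endomorphism `a ⊗ b` of `V^{⊗ (n+1)}`. -/
def tens (n : ℕ) (a : Module.End Cq (tpow n).carrier) (b : Module.End Cq (Fin 2 → Cq)) :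
    Module.End Cq (tpow (n + 1)).carrier := endTensor (tpow n) vec (a ⊗ₜ[Cq] b)

/-- The coefficients are the entries of column `i` of `b`. This turns the comultiplication into
recursions on the number of tensor factors. -/
theorem tens_append (n : ℕ) (a : Module.End Cq (tpow n).carrier) (b : Module.End Cq (Fin 2 → Cq))
    (i : Fin 2) (v : (tpow n).carrier) :
    tens n a b (append n i v) = b (Pi.single i 1) 0 • append n 0 (a v) +
      b (Pi.single i 1) 1 • append n 1 (a v) := by
  have h : tens n a b (append n i v) =
      (a v ⊗ₜ[Cq] b (Pi.single i 1) : (tpow n).carrier ⊗[Cq] (Fin 2 → Cq)) := rfl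
  have hw : b (Pi.single i 1) =
      b (Pi.single i 1) 0 • Pi.single 0 1 + b (Pi.single i 1) 1 • Pi.single 1 1 := by
    ext i; fin_cases i <;> simp
  rw [h, hw, TensorProduct.tmul_add, TensorProduct.tmul_smul, TensorProduct.tmul_smul, ← hw]
  rfl

theorem act_K1_eq (n : ℕ) : (tpow (n + 1)).act (Uq.gen .K1) =
    tens n ((tpow n).act (Uq.gen .K1)) (Matrix.toLin' !![qq, 0; 0, 1]) := by
  have h : vec.act (Uq.gen .K1) = Matrix.toLin' !![qq, 0; 0, 1] := vec_family.lift_gen .K1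
  refine (tensor_act_K1 (tpow n) vec).trans ?_
  rw [h]
  rfl

theorem act_K2_eq (n : ℕ) : (tpow (n + 1)).act (Uq.gen .K2) =
    tens n ((tpow n).act (Uq.gen .K2)) (Matrix.toLin' !![1, 0; 0, qq]) := by
  have h : vec.act (Uq.gen .K2) = Matrix.toLin' !![1, 0; 0, qq] := vec_family.lift_gen .K2
  refine (tensor_act_K2 (tpow n) vec).trans ?_
  rw [h]
  rfl

theorem act_F_eq (n : ℕ) : (tpow (n + 1)).act (Uq.gen .F) =
    tens n ((tpow n).act (Uq.gen .F)) 1 +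
      tens n ((tpow n).act (Uq.gen .K1) * (tpow n).act (Uq.gen .K2) * (tpow n).parity)
        (Matrix.toLin' !![0, 0; 1, 0]) := by
  have h : vec.act (Uq.gen .F) = Matrix.toLin' !![0, 0; 1, 0] := vec_family.lift_gen .F
  refine (tensor_act_F (tpow n) vec).trans ?_
  rw [h, map_add]
  rfl

theorem parity_eq (n : ℕ) : (tpow (n + 1)).parity =
    tens n (tpow n).parity (Matrix.toLin' !![1, 0; 0, -1]) := rfl

theorem act_K1_append_zero (n : ℕ) (v : (tpow n).carrier) :
    (tpow (n + 1)).act (Uq.gen .K1) (append n 0 v) =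
      qq • append n 0 ((tpow n).act (Uq.gen .K1) v) := by
  rw [act_K1_eq, tens_append]; simp

theorem act_K1_append_one (n : ℕ) (v : (tpow n).carrier) :
    (tpow (n + 1)).act (Uq.gen .K1) (append n 1 v) =
      append n 1 ((tpow n).act (Uq.gen .K1) v) := by
  rw [act_K1_eq, tens_append]; simp

theorem act_K2_append_zero (n : ℕ) (v : (tpow n).carrier) :
    (tpow (n + 1)).act (Uq.gen .K2) (append n 0 v) =
      append n 0 ((tpow n).act (Uq.gen .K2) v) := by
  rw [act_K2_eq, tens_append]; simp

theorem act_K2_append_one (n : ℕ) (v : (tpow n).carrier) :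
    (tpow (n + 1)).act (Uq.gen .K2) (append n 1 v) =
      qq • append n 1 ((tpow n).act (Uq.gen .K2) v) := by
  rw [act_K2_eq, tens_append]; simp

theorem parity_append_zero (n : ℕ) (v : (tpow n).carrier) :
    (tpow (n + 1)).parity (append n 0 v) = append n 0 ((tpow n).parity v) := by
  rw [parity_eq, tens_append]; simp

theorem parity_append_one (n : ℕ) (v : (tpow n).carrier) :
    (tpow (n + 1)).parity (append n 1 v) = -append n 1 ((tpow n).parity v) := by
  rw [parity_eq, tens_append]; simp

/-- The element `K = K_1 K_2` acts on `V^{⊗ n}` as `q^n`. -/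
theorem act_K1_act_K2 (n : ℕ) (v : (tpow n).carrier) :
    (tpow n).act (Uq.gen .K1) ((tpow n).act (Uq.gen .K2) v) = qq ^ n • v := by
  induction n with
  | zero =>
    have h1 : (tpow 0).act (Uq.gen .K1) = 1 := triv_family.lift_gen .K1
    have h2 : (tpow 0).act (Uq.gen .K2) = 1 := triv_family.lift_gen .K2
    rw [h1, h2, pow_zero, one_smul]
    rfl
  | succ n ih =>
    refine append_ext (φ := (tpow (n + 1)).act (Uq.gen .K1) ∘ₗ (tpow (n + 1)).act (Uq.gen .K2))
      (χ := qq ^ (n + 1) • LinearMap.id) (fun v => ?_) (fun v => ?_) v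
    · rw [LinearMap.comp_apply, act_K2_append_zero, act_K1_append_zero, ih, map_smul, smul_smul,
        ← pow_succ']
      rfl
    · rw [LinearMap.comp_apply, act_K2_append_one, map_smul, act_K1_append_one, ih, map_smul,
        smul_smul, ← pow_succ']
      rfl

/-- The second term comes from `K ⊗ F`: the scalar `q^n` is the action of `K` on the first `n`
factors, and the parity is the sign rule for the odd `F`. -/
theorem act_F_append_zero (n : ℕ) (v : (tpow n).carrier) :
    (tpow (n + 1)).act (Uq.gen .F) (append n 0 v) =
      append n 0 ((tpow n).act (Uq.gen .F) v) + qq ^ n • append n 1 ((tpow n).parity v) := by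
  rw [act_F_eq, LinearMap.add_apply, tens_append, tens_append, Module.End.mul_apply,
    Module.End.mul_apply, act_K1_act_K2]
  simp

theorem act_F_append_one (n : ℕ) (v : (tpow n).carrier) :
    (tpow (n + 1)).act (Uq.gen .F) (append n 1 v) = append n 1 ((tpow n).act (Uq.gen .F) v) := by
  rw [act_F_eq, LinearMap.add_apply, tens_append, tens_append]
  simp

/-- The operator `1 ⊗ ⋯ ⊗ 1 ⊗ E`, which is the wedge product with `e_n`. -/
def raiseTop : (n : ℕ) → Module.End Cq (tpow n).carrier
  | 0 => 0
  | n + 1 => tens n 1 (Matrix.toLin' !![0, 1; 0, 0])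

theorem raiseTop_append_zero (n : ℕ) (v : (tpow n).carrier) :
    raiseTop (n + 1) (append n 0 v) = 0 := by
  rw [raiseTop, tens_append]; simp

theorem raiseTop_append_one (n : ℕ) (v : (tpow n).carrier) :
    raiseTop (n + 1) (append n 1 v) = append n 0 v := by
  rw [raiseTop, tens_append]; simp

theorem act_K1_raiseTop (n : ℕ) (v : (tpow n).carrier) :
    (tpow n).act (Uq.gen .K1) (raiseTop n v) = qq • raiseTop n ((tpow n).act (Uq.gen .K1) v) := by
  cases n with
  | zero => simp [raiseTop]
  | succ n =>
    refine append_ext (φ := (tpow (n + 1)).act (Uq.gen .K1) ∘ₗ raiseTop (n + 1))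
      (χ := qq • raiseTop (n + 1) ∘ₗ (tpow (n + 1)).act (Uq.gen .K1)) (fun v => ?_) (fun v => ?_) v
    · rw [LinearMap.comp_apply, LinearMap.smul_apply, LinearMap.comp_apply, raiseTop_append_zero,
        act_K1_append_zero, map_smul, raiseTop_append_zero, map_zero, smul_zero, smul_zero]
    · rw [LinearMap.comp_apply, LinearMap.smul_apply, LinearMap.comp_apply, raiseTop_append_one,
        act_K1_append_zero, act_K1_append_one, raiseTop_append_one]

/-- The part `F ⊗ 1` commutes with `1 ⊗ E`, taken without sign. On the last factor `FE - EF` is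
minus the parity, so the part of `F` acting there contributes `-q^n` times the total parity. The
overall factor `q` is the coefficient of the lower term in `ℓ_{i+1} = e_{i+1} + q e_i`. At least one
tensor factor is required: on `V^{⊗ 0}` the raising operator is zero and the parity term would
remain. -/
theorem act_F_raiseTop (n : ℕ) (v : (tpow (n + 1)).carrier) :
    qq • (tpow (n + 1)).act (Uq.gen .F) (raiseTop (n + 1) v) +
      qq ^ (n + 1) • (tpow (n + 1)).parity v =
        qq • raiseTop (n + 1) ((tpow (n + 1)).act (Uq.gen .F) v) := by
  refine append_ext (φ := qq • (tpow (n + 1)).act (Uq.gen .F) ∘ₗ raiseTop (n + 1) +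
    qq ^ (n + 1) • (tpow (n + 1)).parity)
    (χ := qq • raiseTop (n + 1) ∘ₗ (tpow (n + 1)).act (Uq.gen .F)) (fun v => ?_) (fun v => ?_) v
  · simp only [LinearMap.add_apply, LinearMap.comp_apply, LinearMap.smul_apply,
      raiseTop_append_zero, act_F_append_zero, parity_append_zero, raiseTop_append_one, map_add,
      map_smul, map_zero, smul_zero, zero_add, smul_smul, ← pow_succ']
  · simp only [LinearMap.add_apply, LinearMap.comp_apply, LinearMap.smul_apply,
      act_F_append_zero, act_F_append_one, parity_append_one, raiseTop_append_one,
      smul_add, smul_neg, smul_smul, ← pow_succ', add_neg_cancel_right]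

/-! The canonical basis. -/

theorem std_succ_of_mem {n : ℕ} {y : Finset ℕ} (h : n ∈ y) :
    std y (n + 1) = append n 0 (std y n) := by
  rw [std, if_pos h]; rfl

theorem std_succ_of_notMem {n : ℕ} {y : Finset ℕ} (h : n ∉ y) :
    std y (n + 1) = append n 1 (std y n) := by
  rw [std, if_neg h]; rfl

/-- The first `n` tensor positions depend only on the elements below `n`. -/
theorem std_insert {m n : ℕ} (h : n ≤ m) (y : Finset ℕ) : std (insert m y) n = std y n := by
  induction n with
  | zero => rfl
  | succ n ih =>
    by_cases hy : n ∈ y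
    · rw [std_succ_of_mem hy, std_succ_of_mem (Finset.mem_insert_of_mem hy), ih (by omega)]
    · rw [std_succ_of_notMem hy, std_succ_of_notMem, ih (by omega)]
      simp only [Finset.mem_insert, not_or]
      exact ⟨by omega, hy⟩

theorem raiseTop_std {n : ℕ} (y : Finset ℕ) :
    raiseTop (n + 1) (std y (n + 1)) = if n ∈ y then 0 else std (insert n y) (n + 1) := by
  split_ifs with h
  · rw [std_succ_of_mem h, raiseTop_append_zero]
  · rw [std_succ_of_notMem h, raiseTop_append_one,
      std_succ_of_mem (Finset.mem_insert_self _ _), std_insert le_rfl]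

theorem shiftDown_subset {n : ℕ} {x T : Finset ℕ} (hx : x ⊆ Finset.range n) (hT : T ⊆ x) :
    shiftDown x T ⊆ Finset.range n := by
  intro a ha
  rcases Finset.mem_union.1 ha with h | h
  · exact hx (Finset.sdiff_subset h)
  · obtain ⟨b, hb, rfl⟩ := Finset.mem_image.1 h
    have := Finset.mem_range.1 (hx (hT hb))
    exact Finset.mem_range.2 (by omega)

theorem shiftDown_insert {n : ℕ} {x T : Finset ℕ} (hT : n ∉ T) :
    shiftDown (insert n x) T = insert n (shiftDown x T) := by
  rw [shiftDown, shiftDown, Finset.insert_sdiff_of_notMem _ hT, Finset.insert_union]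

theorem shiftDown_insert_insert {n : ℕ} {x T : Finset ℕ} (hx : n ∉ x) :
    shiftDown (insert n x) (insert n T) = insert (n - 1) (shiftDown x T) := by
  rw [shiftDown, shiftDown, Finset.image_insert, Finset.union_insert,
    Finset.insert_sdiff_of_mem _ (Finset.mem_insert_self _ _), Finset.sdiff_insert_of_notMem hx]

/-- No factor `ℓ_i` with `i ≤ n` involves `e_{n+1}`, so the last tensor position carries `v_1` in
every term. -/
theorem canon_succ {n : ℕ} {x : Finset ℕ} (hx : x ⊆ Finset.range n) :
    canon (n + 1) x = append n 1 (canon n x) := by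
  rw [canon, canon, map_sum]
  refine Finset.sum_congr rfl fun T hT => ?_
  have hT' : T ⊆ x := (Finset.mem_powerset.1 hT).trans (Finset.erase_subset _ _)
  rw [std_succ_of_notMem fun h => Finset.notMem_range_self (shiftDown_subset hx hT' h)]
  split_ifs
  · rw [map_smul]
  · rw [map_zero]

/-- Expansion of the leading factor `ℓ_{n+1} = e_{n+1} + q e_n`: choosing `e_{n+1}` puts `v_0` in
the last position, while choosing `q e_n` leaves `v_1` there and wedges `e_n` onto the vector of
`x`. -/
theorem canon_succ_insert {n : ℕ} {x : Finset ℕ} (hx : x ⊆ Finset.range n) :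
    canon (n + 1) (insert n x) =
      append n 0 (canon n x) + qq • append n 1 (raiseTop n (canon n x)) := by
  have hn : n ∉ x := fun h => Finset.notMem_range_self (hx h)
  cases n with
  | zero =>
    -- Here `ℓ_1 = e_1` has no lower term, in agreement with `raiseTop 0 = 0`.
    have : x = ∅ := by simpa using hx
    subst this
    simp [canon, shiftDown, raiseTop, std_succ_of_mem]
    rfl
  | succ m =>
    have he : (insert (m + 1) x).erase 0 = insert (m + 1) (x.erase 0) :=
      Finset.erase_insert_of_ne (by omega)
    -- The subsets `T` are split according to whether they contain `m + 1`, that is, by the term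
    -- chosen from the leading factor.
    rw [canon, he, Finset.sum_powerset_insert fun h => hn (Finset.mem_of_mem_erase h), canon]
    simp only [map_sum, Finset.smul_sum]
    congr 1
    · refine Finset.sum_congr rfl fun T hT => ?_
      have hT' : T ⊆ x := (Finset.mem_powerset.1 hT).trans (Finset.erase_subset _ _)
      have hnS : m + 1 ∉ shiftDown x T := fun h =>
        Finset.notMem_range_self (shiftDown_subset hx hT' h)
      rw [shiftDown_insert fun h => hn (hT' h), Finset.card_insert_of_notMem hnS,
        Finset.card_insert_of_notMem hn, std_succ_of_mem (Finset.mem_insert_self _ _),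
        std_insert le_rfl]
      simp only [Nat.add_right_cancel_iff]
      split_ifs
      · rw [map_smul]
      · rw [map_zero]
    · refine Finset.sum_congr rfl fun T hT => ?_
      have hT' : T ⊆ x := (Finset.mem_powerset.1 hT).trans (Finset.erase_subset _ _)
      have hnS : m + 1 ∉ shiftDown x T := fun h =>
        Finset.notMem_range_self (shiftDown_subset hx hT' h)
      have hnS' : m + 1 ∉ insert m (shiftDown x T) := by
        simp only [Finset.mem_insert, not_or]
        exact ⟨by omega, hnS⟩
      -- If the index `m` is already present, adding it again cannot raise the cardinality to
      -- `x.card + 1`, so the term is dropped; this matches the vanishing of the wedge product with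
      -- a repeated vector.
      have hle : (shiftDown x T).card ≤ x.card := by
        refine (Finset.card_union_le _ _).trans ?_
        have h1 := Finset.card_sdiff_add_card_eq_card hT'
        have h2 := Finset.card_image_le (s := T) (f := fun i => i - 1)
        omega
      rw [shiftDown_insert_insert hn, Nat.add_sub_cancel, Finset.card_insert_of_notMem hn,
        Finset.card_insert_of_notMem fun h => hn (hT' h), std_succ_of_notMem hnS']
      by_cases hm : m ∈ shiftDown x T
      · rw [Finset.insert_eq_of_mem hm, if_neg (by omega)]
        split_ifs
        · rw [map_smul, raiseTop_std, if_pos hm, smul_zero, map_zero, smul_zero]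
        · rw [map_zero, map_zero, smul_zero]
      · rw [Finset.card_insert_of_notMem hm]
        simp only [Nat.add_right_cancel_iff]
        split_ifs
        · rw [map_smul, raiseTop_std, if_neg hm, map_smul, smul_smul, pow_succ']
        · rw [map_zero, map_zero, smul_zero]

theorem subset_range_succ {n : ℕ} {x : Finset ℕ} (hx : x ⊆ Finset.range (n + 1)) :
    x ⊆ Finset.range n ∨ ∃ x', x' ⊆ Finset.range n ∧ x = insert n x' := by
  by_cases h : n ∈ x
  · refine Or.inr ⟨x.erase n, fun a ha => ?_, (Finset.insert_erase h).symm⟩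
    have h1 := Finset.mem_erase.1 ha
    have h2 := Finset.mem_range.1 (hx h1.2)
    exact Finset.mem_range.2 (by omega)
  · refine Or.inl fun a ha => ?_
    have h2 := Finset.mem_range.1 (hx ha)
    have h3 : a ≠ n := by rintro rfl; exact h ha
    exact Finset.mem_range.2 (by omega)

/-- The action of `F` on the canonical basis. -/
theorem act_F_canon {n : ℕ} {x : Finset ℕ} (hx : x ⊆ Finset.range n) :
    (tpow n).act (Uq.gen .F) (canon n x) = if 0 ∈ x then canon n (x.erase 0) else 0 := by
  induction n generalizing x with
  | zero =>
    have : x = ∅ := by simpa using hx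
    subst this
    have h1 : (tpow 0).act (Uq.gen .F) = 0 := triv_family.lift_gen .F
    rw [h1, LinearMap.zero_apply, if_neg (Finset.notMem_empty 0)]
  | succ n ih =>
    rcases subset_range_succ hx with hx | ⟨x, hx', rfl⟩
    · rw [canon_succ hx, act_F_append_one, ih hx]
      split_ifs
      · rw [canon_succ ((Finset.erase_subset _ _).trans hx)]
      · rw [map_zero]
    · rw [canon_succ_insert hx', map_add, map_smul, act_F_append_zero, act_F_append_one, ih hx']
      cases n with
      | zero =>
        -- This is the case `F v_0 = v_1`: there is no lower term to cancel the parity term, which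
        -- becomes the canonical vector with `0` removed.
        have : x = ∅ := by simpa using hx'
        subst this
        have h1 : canon 1 ∅ = append 0 1 (canon 0 ∅) := canon_succ hx'
        have h2 : (tpow 0).parity = 1 := rfl
        simp [raiseTop, h1, h2]
      | succ m =>
        -- With `v` the vector of `x`, the two terms ending in `v_1`, namely the parity term and `q
        -- F(e_{m+1} ∧ v)`, combine to `q e_{m+1} ∧ F v`. What remains is the expansion of
        -- `canon_succ_insert` with `F v` in place of `v`.
        have h := congrArg (append (m + 1) 1) (act_F_raiseTop m (canon (m + 1) x))
        simp only [map_add, map_smul] at h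
        have he : (insert (m + 1) x).erase 0 = insert (m + 1) (x.erase 0) :=
          Finset.erase_insert_of_ne (by omega)
        have h0 : 0 ∈ insert (m + 1) x ↔ 0 ∈ x := by simp
        rw [add_assoc (append (m + 1) 0 _), add_comm (qq ^ (m + 1) • _), h, ih hx',
          if_congr h0 rfl rfl, he]
        split_ifs
        · rw [canon_succ_insert ((Finset.erase_subset _ _).trans hx')]
        · rw [map_zero, map_zero, map_zero, smul_zero, add_zero]

theorem act_K1_canon {n : ℕ} {x : Finset ℕ} (hx : x ⊆ Finset.range n) :
    (tpow n).act (Uq.gen .K1) (canon n x) = qq ^ x.card • canon n x := by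
  induction n generalizing x with
  | zero =>
    have : x = ∅ := by simpa using hx
    subst this
    have h1 : (tpow 0).act (Uq.gen .K1) = 1 := triv_family.lift_gen .K1
    rw [h1, Module.End.one_apply, Finset.card_empty, pow_zero, one_smul]
  | succ n ih =>
    rcases subset_range_succ hx with hx | ⟨x, hx', rfl⟩
    · rw [canon_succ hx, act_K1_append_one, ih hx, map_smul]
    · rw [canon_succ_insert hx', map_add, map_smul, act_K1_append_zero, act_K1_append_one,
        act_K1_raiseTop, ih hx', Finset.card_insert_of_notMem fun h =>
          Finset.notMem_range_self (hx' h)]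
      simp only [map_smul, smul_add, smul_smul]
      congr 2 <;> ring

/-- Only the eigenvalue of `K_1` has to be computed; that of `K_2` follows because `K_1 K_2` acts as
`q^n`. -/
theorem canon_mem_weightSpace {n : ℕ} {x : Finset ℕ} (hx : x ⊆ Finset.range n) :
    canon n x ∈ weightSpace n x.card := by
  refine mem_weightSpace.2 ⟨act_K1_canon hx, ?_⟩
  have h1 := act_K1_act_K2 n (canon n x)
  have h2 : (tpow n).act (Uq.gen .K1) ((tpow n).act (Uq.gen .K2) (canon n x)) =
      (tpow n).act (Uq.gen .K2) ((tpow n).act (Uq.gen .K1) (canon n x)) := by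
    rw [← Module.End.mul_apply, ← Module.End.mul_apply, ← map_mul, ← map_mul, Uq.family.comm]
  rw [h2, act_K1_canon hx, map_smul] at h1
  rw [zpow_sub₀ qq_ne_zero, zpow_natCast, zpow_natCast, div_eq_inv_mul, mul_smul, ← h1,
    inv_smul_smul₀ (pow_ne_zero _ qq_ne_zero)]

/-- The recursion is triangular. Appending `v_1` to canonical vectors gives canonical vectors, so
everything ending in `v_1` is in the span; a canonical vector followed by `v_0` differs from the
canonical vector of `insert n x` by something ending in `v_1`. -/
theorem mem_span_canon (n : ℕ) (v : (tpow n).carrier) :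
    v ∈ Submodule.span Cq (Set.range fun x : (Finset.range n).powerset => canon n x.1) := by
  induction n with
  | zero =>
    have h1 : canon 0 ∅ = (1 : Cq) := by
      simp [canon, shiftDown]
      rfl
    have h2 : v = (show Cq from v) • canon 0 ∅ := by
      rw [h1]
      exact (mul_one (show Cq from v)).symm
    rw [h2]
    exact Submodule.smul_mem _ _ (Submodule.subset_span ⟨⟨∅, by simp⟩, rfl⟩)
  | succ n ih =>
    have h1 : ∀ v, append n 1 v ∈ Submodule.span Cq
        (Set.range fun x : (Finset.range (n + 1)).powerset => canon (n + 1) x.1) := by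
      intro v
      induction ih v using Submodule.span_induction with
      | mem v hv =>
        obtain ⟨⟨x, hx⟩, rfl⟩ := hv
        have hx := Finset.mem_powerset.1 hx
        rw [← canon_succ hx]
        exact Submodule.subset_span ⟨⟨x, Finset.mem_powerset.2
          (hx.trans (Finset.range_subset_range.2 n.le_succ))⟩, rfl⟩
      | zero => rw [map_zero]; exact zero_mem _
      | add v w _ _ hv hw => rw [map_add]; exact add_mem hv hw
      | smul c v _ hv => rw [map_smul]; exact Submodule.smul_mem _ _ hv
    refine append_induction (fun v => ?_) h1 v
    induction ih v using Submodule.span_induction with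
    | mem v hv =>
      obtain ⟨⟨x, hx⟩, rfl⟩ := hv
      have hx := Finset.mem_powerset.1 hx
      rw [← add_sub_cancel_right (append n 0 (canon n x))
        (qq • append n 1 (raiseTop n (canon n x))), ← canon_succ_insert hx]
      refine sub_mem (Submodule.subset_span ⟨⟨insert n x, Finset.mem_powerset.2 ?_⟩, rfl⟩)
        (Submodule.smul_mem _ _ (h1 _))
      exact Finset.insert_subset (Finset.self_mem_range_succ n)
        (hx.trans (Finset.range_subset_range.2 n.le_succ))
    | zero => rw [map_zero]; exact zero_mem _
    | add v w _ _ hv hw => rw [map_add]; exact add_mem hv hw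
    | smul c v _ hv => rw [map_smul]; exact Submodule.smul_mem _ _ hv

theorem finrank_tpow (n : ℕ) : Module.finrank Cq (tpow n).carrier = 2 ^ n := by
  induction n with
  | zero => exact Module.finrank_self Cq
  | succ n ih =>
    change Module.finrank Cq ((tpow n).carrier ⊗[Cq] (Fin 2 → Cq)) = _
    rw [Module.finrank_tensorProduct, ih, Module.finrank_fin_fun, pow_succ]

/-- The canonical basis of `V^{⊗ n}`. -/
def canonBasis (n : ℕ) : Module.Basis (Finset.range n).powerset Cq (tpow n).carrier :=
  basisOfTopLeSpanOfCardEqFinrank (fun x => canon n x.1) (fun v _ => mem_span_canon n v) (by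
    rw [finrank_tpow, Fintype.card_coe, Finset.card_powerset, Finset.card_range])

theorem canonBasis_apply (n : ℕ) (x : (Finset.range n).powerset) :
    canonBasis n x = canon n x.1 := by
  rw [canonBasis, coe_basisOfTopLeSpanOfCardEqFinrank]

/-- Distinct powers of the variable have distinct degrees as polynomials. This makes the eigenvalues
of `K_1` separate the numbers `k`. -/
theorem qq_pow_injective : Function.Injective fun i : ℕ => qq ^ i := by
  intro i j h
  have h1 : algebraMap (Polynomial ℂ) Cq (Polynomial.X ^ i) =
      algebraMap (Polynomial ℂ) Cq (Polynomial.X ^ j) := by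
    rw [map_pow, map_pow, RatFunc.algebraMap_X]
    exact h
  have h2 := congrArg Polynomial.natDegree (RatFunc.algebraMap_injective ℂ h1)
  simpa using h2

/-- The canonical basis diagonalises `K_1`: the coordinate at `x` of `K_1 v` is `q^{|x|}` times that
of `v`, but also `q^k` times it. -/
theorem canonBasis_repr_eq_zero {n k : ℕ} {v : (tpow n).carrier} (hv : v ∈ weightSpace n k)
    (x : (Finset.range n).powerset) (hx : x.1.card ≠ k) : (canonBasis n).repr v x = 0 := by
  have h : (canonBasis n).coord x ∘ₗ (tpow n).act (Uq.gen .K1) =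
      qq ^ x.1.card • (canonBasis n).coord x := by
    refine (canonBasis n).ext fun y => ?_
    rw [LinearMap.comp_apply, canonBasis_apply, act_K1_canon (Finset.mem_powerset.1 y.2),
      map_smul, LinearMap.smul_apply, ← canonBasis_apply, Module.Basis.coord_apply,
      Module.Basis.repr_self]
    by_cases hxy : y = x
    · rw [hxy]
    · rw [Finsupp.single_eq_of_ne (Ne.symm hxy), smul_zero, smul_zero]
  have h1 := LinearMap.congr_fun h v
  rw [LinearMap.comp_apply, (mem_weightSpace.1 hv).1, map_smul, LinearMap.smul_apply,
    ← sub_eq_zero, ← sub_smul] at h1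
  refine (smul_eq_zero.1 h1).resolve_left fun h0 => hx ?_
  exact (qq_pow_injective (sub_eq_zero.1 h0)).symm

theorem LState.subset_range {n k : ℕ} (x : LState n k) : x.1.1 ⊆ Finset.range n := by
  rcases subset_range_succ (Finset.mem_powersetCard.1 x.1.2).1 with h | ⟨y, -, h⟩
  · exact h
  · exact absurd (h ▸ Finset.mem_insert_self _ _) x.2

theorem LState.card {n k : ℕ} (x : LState n k) : x.1.1.card = k :=
  (Finset.mem_powersetCard.1 x.1.2).2

/-- The canonical basis vectors, in the weight space. -/
def canonWeight {n k : ℕ} (x : LState n k) : weightSpace n k :=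
  ⟨canon n x.1.1, by
    have := canon_mem_weightSpace (LState.subset_range x)
    rwa [LState.card] at this⟩

theorem linearIndependent_canonWeight (n k : ℕ) :
    LinearIndependent Cq (canonWeight (n := n) (k := k)) := by
  refine LinearIndependent.of_comp (Submodule.subtype _) ?_
  have h := (canonBasis n).linearIndependent.comp
    (fun x : LState n k => (⟨x.1.1, Finset.mem_powerset.2 (LState.subset_range x)⟩ :
      (Finset.range n).powerset)) fun x y hxy =>
        Subtype.ext (Subtype.ext (Subtype.mk.inj hxy))
  convert h using 1
  funext x
  exact (canonBasis_apply n ⟨x.1.1, Finset.mem_powerset.2 (LState.subset_range x)⟩).symm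

/-- In the expansion of a weight vector in the canonical basis of `V^{⊗ n}` only subsets `x` with
`k` elements survive, and these are precisely the left I-states. -/
theorem span_canonWeight (n k : ℕ) :
    ⊤ ≤ Submodule.span Cq (Set.range (canonWeight (n := n) (k := k))) := by
  rintro ⟨v, hv⟩ -
  have h1 : v ∈ (Submodule.span Cq (Set.range (canonWeight (n := n) (k := k)))).map
      (Submodule.subtype _) := by
    rw [← (canonBasis n).sum_repr v]
    refine sum_mem fun x _ => ?_
    by_cases hx : x.1.card = k
    · have hx' := Finset.mem_powerset.1 x.2
      refine Submodule.smul_mem _ _ ⟨_, Submodule.subset_span ⟨⟨⟨x.1, Finset.mem_powersetCard.2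
        ⟨hx'.trans (Finset.range_subset_range.2 n.le_succ), hx⟩⟩, fun h =>
          Finset.notMem_range_self (hx' h)⟩, rfl⟩, ?_⟩
      exact (canonBasis_apply n x).symm
    · rw [canonBasis_repr_eq_zero hv x hx, zero_smul]
      exact zero_mem _
  obtain ⟨w, hw, rfl⟩ := h1
  exact hw

/-- The canonical basis of a weight space. -/
def weightBasis (n k : ℕ) : Module.Basis (LState n k) Cq (weightSpace n k) :=
  Module.Basis.mk (linearIndependent_canonWeight n k) (span_canonWeight n k)

theorem weightBasis_apply {n k : ℕ} (x : LState n k) :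
    (weightBasis n k x : (tpow n).carrier) = canon n x.1.1 :=
  congrArg Subtype.val (Module.Basis.mk_apply _ _ x)

end SuperMod

end

end OSz

/-! ### Matching the two bases -/

namespace OSz

noncomputable section

universe u

open OSzAlg SuperMod TensorProduct LaurentPolynomial

variable (𝕜 : Type u) [Field 𝕜] (n k : ℕ)

/-- The basis of the Grothendieck group over `ℂ(q)` given by the classes of the `P(x)`. -/
def K0CBasis : Module.Basis (LState n k) Cq (OSzK0C 𝕜 n k) := (K0.basis 𝕜 n k).baseChange Cq

variable {n k} in
theorem K0CBasis_apply (x : LState n k) :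
    K0CBasis 𝕜 n k x = 1 ⊗ₜ[ℤ[T;T⁻¹]] K0.cls (projP (R := 𝕜) x) := by
  rw [K0CBasis, Module.Basis.baseChange_apply, K0.basis_apply]

variable [NeZero n]

/-- The identification of the Grothendieck group with the weight space. -/
def canonicalIdent : OSzK0C 𝕜 n k ≃ₗ[Cq] weightSpace n k :=
  (K0CBasis 𝕜 n k).equiv (weightBasis n k) (Equiv.refl _)

theorem isCanonicalIdent_canonicalIdent : IsCanonicalIdent (canonicalIdent 𝕜 n) := by
  intro k x
  rw [← K0CBasis_apply, canonicalIdent, Module.Basis.equiv_apply, Equiv.refl_apply,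
    weightBasis_apply]

variable {𝕜 n k}

theorem IsCanonicalIdent.ext {Φ Φ' : (k : ℕ) → OSzK0C 𝕜 n k ≃ₗ[Cq] weightSpace n k}
    (h : IsCanonicalIdent Φ) (h' : IsCanonicalIdent Φ') : Φ = Φ' := by
  funext k
  refine LinearEquiv.toLinearMap_injective ((K0CBasis 𝕜 n k).ext fun x => Subtype.ext ?_)
  rw [K0CBasis_apply]
  exact (h k x).trans (h' k x).symm

/-- By linearity it is enough to compare on the basis of classes `[P(x)]`. There the functor and `F`
follow the same rule: remove `0` from `x` if it is present, and give zero otherwise. -/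
theorem IsCanonicalIdent.map_K0FC {Φ : (k : ℕ) → OSzK0C 𝕜 n k ≃ₗ[Cq] weightSpace n k}
    (h : IsCanonicalIdent Φ) (k : ℕ) (z : OSzK0C 𝕜 n (k + 1)) :
    (Φ k (K0FC 𝕜 n k z) : (tpow n).carrier) =
      (tpow n).act (Uq.gen UGen.F) (Φ (k + 1) z : (tpow n).carrier) := by
  have key : (weightSpace n k).subtype ∘ₗ (Φ k).toLinearMap ∘ₗ K0FC 𝕜 n k =
      (tpow n).act (Uq.gen UGen.F) ∘ₗ (weightSpace n (k + 1)).subtype ∘ₗ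
        (Φ (k + 1)).toLinearMap := by
    refine (K0CBasis 𝕜 n (k + 1)).ext fun x => ?_
    rw [K0CBasis_apply]
    change (Φ k (K0FC 𝕜 n k (1 ⊗ₜ K0.cls (projP x))) : (tpow n).carrier) =
      (tpow n).act (Uq.gen UGen.F) (Φ (k + 1) (1 ⊗ₜ K0.cls (projP x)) : (tpow n).carrier)
    rw [h (k + 1) x, act_F_canon (LState.subset_range x), K0FC, LinearMap.baseChange_tmul, K0F_cls]
    split_ifs with hx
    · rw [K0.cls_of_grIso (grIso_tensorF_projP x hx)]
      exact h k (x.removeZero hx)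
    · have := subsingleton_tensorF_projP (R := 𝕜) x hx
      rw [K0.cls_of_subsingleton, tmul_zero, map_zero]
      rfl
  exact LinearMap.congr_fun key z

end

end OSz

open OSz OSz.OSzAlg OSz.SuperMod in
theorem mainTheorem8 (n : ℕ) [NeZero n] :
    -- over any commutative ring: the bimodule and the functor square to zero
    (∀ (R : Type*) [CommRing R] (k : ℕ),
      Subsingleton (BTensor (OSzAlg R n (k + 1)) (OSzAlg R n k) (FBim R n k) (FBim R n (k + 1))) ∧
      (∀ M : OSzProj R n (k + 2), Subsingleton (tensorF (tensorF M)).carrier) ∧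
      -- the values of the functor on the modules `P(x)`
      ∀ x : LState n (k + 1),
        (∀ h : 0 ∈ x.1.1, GrIso (tensorF (projP (R := R) x)) (projP (x.removeZero h))) ∧
        (0 ∉ x.1.1 → Subsingleton (tensorF (projP (R := R) x)).carrier)) ∧
    -- over any field: the identification with `V^{⊗ n}` and the action of `F`
    (∀ (𝕜 : Type*) [Field 𝕜],
      (∃! Φ : (k : ℕ) → OSzK0C 𝕜 n k ≃ₗ[Cq] weightSpace n k, IsCanonicalIdent Φ) ∧
      ∀ Φ : (k : ℕ) → OSzK0C 𝕜 n k ≃ₗ[Cq] weightSpace n k, IsCanonicalIdent Φ →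
        ∀ (k : ℕ) (z : OSzK0C 𝕜 n (k + 1)),
          (Φ k (K0FC 𝕜 n k z) : (tpow n).carrier) =
            (tpow n).act (Uq.gen UGen.F) (Φ (k + 1) z : (tpow n).carrier)) :=
  ⟨fun R _ k => ⟨subsingleton_FBim_tensor_FBim R n k, subsingleton_tensorF_tensorF,
      fun x => ⟨grIso_tensorF_projP x, subsingleton_tensorF_projP x⟩⟩,
    fun 𝕜 _ => ⟨⟨canonicalIdent 𝕜 n, isCanonicalIdent_canonicalIdent 𝕜 n,
      fun _ h => h.ext (isCanonicalIdent_canonicalIdent 𝕜 n)⟩, fun _ h => h.map_K0FC⟩⟩
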